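/- **Setting.** Let $\mathcal B$ be a finite set of at least two real numbers, $\gamma=\min\mathcal B\ge 1$, $\Gamma=\max\mathcal B$, and $\theta_\beta(x)=1/(x+\beta)$ for $\beta\in\mathcal B$. For $s\ge 0$ let $\lambda_s$ be the spectral radius of the operator $(L_sf)(x)=\sum_{\beta\in\mathcal B}|\theta_\beta'(x)|^s f(\theta_\beta(x))$ on $C([0,1])$. For $\nu\ge1$ and $\omega=(\beta_1,\dots,\beta_\nu)\in\Omega_\nu:=\mathcal B^\nu$ put $\theta_\omega=\theta_{\beta_1}\circ\cdots\circ\theta_{\beta_\nu}$ and $g_\omega=|\theta_\omega'|$. Put $\mathfrak a_0=0$, $\mathfrak b_0=1/\gamma$, $\mathfrak a_{k+1}=\theta_\Gamma(\mathfrak b_k)$, $\mathfrak b_{k+1}=\theta_\gamma(\mathfrak a_k)$, $\mathfrak a_\infty=-\frac\gamma2+\sqrt{\frac{\gamma^2}{4}+\frac{\gamma}{\Gamma}}$, $\mathfrak b_\infty=-\frac\Gamma2+\sqrt{\frac{\Gamma^2}{4}+\frac{\Gamma}{\gamma}}$ (the limits of $\mathfrak a_k,\mathfrak b_k$), $S=[\mathfrak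 a_\infty,\mathfrak b_\infty]$, $\chi=2\mathfrak a_\infty+\gamma$. Let $\tilde B_0=1$, $\tilde B_1=\gamma$, $\tilde B_{j+1}=\tilde B_{j-1}+\gamma\tilde B_j$, $c(\nu)=(\tilde B_{\nu-1}\mathfrak a_\infty+\tilde B_\nu)^{-2}$, $\psi(r)=\frac2\pi\ln(r+1)+\frac34$, and $\eta(r)=\frac12$ for $r$ even, $\eta(r)=\frac12[1+\tan\frac{\pi}{2r+2}]$ for $r$ odd. Let $\kappa_1=c(\nu)\,2\eta(r)r^2\psi(r)$. **Meshes.** Let $[a_i,b_i]\subset S$ ($1\le i\le I$, $a_i<b_i$) be pairwise disjoint intervals such that for every $\omega\in\Omega_\nu$ there is an $i$ with $\theta_\omega(S)\subset[a_i,b_i]$. Let $N_i\ge1$ be integers, $h_i=(b_i-a_i)/N_i$, $t^i_j=a_i+jh_i$, $h=\max_ih_i$, $\mu=h/\min_ih_i$. Let $\hat c_k=-\cos\left(\frac{2k+1}{2r+2}\pi\right)/\cos\frac{\pi}{2r+2}$ for $0\le k\le r$, $c^i_{j,k}=t^i_{j-1}+\frac{h_i}{2}(1+\hat c_k)$ for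 $1\le j\le N_i$, and let $T$ be the set of all the points $c^i_{j,k}$. For $F:T\to\mathbb R$ let $\mathcal F$ be the continuous function on $\bigcup_i[a_i,b_i]$ that agrees with $F$ on $T$ and is a polynomial of degree $\le r$ on every $[t^i_{j-1},t^i_j]$. Let $\mathbf L_{s,\nu}$ be the matrix of the linear map $(\mathbf L_{s,\nu}F)(\xi)=\sum_{\omega\in\Omega_\nu}g_\omega(\xi)^s\mathcal F(\theta_\omega(\xi))$, $\xi\in T$, of $\mathbb R^T$ to itself, and let $R(\mathbf L_{s,\nu})$ be its spectral radius. Let $$G=\frac{(2s)(2s+1)\cdots(2s+r)}{\chi^{r+1}}\,e^{2sh/\chi}\,\frac{1}{(r+1)!}\Big[\frac{1}{2\cos(\pi/(2r+2))}\Big]^{r+1}\frac1{2^r},\qquad H=\mu\Big[\frac{1}{\sin(\pi/(2r+2))}\Big]^2G\,\frac{\chi}{2s},$$ where in $H$ the factor $2s$ of $G$ is cancelled if $s=0$. **Theorem 8.2.** Let $r\ge2$, $\nu\ge1$, $\chi\ge1$, $0\le s\le3/2$ and $\kappa_1<1$. (a) Let $\kappa_1<\kappa_2<1$. Let $M_0$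 be a constant with $g_\omega(x)\le e^{M_0|x-y|}g_\omega(y)$ for all $x,y\in S$ and $\omega\in\Omega_\nu$, and suppose that $$M:=\frac{4s}{\mathfrak a_\infty+\mathfrak a_{\nu-1}+\gamma}\,\frac1{\kappa_2-\kappa_1}\ \ge\ \frac{2sM_0}{\kappa_2-\kappa_1}.$$ Suppose that $h\le 0.2$ and that, with $u=M\eta(r)h$, $$\psi(r)ue^u<1,\qquad \frac{\kappa_1e^u}{1-\psi(r)ue^u}<\kappa_2-\frac{sM_0}{M},\qquad 2+Hh^r(1+h^{2r+2})+h^2\le\frac{2}{\kappa_2-\kappa_1}$$ (for $s=0$, $sM_0/M$ is read as $0$). Then $$[(1+Hh^r)^{-1}R(\mathbf L_{s,\nu})]^{1/\nu}\le\lambda_s,$$ and if moreover $Hh^r<1$, then $$\lambda_s\le[(1-Hh^r)^{-1}R(\mathbf L_{s,\nu})]^{1/\nu}.$$ (b) The entries of $(1+Hh^r)^{-1}\mathbf L_{s,\nu}$ and $(1-Hh^r)^{-1}\mathbf L_{s,\nu}$ differ by $O(h^r)$: for every $\mu_0$ there are $C$ and $h_0>0$, depending only on $\mathcal B,r,\nu,s,\mu_0$,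 such that for every mesh with $\mu\le\mu_0$ and $h\le h_0$ all entries of the difference of the two matrices are at most $Ch^r$ in absolute value. -/

import Mathlib

open scoped BigOperators

noncomputable section

namespace CFTransfer

/-- A finite set of at least two distinct real numbers, all of them `≥ 1`. -/
structure Digits where
  carrier : Finset ℝ
  one_le : ∀ β ∈ carrier, 1 ≤ β
  nontrivial : carrier.Nontrivial

/-- The map `θ_β(x) = 1 / (x + β)`. -/
def theta (β x : ℝ) : ℝ := 1 / (x + β)

lemma hasDerivAt_theta {β x : ℝ} (h : x + β ≠ 0) :
    HasDerivAt (theta β) (-(1 / (x + β) ^ 2)) x := by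
  have h1 : HasDerivAt (fun y : ℝ => y + β) 1 x := (hasDerivAt_id x).add_const β
  have h2 := h1.inv h
  have h3 : theta β = (fun y : ℝ => y + β)⁻¹ := by
    funext y
    simp [theta]
  rw [h3]
  rwa [neg_div] at h2

namespace Digits

variable (𝓑 : Digits)

/-- `γ`, the smallest digit. -/
def γ : ℝ := 𝓑.carrier.min' 𝓑.nontrivial.nonempty

/-- `Γ`, the largest digit. -/
def Γ : ℝ := 𝓑.carrier.max' 𝓑.nontrivial.nonempty

/-- Words of length `ν` in the digits. -/
abbrev Word (ν : ℕ) : Type := Fin ν → 𝓑.carrier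

end Digits

/-- `θ_ω = θ_{β₁} ∘ θ_{β₂} ∘ ⋯ ∘ θ_{β_ν}` for `ω = (β₁, …, β_ν)`. -/
def thetaWord {𝓑 : Digits} {ν : ℕ} (ω : 𝓑.Word ν) : ℝ → ℝ :=
  fun x => (List.ofFn ω).foldr (fun β y => theta β y) x

/-- `g_ω = |θ_ω'|`. -/
def gWord {𝓑 : Digits} {ν : ℕ} (ω : 𝓑.Word ν) (x : ℝ) : ℝ := |deriv (thetaWord ω) x|

/-! ### The transfer operator and its spectral radius -/

section Transfer

variable (𝓑 : Digits)

lemma Digits.add_pos (β : 𝓑.carrier) (x : Set.Icc (0 : ℝ) 1) : 0 < (x : ℝ) + β := by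
  have := 𝓑.one_le β β.2
  have := x.2.1
  linarith

/-- `θ_β` as a continuous self-map of `[0, 1]`. -/
def thetaC (β : 𝓑.carrier) : C(Set.Icc (0 : ℝ) 1, Set.Icc (0 : ℝ) 1) where
  toFun x := ⟨theta β x, by
    have h := 𝓑.add_pos β x
    have h1 := 𝓑.one_le β β.2
    have h0 := x.2.1
    refine ⟨by unfold theta; positivity, ?_⟩
    unfold theta
    rw [div_le_one h]
    linarith⟩
  continuous_toFun := by
    refine Continuous.subtype_mk ?_ _
    unfold theta
    exact continuous_const.div (by fun_prop) fun x => (𝓑.add_pos β x).ne'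

/-- The weight `x ↦ |θ_β'(x)|^s` on `[0, 1]`, with complex values. -/
def weightC (s : ℝ) (β : 𝓑.carrier) : C(Set.Icc (0 : ℝ) 1, ℂ) where
  toFun x := ((|deriv (theta β) x| ^ s : ℝ) : ℂ)
  continuous_toFun := by
    have h : ∀ x : Set.Icc (0 : ℝ) 1, |deriv (theta β) x| = 1 / ((x : ℝ) + β) ^ 2 := fun x => by
      have hx := 𝓑.add_pos β x
      rw [(hasDerivAt_theta hx.ne').deriv, abs_neg, abs_of_pos (by positivity)]
    simp_rw [h]
    refine Complex.continuous_ofReal.comp (Continuous.rpow_const ?_ fun x => Or.inl ?_)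
    · exact continuous_const.div (by fun_prop) fun x => pow_ne_zero _ (𝓑.add_pos β x).ne'
    · have hx := 𝓑.add_pos β x
      positivity

/-- Composition `f ↦ f ∘ θ_β` on `C([0, 1])`. -/
def compTheta (β : 𝓑.carrier) :
    C(Set.Icc (0 : ℝ) 1, ℂ) →L[ℂ] C(Set.Icc (0 : ℝ) 1, ℂ) where
  toLinearMap := (ContinuousMap.compRightAlgHom ℂ ℂ (thetaC 𝓑 β)).toLinearMap
  cont := ContinuousMap.compRightAlgHom_continuous ℂ ℂ (thetaC 𝓑 β)

/-- The transfer operator `(L_s f)(x) = ∑_β |θ_β'(x)|^s f(θ_β(x))` on `C([0, 1])`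
(on complex-valued functions, that is, the complexification of the operator on real ones). -/
def transferOp (s : ℝ) : C(Set.Icc (0 : ℝ) 1, ℂ) →L[ℂ] C(Set.Icc (0 : ℝ) 1, ℂ) :=
  ∑ β : 𝓑.carrier, (ContinuousLinearMap.mul ℂ C(Set.Icc (0 : ℝ) 1, ℂ) (weightC 𝓑 s β)).comp
    (compTheta 𝓑 β)

lemma transferOp_apply (s : ℝ) (f : C(Set.Icc (0 : ℝ) 1, ℂ)) (x : Set.Icc (0 : ℝ) 1) :
    transferOp 𝓑 s f x =
      ∑ β : 𝓑.carrier, ((|deriv (theta β) x| ^ s : ℝ) : ℂ) * f (thetaC 𝓑 β x) := by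
  simp only [transferOp, sum_apply, ContinuousMap.sum_apply]
  rfl

/-- `λ_s`, the spectral radius of `L_s`. -/
def lam (s : ℝ) : ℝ := (spectralRadius ℂ (transferOp 𝓑 s)).toReal

end Transfer

/-- The spectral radius of a real square matrix: the largest modulus of a complex eigenvalue. -/
def matrixSpectralRadius {n : Type*} [Fintype n] [DecidableEq n] (A : Matrix n n ℝ) : ℝ :=
  (spectralRadius ℂ (A.map (fun t : ℝ => (t : ℂ)))).toReal

/-! ### Constants attached to the digits -/

namespace Digits

variable (𝓑 : Digits)

/-- `(𝔞_k, 𝔟_k)`: `𝔞_0 = 0`, `𝔟_0 = 1/γ`, `𝔞_{k+1} = θ_Γ(𝔟_k)`, `𝔟_{k+1} = θ_γ(𝔞_k)`. -/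
def ends : ℕ → ℝ × ℝ
  | 0 => (0, 1 / 𝓑.γ)
  | k + 1 => (theta 𝓑.Γ (ends k).2, theta 𝓑.γ (ends k).1)

/-- `𝔞_∞`, the limit of the `𝔞_k`. -/
def aInf : ℝ := -(𝓑.γ / 2) + Real.sqrt ((𝓑.γ / 2) ^ 2 + 𝓑.γ / 𝓑.Γ)

/-- `𝔟_∞`, the limit of the `𝔟_k`. -/
def bInf : ℝ := -(𝓑.Γ / 2) + Real.sqrt ((𝓑.Γ / 2) ^ 2 + 𝓑.Γ / 𝓑.γ)

/-- The interval `S = [𝔞_∞, 𝔟_∞]`. -/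
def S : Set ℝ := Set.Icc 𝓑.aInf 𝓑.bInf

/-- `χ = 2 𝔞_∞ + γ`. -/
def χ : ℝ := 2 * 𝓑.aInf + 𝓑.γ

/-- `B̃_0 = 1`, `B̃_1 = γ`, `B̃_{j+1} = B̃_{j-1} + γ B̃_j`. -/
def Btilde : ℕ → ℝ
  | 0 => 1
  | 1 => 𝓑.γ
  | j + 2 => Btilde j + 𝓑.γ * Btilde (j + 1)

/-- `c(ν)`, the largest Lipschitz constant on `S` of the maps `θ_ω` with `ω` of length `ν`. -/
def c (ν : ℕ) : ℝ := ((𝓑.Btilde (ν - 1) * 𝓑.aInf + 𝓑.Btilde ν) ^ 2)⁻¹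

end Digits

/-- `η(r)`. -/
def eta (r : ℕ) : ℝ :=
  if Even r then 1 / 2 else 1 / 2 * (1 + Real.tan (Real.pi / (2 * r + 2)))

/-- `ψ(r) = (2/π) ln(r+1) + 3/4`. -/
def psi (r : ℕ) : ℝ := 2 / Real.pi * Real.log (r + 1) + 3 / 4

/-- `κ₁ = c(ν) · 2 η(r) r² ψ(r)`. -/
def kappa₁ (𝓑 : Digits) (r ν : ℕ) : ℝ := 𝓑.c ν * (2 * eta r * (r : ℝ) ^ 2 * psi r)

/-- `M = 4s / (𝔞_∞ + 𝔞_{ν-1} + γ) · 1 / (κ₂ - κ₁)`. -/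
def Mconst (𝓑 : Digits) (s : ℝ) (r ν : ℕ) (κ₂ : ℝ) : ℝ :=
  4 * s / (𝓑.aInf + (𝓑.ends (ν - 1)).1 + 𝓑.γ) * (1 / (κ₂ - kappa₁ 𝓑 r ν))

/-- The constant `G_{r+1}`, for mesh size `h`. -/
def Gconst (𝓑 : Digits) (s : ℝ) (r : ℕ) (h : ℝ) : ℝ :=
  (∏ j ∈ Finset.range (r + 1), (2 * s + j)) / 𝓑.χ ^ (r + 1) * Real.exp (2 * s * h / 𝓑.χ) *
    (1 / ((r + 1).factorial : ℝ)) * (1 / (2 * Real.cos (Real.pi / (2 * r + 2)))) ^ (r + 1) *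
    (1 / 2 ^ r)

/-- `D_{r+1} = sin(π/(2r+2))⁻² G_{r+1}`. -/
def Dconst (𝓑 : Digits) (s : ℝ) (r : ℕ) (h : ℝ) : ℝ :=
  (1 / Real.sin (Real.pi / (2 * r + 2))) ^ 2 * Gconst 𝓑 s r h

/-- `H_{r+1} = μ D_{r+1} χ / (2s)`, with the factor `2s` of `D_{r+1}` cancelled, so that it makes
sense at `s = 0`; see `Hconst_eq`. -/
def Hconst (𝓑 : Digits) (s : ℝ) (r : ℕ) (h μ : ℝ) : ℝ :=
  μ * (1 / Real.sin (Real.pi / (2 * r + 2))) ^ 2 *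
    ((∏ j ∈ Finset.range r, (2 * s + (j + 1 : ℕ))) / 𝓑.χ ^ (r + 1) *
      Real.exp (2 * s * h / 𝓑.χ) * (1 / ((r + 1).factorial : ℝ)) *
      (1 / (2 * Real.cos (Real.pi / (2 * r + 2)))) ^ (r + 1) * (1 / 2 ^ r)) * 𝓑.χ

lemma Hconst_eq (𝓑 : Digits) {s : ℝ} (hs : s ≠ 0) (r : ℕ) (h μ : ℝ) :
    Hconst 𝓑 s r h μ = μ * Dconst 𝓑 s r h * (𝓑.χ / (2 * s)) := by
  unfold Hconst Dconst Gconst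
  rw [Finset.prod_range_succ']
  simp only [Nat.cast_zero, add_zero]
  generalize (∏ j ∈ Finset.range r, (2 * s + (j + 1 : ℕ))) = P
  have h2 : P * (2 * s) / 𝓑.χ ^ (r + 1) = P / 𝓑.χ ^ (r + 1) * (2 * s) := by ring
  have h3 : (2 * s) * (𝓑.χ / (2 * s)) = 𝓑.χ := by field_simp
  rw [h2]
  generalize P / 𝓑.χ ^ (r + 1) = P'
  generalize Real.exp (2 * s * h / 𝓑.χ) = e
  generalize 𝓑.χ / (2 * s) = q at h3
  rw [← h3]
  ring

/-! ### Meshes, interpolation and the discrete operator -/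

/-- The extended Chebyshev points `ĉ_k`, `0 ≤ k ≤ r`, in `[-1, 1]`. -/
def chat (r k : ℕ) : ℝ :=
  -Real.cos ((2 * k + 1) / (2 * r + 2) * Real.pi) / Real.cos (Real.pi / (2 * r + 2))

/-- Pairwise disjoint compact intervals `[a_i, b_i] ⊆ S`, each divided into `N_i` equal parts,
such that every `θ_ω` with `ω` of length `ν` maps `S` into one of the intervals. -/
structure Mesh (𝓑 : Digits) (ν : ℕ) where
  I : ℕ
  a : Fin I → ℝ
  b : Fin I → ℝ
  N : Fin I → ℕ
  lt : ∀ i, a i < b i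
  N_pos : ∀ i, 0 < N i
  subset : ∀ i, Set.Icc (a i) (b i) ⊆ 𝓑.S
  disjoint : ∀ i j, i ≠ j → Disjoint (Set.Icc (a i) (b i)) (Set.Icc (a j) (b j))
  mapsTo : ∀ ω : 𝓑.Word ν, ∃ i, Set.MapsTo (thetaWord ω) 𝓑.S (Set.Icc (a i) (b i))

namespace Mesh

variable {𝓑 : Digits} {ν : ℕ} (𝓣 : Mesh 𝓑 ν)

/-- `h_i = (b_i - a_i) / N_i`. -/
def hi (i : Fin 𝓣.I) : ℝ := (𝓣.b i - 𝓣.a i) / 𝓣.N i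

/-- The mesh size `h = max_i h_i`. -/
def h : ℝ := ⨆ i, 𝓣.hi i

/-- `μ = h / min_i h_i`. -/
def μ : ℝ := 𝓣.h / ⨅ i, 𝓣.hi i

/-- The mesh points `t_j^i = a_i + j h_i`. -/
def t (i : Fin 𝓣.I) (j : ℕ) : ℝ := 𝓣.a i + j * 𝓣.hi i

/-- The index set of the subintervals. -/
abbrev Cell : Type := Σ i : Fin 𝓣.I, Fin (𝓣.N i)

/-- The subinterval with index `(i, j)`, where `j` is counted from `0`. -/
def cell (p : 𝓣.Cell) : Set ℝ := Set.Icc (𝓣.t p.1 p.2) (𝓣.t p.1 (p.2 + 1))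

/-- The interpolation points of a subinterval. -/
def node (r : ℕ) (p : 𝓣.Cell) (k : Fin (r + 1)) : ℝ :=
  𝓣.t p.1 p.2 + 𝓣.hi p.1 * (1 + chat r k) / 2

/-- The set `T` of all interpolation points. -/
def T (r : ℕ) : Finset ℝ :=
  Finset.univ.image fun q : 𝓣.Cell × Fin (r + 1) => 𝓣.node r q.1 q.2

lemma node_mem (r : ℕ) (p : 𝓣.Cell) (k : Fin (r + 1)) : 𝓣.node r p k ∈ 𝓣.T r :=
  Finset.mem_image.2 ⟨(p, k), Finset.mem_univ _, rfl⟩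

/-- The polynomial interpolant, on one subinterval, of a function on `T`. -/
def localInterp (r : ℕ) (F : 𝓣.T r → ℝ) (p : 𝓣.Cell) (x : ℝ) : ℝ :=
  ∑ k, (Lagrange.basis Finset.univ (𝓣.node r p) k).eval x * F ⟨𝓣.node r p k, 𝓣.node_mem r p k⟩

open Classical in
/-- The continuous piecewise polynomial interpolant `𝓕` on `⋃ [a_i, b_i]` of a function `F` on `T`
(and `0` elsewhere). The subinterval that is used does not matter; see `interp_eq`. -/
def interp (r : ℕ) (F : 𝓣.T r → ℝ) (x : ℝ) : ℝ :=
  if hx : ∃ p, x ∈ 𝓣.cell p then 𝓣.localInterp r F hx.choose x else 0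

lemma hi_pos (i : Fin 𝓣.I) : 0 < 𝓣.hi i :=
  div_pos (sub_pos.2 (𝓣.lt i)) (Nat.cast_pos.2 (𝓣.N_pos i))

end Mesh

lemma cos_pos_aux {r : ℕ} (hr : 1 ≤ r) : 0 < Real.cos (Real.pi / (2 * r + 2)) := by
  have hr' : (1 : ℝ) ≤ r := by exact_mod_cast hr
  apply Real.cos_pos_of_mem_Ioo
  constructor
  · have : 0 < Real.pi / (2 * (r : ℝ) + 2) := by positivity
    linarith [Real.pi_pos]
  · apply div_lt_div_of_pos_left Real.pi_pos (by norm_num)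
    linarith

lemma chat_strictMono {r : ℕ} (hr : 1 ≤ r) : StrictMono fun k : Fin (r + 1) => chat r k := by
  intro k l hkl
  have hc := cos_pos_aux hr
  have hkl' : ((k : ℕ) : ℝ) < ((l : ℕ) : ℝ) := by exact_mod_cast hkl
  have hl : ((l : ℕ) : ℝ) ≤ r := by exact_mod_cast Nat.lt_succ_iff.1 l.2
  have hr0 : (0 : ℝ) < 2 * r + 2 := by positivity
  refine div_lt_div_of_pos_right (neg_lt_neg (Real.cos_lt_cos_of_nonneg_of_le_pi ?_ ?_ ?_)) hc
  · positivity
  · have : (2 * ((l : ℕ) : ℝ) + 1) / (2 * r + 2) ≤ 1 := by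
      rw [div_le_one hr0]; linarith
    nlinarith [Real.pi_pos]
  · refine mul_lt_mul_of_pos_right ?_ Real.pi_pos
    exact div_lt_div_of_pos_right (by linarith) hr0

lemma chat_zero {r : ℕ} (hr : 1 ≤ r) : chat r 0 = -1 := by
  have hc := (cos_pos_aux hr).ne'
  have : ((2 * ((0 : ℕ) : ℝ) + 1) / (2 * r + 2) * Real.pi) = Real.pi / (2 * r + 2) := by
    push_cast; ring
  rw [chat, this, neg_div, div_self hc]

lemma chat_last {r : ℕ} (hr : 1 ≤ r) : chat r r = 1 := by
  have hc := (cos_pos_aux hr).ne'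
  have : ((2 * (r : ℝ) + 1) / (2 * r + 2) * Real.pi) = Real.pi - Real.pi / (2 * r + 2) := by
    have : (2 * (r : ℝ) + 2) ≠ 0 := by positivity
    field_simp
    ring
  rw [chat, this, Real.cos_pi_sub, neg_neg, div_self hc]

namespace Mesh

variable {𝓑 : Digits} {ν : ℕ} (𝓣 : Mesh 𝓑 ν)

lemma node_injective {r : ℕ} (hr : 1 ≤ r) (p : 𝓣.Cell) : Function.Injective (𝓣.node r p) := by
  intro k l hkl
  apply (chat_strictMono hr).injective
  have := 𝓣.hi_pos p.1
  simp only [node] at hkl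
  have h2 : 𝓣.hi p.1 * (1 + chat r k) = 𝓣.hi p.1 * (1 + chat r l) := by linarith
  have := mul_left_cancel₀ this.ne' h2
  simp only
  linarith

lemma localInterp_node {r : ℕ} (hr : 1 ≤ r) (F : 𝓣.T r → ℝ) (p : 𝓣.Cell) (k : Fin (r + 1)) :
    𝓣.localInterp r F p (𝓣.node r p k) = F ⟨𝓣.node r p k, 𝓣.node_mem r p k⟩ := by
  unfold localInterp
  rw [Finset.sum_eq_single k]
  · rw [Lagrange.eval_basis_self ((𝓣.node_injective hr p).injOn) (Finset.mem_univ _), one_mul]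
  · intro l _ hl
    rw [Lagrange.eval_basis_of_ne hl (Finset.mem_univ _), zero_mul]
  · simp

lemma node_zero {r : ℕ} (hr : 1 ≤ r) (p : 𝓣.Cell) : 𝓣.node r p 0 = 𝓣.t p.1 p.2 := by
  simp [node, chat_zero hr]

lemma node_last {r : ℕ} (hr : 1 ≤ r) (p : 𝓣.Cell) :
    𝓣.node r p (Fin.last r) = 𝓣.t p.1 (p.2 + 1) := by
  simp only [node, Fin.val_last, chat_last hr, t]
  push_cast
  ring

lemma t_mono (i : Fin 𝓣.I) : Monotone (𝓣.t i) := by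
  intro j k hjk
  have : (j : ℝ) ≤ k := by exact_mod_cast hjk
  have := mul_le_mul_of_nonneg_right this (𝓣.hi_pos i).le
  simp only [t]
  linarith

lemma cell_subset (p : 𝓣.Cell) : 𝓣.cell p ⊆ Set.Icc (𝓣.a p.1) (𝓣.b p.1) := by
  have h0 : 𝓣.t p.1 0 = 𝓣.a p.1 := by simp [t]
  have h1 : 𝓣.t p.1 (𝓣.N p.1) = 𝓣.b p.1 := by
    have : ((𝓣.N p.1 : ℕ) : ℝ) ≠ 0 := by exact_mod_cast (𝓣.N_pos p.1).ne'
    simp only [t, hi]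
    field_simp
    ring
  rw [← h0, ← h1]
  exact Set.Icc_subset_Icc (𝓣.t_mono _ (Nat.zero_le _)) (𝓣.t_mono _ p.2.2)

lemma localInterp_eq_of_lt {r : ℕ} (hr : 1 ≤ r) (F : 𝓣.T r → ℝ) (i : Fin 𝓣.I)
    (j k : Fin (𝓣.N i)) (hjk : j < k) {x : ℝ} (hx : x ∈ 𝓣.cell ⟨i, j⟩) (hx' : x ∈ 𝓣.cell ⟨i, k⟩) :
    𝓣.localInterp r F ⟨i, j⟩ x = 𝓣.localInterp r F ⟨i, k⟩ x := by
  have h1 : x ≤ 𝓣.t i (j + 1) := hx.2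
  have h2 : 𝓣.t i k ≤ x := hx'.1
  have h3 : 𝓣.t i (j + 1) ≤ 𝓣.t i k := 𝓣.t_mono i hjk
  have e1 : x = 𝓣.node r ⟨i, j⟩ (Fin.last r) := by
    rw [node_last 𝓣 hr]; exact le_antisymm h1 (h3.trans h2)
  have e2 : x = 𝓣.node r ⟨i, k⟩ 0 := by
    rw [node_zero 𝓣 hr]; exact le_antisymm (h1.trans h3) h2
  have l1 : 𝓣.localInterp r F ⟨i, j⟩ x = F ⟨x, e1 ▸ 𝓣.node_mem r _ _⟩ := by
    subst e1
    exact localInterp_node 𝓣 hr F _ _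
  have l2 : 𝓣.localInterp r F ⟨i, k⟩ x = F ⟨x, e2 ▸ 𝓣.node_mem r _ _⟩ := by
    clear l1 e1
    subst e2
    exact localInterp_node 𝓣 hr F _ _
  rw [l1, l2]

lemma interp_eq {r : ℕ} (hr : 1 ≤ r) (F : 𝓣.T r → ℝ) (p : 𝓣.Cell) {x : ℝ} (hx : x ∈ 𝓣.cell p) :
    𝓣.interp r F x = 𝓣.localInterp r F p x := by
  have hex : ∃ p, x ∈ 𝓣.cell p := ⟨p, hx⟩
  rw [interp, dif_pos hex]
  have hq := hex.choose_spec
  generalize hex.choose = q at hq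
  obtain ⟨i, j⟩ := p
  obtain ⟨i', k⟩ := q
  have hi : i = i' := by
    by_contra hne
    exact Set.disjoint_left.1 (𝓣.disjoint i i' hne) (𝓣.cell_subset _ hx) (𝓣.cell_subset _ hq)
  subst hi
  rcases lt_trichotomy j k with h | h | h
  · exact (𝓣.localInterp_eq_of_lt hr F i j k h hx hq).symm
  · rw [h]
  · exact 𝓣.localInterp_eq_of_lt hr F i k j h hq hx

lemma localInterp_add (r : ℕ) (F G : 𝓣.T r → ℝ) (p : 𝓣.Cell) (x : ℝ) :
    𝓣.localInterp r (F + G) p x = 𝓣.localInterp r F p x + 𝓣.localInterp r G p x := by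
  simp [localInterp, mul_add, Finset.sum_add_distrib]

lemma localInterp_smul (r : ℕ) (c : ℝ) (F : 𝓣.T r → ℝ) (p : 𝓣.Cell) (x : ℝ) :
    𝓣.localInterp r (c • F) p x = c * 𝓣.localInterp r F p x := by
  simp [localInterp, Finset.mul_sum, mul_left_comm]

/-- The discrete operator `(𝐋_{s,ν} F)(ξ) = ∑_ω g_ω(ξ)^s 𝓕(θ_ω(ξ))`, `ξ ∈ T`, the sum being over
all words `ω` of length `ν`. -/
def discreteOp (s : ℝ) (r : ℕ) : (𝓣.T r → ℝ) →ₗ[ℝ] (𝓣.T r → ℝ) where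
  toFun F := fun ξ => ∑ ω : 𝓑.Word ν, gWord ω ξ ^ s * 𝓣.interp r F (thetaWord ω ξ)
  map_add' F G := by
    funext ξ
    simp only [Pi.add_apply, ← Finset.sum_add_distrib]
    refine Finset.sum_congr rfl fun ω _ => ?_
    simp only [interp]
    split_ifs
    · rw [localInterp_add, mul_add]
    · simp
  map_smul' c F := by
    funext ξ
    simp only [RingHom.id_apply, Pi.smul_apply, smul_eq_mul, Finset.mul_sum]
    refine Finset.sum_congr rfl fun ω _ => ?_
    simp only [interp]
    split_ifs
    · rw [localInterp_smul, mul_left_comm]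
    · simp

/-- The matrix of the discrete operator. -/
def L (s : ℝ) (r : ℕ) : Matrix (𝓣.T r) (𝓣.T r) ℝ := LinearMap.toMatrix' (𝓣.discreteOp s r)

/-- The constant `H = H_{r+1}` of the mesh. -/
def H (s : ℝ) (r : ℕ) : ℝ := Hconst 𝓑 s r 𝓣.h 𝓣.μ

end Mesh

end CFTransfer

end

open CFTransfer

/-!
Write `f_n = L_s ^ n 1`. On `[0, 1]` each `f_n` is a nonnegative combination of powers
`x ↦ (x + ρ) ^ (-2s)` with `ρ ≥ γ + 𝔞_{n-1}` (`IsPowerMixture`). This gives two sharp facts on `S`: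
`f_n` is log-Lipschitz with a constant that tends to `a = 2s / χ`, and piecewise interpolation at
the extended Chebyshev points reproduces `f_n` up to a relative error whose bound tends to
`G h ^ (r + 1)`. As the sum over words of length `ν` of `g_ω ^ s • f_n ∘ θ_ω` is `f_{n+ν}`, the
discrete operator maps the restriction of `f_n` to `T` to that of `f_{n+ν}` up to this relative
error.

The comparison is made in the cone `K(M)` (`Mesh.cone`) of the nonnegative `F` on `T` with
`F ξ ≤ F η * exp (M |ξ - η|)` whenever `ξ` and `η` lie in the same interval `[a_i, b_i]`.
The discrete operator maps `K(M)` into itself (`Mesh.discreteOp_mem_cone`): by Markov's inequality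
(`markov_inequality`) and the bound `ψ(r)` for the Lebesgue constant (`sum_abs_basis_chat_le`) the
interpolant of `F` is log-Lipschitz with constant `2 η(r) r ^ 2 ψ(r) M e ^ u / (1 - ψ(r) u e ^ u)`,
and `θ_ω` contracts by `c(ν)`. With `ε = H h ^ r`, both
`(1 + ε) f_{n+ν} - 𝐋 f_n` and `𝐋 f_n - (1 - ε) f_{n+ν}` lie in `K(M)` for all large `n`
(`Mesh.smul_add_mem_cone`, `Mesh.exists_scalar_cond`): two points of `T` in one interval are at
distance at least `d = 2 sin ^ 2 (π / (2r + 2)) h / μ`, so what is needed is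
`(ε + g) ≤ (ε - g) exp ((M - a) d)` with `g = G h ^ (r + 1)`, and `H` is chosen such that
`ε a d = 2 g`.

Iterating, `(1 - ε) ^ k f_{n+kν} ≤ 𝐋 ^ k f_n ≤ (1 + ε) ^ k f_{n+kν}` on `T`. Since `f_n` restricted
to `T` is an interior point of `K(M)`, the norm of `𝐋 ^ k` is comparable to `𝐋 ^ k f_n`, uniformly in
`k`; and the norm of `L_s ^ n` is comparable to `f_n`. Gelfand's formula turns this into
`(1 - ε) λ_s ^ ν ≤ R(𝐋) ≤ (1 + ε) λ_s ^ ν` (`Mesh.spectralRadius_bounds`). For `s = 0` the given `M`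
is `0` and `K(M)` has no interior; but then the interpolation error vanishes, and the argument runs
with `ε = 0` and any small positive parameter in place of `M`.
-/

open scoped BigOperators

noncomputable section

namespace CFTransfer

/-! ### The inequalities of Schur, Bernstein and Markov -/

section Chebyshev

open Polynomial Polynomial.Chebyshev

/-- The zeros of the Chebyshev polynomial `T_n`, in decreasing order. -/
def chebZero (n : ℕ) (k : Fin n) : ℝ := Real.cos ((2 * (k : ℕ) + 1) * Real.pi / (2 * n))

/-- The angles whose cosines are the zeros of `T_n`; the index is any natural number. -/
def chebAngle (n : ℕ) (k : ℕ) : ℝ := (2 * k + 1) * Real.pi / (2 * n)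

lemma chebAngle_mem {n : ℕ} {k : ℕ} (hk : k < n) : chebAngle n k ∈ Set.Ioo 0 Real.pi := by
  have hn : (0 : ℝ) < n := by exact_mod_cast (Nat.zero_le _).trans_lt hk
  have hk' : (k : ℝ) + 1 ≤ n := by exact_mod_cast hk
  have := Real.pi_pos
  refine ⟨by unfold chebAngle; positivity, ?_⟩
  unfold chebAngle
  rw [div_lt_iff₀ (by positivity)]
  nlinarith

lemma chebZero_eq (n : ℕ) (k : Fin n) : chebZero n k = Real.cos (chebAngle n k) := rfl

lemma chebAngle_strictMono {n : ℕ} (hn : 0 < n) : StrictMono (chebAngle n) := by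
  intro k l hkl
  have hkl' : (k : ℝ) < l := by exact_mod_cast hkl
  have hn' : (0 : ℝ) < n := by exact_mod_cast hn
  unfold chebAngle
  have := Real.pi_pos
  gcongr

lemma chebZero_injective (n : ℕ) : Function.Injective (chebZero n) := by
  intro k l hkl
  have hk := chebAngle_mem k.2
  have hl := chebAngle_mem l.2
  have := Real.injOn_cos ⟨hk.1.le, hk.2.le⟩ ⟨hl.1.le, hl.2.le⟩ hkl
  exact Fin.ext ((chebAngle_strictMono (Nat.zero_lt_of_lt k.2)).injective this)

lemma T_eq_nodal (n : ℕ) :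
    T ℝ n = C (2 ^ (n - 1)) * Lagrange.nodal Finset.univ (chebZero n) := by
  have hinj : Set.InjOn (fun k : ℕ => Real.cos ((2 * (k : ℝ) + 1) * Real.pi / (2 * n)))
      (Finset.range n) := by
    have := (Finset.range n).nodup_map_iff_injOn.mp (roots_T_real_nodup n)
    exact this
  have hcard : (T ℝ n).roots.card = (T ℝ n).natDegree := by
    rw [roots_T_real, natDegree_T, Finset.card_val, Finset.card_image_of_injOn hinj]
    simp
  have h := C_leadingCoeff_mul_prod_multiset_X_sub_C hcard
  rw [roots_T_real, leadingCoeff_T] at h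
  rw [← h]
  simp only [Int.natAbs_natCast]
  congr 1
  rw [Lagrange.nodal_eq]
  have h2 := Finset.prod_image (s := Finset.range n) (f := fun a : ℝ => (X - C a : ℝ[X])) hinj
  rw [Finset.prod_eq_multiset_prod] at h2
  rw [h2, Finset.prod_range]
  rfl

lemma derivative_T_chebZero {n : ℕ} (k : Fin n) :
    |(derivative (T ℝ n)).eval (chebZero n k)| * Real.sin (chebAngle n k) = n := by
  have hn : (n : ℝ) ≠ 0 := by exact_mod_cast (Nat.zero_lt_of_lt k.2).ne'
  have hs : 0 < Real.sin (chebAngle n k) :=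
    Real.sin_pos_of_mem_Ioo (chebAngle_mem k.2)
  rw [← abs_of_pos hs, ← abs_mul, T_derivative_eq_U, eval_mul, mul_assoc, chebZero_eq,
    U_real_cos]
  have h1 : (((n : ℤ) - 1 : ℤ) + 1 : ℝ) * chebAngle n k = (k : ℕ) * Real.pi + Real.pi / 2 := by
    unfold chebAngle
    push_cast
    field_simp
    ring
  rw [h1, Real.sin_add_pi_div_two, Real.cos_nat_mul_pi]
  simp

lemma abs_basis_chebZero {n : ℕ} (k : Fin n) {x : ℝ} (hx : x ≠ chebZero n k) :
    |(Lagrange.basis Finset.univ (chebZero n) k).eval x| =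
      |(T ℝ n).eval x| / n * (Real.sin (chebAngle n k) / |x - chebZero n k|) := by
  have hn : (n : ℝ) ≠ 0 := by exact_mod_cast (Nat.zero_lt_of_lt k.2).ne'
  have hd := derivative_T_chebZero k
  rw [Lagrange.eval_basis_not_at_node (Finset.mem_univ _) hx,
    Lagrange.nodalWeight_eq_eval_derivative_nodal (Finset.mem_univ _)]
  rw [T_eq_nodal] at hd ⊢
  rw [derivative_C_mul] at hd
  simp only [eval_mul, eval_C, abs_mul, abs_inv, abs_pow, Nat.abs_ofNat] at hd ⊢
  rw [← hd]
  have h2 : (2 : ℝ) ^ (n - 1) ≠ 0 := by positivity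
  have hD : |(derivative (Lagrange.nodal Finset.univ (chebZero n))).eval (chebZero n k)| ≠ 0 := by
    intro h; rw [h] at hd; simp at hd; exact hn hd.symm
  have hs : Real.sin (chebAngle n k) ≠ 0 :=
    (Real.sin_pos_of_mem_Ioo (chebAngle_mem k.2)).ne'
  field_simp

/-- Schur's inequality. Up to the largest zero of `T_n` the weight `sin θ` is at least `1 / n`.
Beyond it one interpolates `Q` at the zeros of `T_n`; as `x` lies on the same side of all of them,
the bounds for the terms add up to `K * T_n' x / n ≤ n * K`. -/
theorem schur_inequality {n : ℕ} {K : ℝ} (Q : ℝ[X]) (hdeg : Q.degree < n)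
    (h : ∀ θ, |Q.eval (Real.cos θ) * Real.sin θ| ≤ K) {x : ℝ} (hx : |x| ≤ 1) :
    |Q.eval x| ≤ n * K := by
  have hK : 0 ≤ K := (abs_nonneg _).trans (h 0)
  rcases Nat.eq_zero_or_pos n with rfl | hn
  · have : Q = 0 := by
      rw [← degree_eq_bot]; simpa using hdeg
    simp [this]
  have hn' : (0 : ℝ) < n := by exact_mod_cast hn
  wlog hx0 : 0 ≤ x generalizing x Q
  · have := this (Q.comp (-X)) (by
        refine lt_of_le_of_lt ?_ hdeg
        by_cases hQ : Q = 0
        · simp [hQ]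
        rw [degree_eq_natDegree hQ]
        refine (degree_le_natDegree).trans ?_
        simp [natDegree_comp])
      (fun θ => by
        have := h (θ + Real.pi)
        simpa [Real.cos_add_pi, Real.sin_add_pi] using this) (x := -x) (by simpa using hx)
        (by linarith)
    simpa using this
  rw [abs_of_nonneg hx0] at hx
  by_cases hc : x ≤ Real.cos (Real.pi / (2 * n))
  · set θ := Real.arccos x with hθ
    have hcos : Real.cos θ = x := Real.cos_arccos (by linarith) hx
    have hθ1 : Real.pi / (2 * n) ≤ θ := by
      rw [hθ, ← Real.arccos_cos (x := Real.pi / (2 * n)) (by positivity)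
        (by rw [div_le_iff₀ (by positivity)]
            nlinarith [Real.pi_pos, (by exact_mod_cast hn : (1 : ℝ) ≤ n)])]
      exact Real.arccos_le_arccos hc
    have hθ2 : θ ≤ Real.pi / 2 := Real.arccos_le_pi_div_two.2 hx0
    have hsin : 1 / n ≤ Real.sin θ := by
      have := Real.mul_le_sin (x := θ) (le_trans (by positivity) hθ1) hθ2
      refine le_trans ?_ this
      calc (1 : ℝ) / n = 2 / Real.pi * (Real.pi / (2 * n)) := by
            field_simp
        _ ≤ _ := by gcongr
    have := h θ
    rw [hcos, abs_mul] at this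
    have hs : 1 / n ≤ |Real.sin θ| := hsin.trans (le_abs_self _)
    have h3 : |Q.eval x| * (1 / n) ≤ K := (by gcongr : _ ≤ _).trans this
    rwa [mul_one_div, div_le_iff₀ hn', mul_comm] at h3
  · push Not at hc
    have hlt : ∀ k : Fin n, chebZero n k < x := by
      intro k
      refine lt_of_le_of_lt ?_ hc
      rw [chebZero_eq]
      refine Real.cos_le_cos_of_nonneg_of_le_pi (by positivity) (chebAngle_mem k.2).2.le ?_
      have := (chebAngle_strictMono hn).monotone (Nat.zero_le k)
      simpa [chebAngle] using this
    have hQ : Q = Lagrange.interpolate Finset.univ (chebZero n) fun k => Q.eval (chebZero n k) :=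
      Lagrange.eq_interpolate (chebZero_injective n).injOn (by simpa using hdeg)
    rw [hQ, Lagrange.interpolate_apply, eval_finsetSum]
    refine (Finset.abs_sum_le_sum_abs _ _).trans ?_
    have hTx : 0 ≤ (T ℝ n).eval x := by
      rw [T_eq_nodal, eval_mul, Lagrange.eval_nodal, eval_C]
      exact mul_nonneg (by positivity) (Finset.prod_nonneg fun i _ => (sub_pos.2 (hlt i)).le)
    have hder : (derivative (T ℝ n)).eval x = ∑ k : Fin n, (T ℝ n).eval x / (x - chebZero n k) := by
      rw [T_eq_nodal, derivative_C_mul, Lagrange.derivative_nodal, eval_mul, eval_finsetSum,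
        Finset.mul_sum]
      refine Finset.sum_congr rfl fun k _ => ?_
      rw [eval_mul, Lagrange.nodal_eq_mul_nodal_erase (Finset.mem_univ k), eval_mul]
      have := (sub_pos.2 (hlt k)).ne'
      simp only [eval_C, eval_sub, eval_X]
      field_simp
    have hle : (derivative (T ℝ n)).eval x ≤ (n : ℝ) ^ 2 := by
      have h1 := abs_iterate_derivative_T_real_le n 1 (x := x)
        (by rw [abs_of_nonneg hx0]; exact hx)
      simp only [Function.iterate_one] at h1
      have h2 := derivative_T_eval_one (R := ℝ) n
      rw [h2] at h1
      exact (le_abs_self _).trans (by simpa using h1)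
    calc ∑ k : Fin n, |(C (Q.eval (chebZero n k)) *
            Lagrange.basis Finset.univ (chebZero n) k).eval x|
        ≤ ∑ k : Fin n, K * ((T ℝ n).eval x / (x - chebZero n k) / n) := by
          refine Finset.sum_le_sum fun k _ => ?_
          have hk := sub_pos.2 (hlt k)
          rw [eval_mul, abs_mul, eval_C, abs_basis_chebZero k (hlt k).ne', abs_of_nonneg hTx,
            abs_of_pos hk]
          have h1 := h (chebAngle n k)
          rw [abs_mul, abs_of_pos (Real.sin_pos_of_mem_Ioo (chebAngle_mem k.2)),
            ← chebZero_eq] at h1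
          calc _ = (|Q.eval (chebZero n k)| * Real.sin (chebAngle n k)) *
                ((T ℝ n).eval x / (x - chebZero n k) / n) := by ring
            _ ≤ K * ((T ℝ n).eval x / (x - chebZero n k) / n) := by
              gcongr
      _ = (derivative (T ℝ n)).eval x / n * K := by
          rw [hder, Finset.sum_div, ← Finset.mul_sum, mul_comm]
      _ ≤ n * K := by
          gcongr
          rw [div_le_iff₀ hn', ← sq]
          exact hle

/-- The monomial case of `exists_bernstein_factor`, by the recursion for `a ^ k - b ^ k` in terms of
`a + b` and `a * b`, both of which are polynomials in `cos t`. -/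
lemma exists_bernstein_factor_pow (θ : ℝ) (k : ℕ) :
    ∃ R : ℝ[X], R.degree < k ∧ ∀ t, Real.cos (θ + t) ^ k - Real.cos (θ - t) ^ k =
      Real.sin t * R.eval (Real.cos t) := by
  induction k using Nat.twoStepInduction with
  | zero => exact ⟨0, by simp, by simp⟩
  | one =>
    refine ⟨C (-2 * Real.sin θ), lt_of_le_of_lt degree_C_le (by norm_num), fun t => ?_⟩
    simp only [pow_one, Real.cos_add, Real.cos_sub, eval_C]
    ring
  | more k ih0 ih1 =>
    obtain ⟨R0, hd0, h0⟩ := ih0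
    obtain ⟨R1, hd1, h1⟩ := ih1
    refine ⟨C (2 * Real.cos θ) * X * R1 - (X ^ 2 + C (Real.cos θ ^ 2 - 1)) * R0, ?_, fun t => ?_⟩
    · have e1 : (C (2 * Real.cos θ) * X * R1).degree < ((k + 2 : ℕ) : WithBot ℕ) := by
        by_cases hR : R1 = 0
        · rw [hR, mul_zero, degree_zero]
          exact WithBot.bot_lt_coe _
        rw [degree_eq_natDegree hR, Nat.cast_lt] at hd1
        refine degree_le_natDegree.trans_lt (Nat.cast_lt.2 ?_)
        have := natDegree_mul_le (p := C (2 * Real.cos θ) * X) (q := R1)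
        have := (natDegree_C_mul_le (2 * Real.cos θ) X).trans natDegree_X_le
        omega
      have e2 : ((X ^ 2 + C (Real.cos θ ^ 2 - 1)) * R0).degree < ((k + 2 : ℕ) : WithBot ℕ) := by
        by_cases hR : R0 = 0
        · rw [hR, mul_zero, degree_zero]
          exact WithBot.bot_lt_coe _
        rw [degree_eq_natDegree hR, Nat.cast_lt] at hd0
        refine degree_le_natDegree.trans_lt (Nat.cast_lt.2 ?_)
        have := natDegree_mul_le (p := X ^ 2 + C (Real.cos θ ^ 2 - 1)) (q := R0)
        have := natDegree_X_pow_add_C (R := ℝ) (n := 2) (r := Real.cos θ ^ 2 - 1)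
        omega
      exact (degree_sub_le _ _).trans_lt (max_lt e1 e2)
    · have hA : Real.cos (θ + t) + Real.cos (θ - t) = 2 * Real.cos θ * Real.cos t := by
        rw [Real.cos_add, Real.cos_sub]; ring
      have hB : Real.cos (θ + t) * Real.cos (θ - t) = Real.cos t ^ 2 + (Real.cos θ ^ 2 - 1) := by
        rw [Real.cos_add, Real.cos_sub]
        have h1 := Real.sin_sq_add_cos_sq θ
        have h2 := Real.sin_sq_add_cos_sq t
        linear_combination (-(Real.sin t ^ 2)) * h1 + (Real.cos θ ^ 2 - 1) * h2
      simp only [eval_sub, eval_mul, eval_add, eval_pow, eval_X, eval_C]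
      rw [← hA, ← hB]
      linear_combination (Real.cos (θ + t) + Real.cos (θ - t)) * h1 t -
        Real.cos (θ + t) * Real.cos (θ - t) * h0 t

/-- The odd part in `t` of `p (cos (θ + t))` is `sin t` times a polynomial of degree `< n` in
`cos t`. -/
lemma exists_bernstein_factor {n : ℕ} (p : ℝ[X]) (hp : p.natDegree ≤ n) (θ : ℝ) :
    ∃ R : ℝ[X], R.degree < n ∧ ∀ t, p.eval (Real.cos (θ + t)) - p.eval (Real.cos (θ - t)) =
      Real.sin t * R.eval (Real.cos t) := by
  choose R hdeg hR using exists_bernstein_factor_pow θ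
  refine ⟨∑ k ∈ Finset.range (n + 1), C (p.coeff k) * R k, ?_, fun t => ?_⟩
  · refine (degree_sum_le _ _).trans_lt ((Finset.sup_lt_iff (by simp [bot_lt_iff_ne_bot])).2 ?_)
    intro k hk
    refine lt_of_lt_of_le (lt_of_le_of_lt ?_ (hdeg k)) ?_
    · rw [← smul_eq_C_mul]
      exact degree_smul_le _ _
    exact Nat.cast_le.2 (Nat.lt_succ_iff.1 (Finset.mem_range.1 hk))
  · rw [eval_eq_sum_range' (Nat.lt_succ_iff.2 hp), eval_eq_sum_range' (Nat.lt_succ_iff.2 hp),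
      ← Finset.sum_sub_distrib, eval_finsetSum, Finset.mul_sum]
    refine Finset.sum_congr rfl fun k _ => ?_
    rw [← mul_sub, hR, eval_mul, eval_C]
    ring

/-- Bernstein's inequality for `θ ↦ p (cos θ)`: Schur's inequality at `1` for the factor of
`exists_bernstein_factor`, whose value there is a derivative. -/
theorem bernstein_inequality {n : ℕ} {K : ℝ} (p : ℝ[X]) (hp : p.natDegree ≤ n)
    (h : ∀ x, |x| ≤ 1 → |p.eval x| ≤ K) (θ : ℝ) :
    |(derivative p).eval (Real.cos θ) * Real.sin θ| ≤ n * K := by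
  obtain ⟨R, hdeg, hR⟩ := exists_bernstein_factor p hp θ
  have hR1 : R.eval 1 = -2 * ((derivative p).eval (Real.cos θ) * Real.sin θ) := by
    have d1 : HasDerivAt (fun t => p.eval (Real.cos (θ + t)) - p.eval (Real.cos (θ - t)))
        ((derivative p).eval (Real.cos (θ + 0)) * (-Real.sin (θ + 0) * 1) -
          (derivative p).eval (Real.cos (θ - 0)) * (-Real.sin (θ - 0) * (-1))) 0 := by
      refine HasDerivAt.sub ?_ ?_
      · exact (p.hasDerivAt _).comp (0 : ℝ)
          ((Real.hasDerivAt_cos _).comp (0 : ℝ) ((hasDerivAt_id (0 : ℝ)).const_add θ))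
      · exact (p.hasDerivAt _).comp (0 : ℝ)
          ((Real.hasDerivAt_cos _).comp (0 : ℝ) ((hasDerivAt_id (0 : ℝ)).const_sub θ))
    have d2 : HasDerivAt (fun t => Real.sin t * R.eval (Real.cos t))
        (Real.cos 0 * R.eval (Real.cos 0) +
          Real.sin 0 * ((derivative R).eval (Real.cos 0) * (-Real.sin 0))) 0 :=
      (Real.hasDerivAt_sin 0).mul ((R.hasDerivAt _).comp (0 : ℝ) (Real.hasDerivAt_cos 0))
    rw [funext hR] at d1
    have := d2.unique d1
    simp only [Real.cos_zero, Real.sin_zero, add_zero, sub_zero] at this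
    linarith
  have hS := schur_inequality (K := 2 * K) R hdeg (fun t => by
    rw [mul_comm, ← hR]
    have h1 := h _ (Real.abs_cos_le_one (θ + t))
    have h2 := h _ (Real.abs_cos_le_one (θ - t))
    have := abs_sub (p.eval (Real.cos (θ + t))) (p.eval (Real.cos (θ - t)))
    linarith) (x := 1) (by simp)
  rw [hR1, abs_mul] at hS
  norm_num at hS
  rw [abs_mul]
  linarith

/-- Markov's inequality for the derivative of a polynomial on `[-1, 1]`. -/
theorem markov_inequality {n : ℕ} {K : ℝ} (p : ℝ[X]) (hp : p.natDegree ≤ n)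
    (h : ∀ x, |x| ≤ 1 → |p.eval x| ≤ K) {x : ℝ} (hx : |x| ≤ 1) :
    |(derivative p).eval x| ≤ n ^ 2 * K := by
  rcases Nat.eq_zero_or_pos n with rfl | hn
  · rw [eq_C_of_natDegree_le_zero hp]
    simp
  have := schur_inequality (derivative p) (n := n) (K := n * K) (by
    refine degree_le_natDegree.trans_lt (Nat.cast_lt.2 ?_)
    have := natDegree_derivative_le p
    omega) (bernstein_inequality p hp h) hx
  rwa [← mul_assoc, ← sq] at this

/-- The Lagrange basis is invariant under affine changes of the variable. -/
lemma eval_basis_affine {ι : Type*} [Fintype ι] [DecidableEq ι] (v : ι → ℝ) {a b : ℝ} (hb : b ≠ 0)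
    (k : ι) (x : ℝ) :
    (Lagrange.basis Finset.univ (fun i => a + b * v i) k).eval (a + b * x) =
      (Lagrange.basis Finset.univ v k).eval x := by
  simp only [Lagrange.basis, eval_prod, Lagrange.basisDivisor, eval_mul, eval_C, eval_sub, eval_X]
  refine Finset.prod_congr rfl fun i _ => ?_
  have e1 : a + b * v k - (a + b * v i) = b * (v k - v i) := by ring
  have e2 : a + b * x - (a + b * v i) = b * (x - v i) := by ring
  rw [e1, e2, mul_inv]
  field_simp

/-! ### The Lebesgue function of the Chebyshev nodes -/

lemma cos_sub_cos_pos {x y : ℝ} (hx : 0 ≤ x) (hxy : x < y) (hy : y ≤ Real.pi) :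
    0 < Real.cos x - Real.cos y :=
  sub_pos.2 (Real.cos_lt_cos_of_nonneg_of_le_pi hx hy hxy)

/-- A form of midpoint convexity of `t ↦ sin t / (cos θ - cos t)`, the derivative of
`t ↦ log (cos θ - cos t)`, which allows sums over nodes to be compared with logarithms. -/
lemma midpoint_le_add {θ t y : ℝ} (hθ : 0 ≤ θ) (hy : 0 ≤ y) (h1 : θ < t - y)
    (h2 : t + y ≤ Real.pi) :
    2 * (Real.sin t / (Real.cos θ - Real.cos t)) ≤
      Real.sin (t + y) / (Real.cos θ - Real.cos (t + y)) +
        Real.sin (t - y) / (Real.cos θ - Real.cos (t - y)) := by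
  have p1 := cos_sub_cos_pos hθ (by linarith : θ < t + y) h2
  have p2 := cos_sub_cos_pos hθ h1 (by linarith)
  have p0 := cos_sub_cos_pos hθ (by linarith : θ < t) (by linarith)
  have hs : 0 ≤ Real.sin t := Real.sin_nonneg_of_nonneg_of_le_pi (by linarith) (by linarith)
  have hsθ : 0 ≤ Real.sin θ := Real.sin_nonneg_of_nonneg_of_le_pi hθ (by linarith)
  have hcc : Real.cos θ * Real.cos t ≤ Real.cos y := by
    have h3 : Real.cos (t - θ) ≤ Real.cos y :=
      Real.cos_le_cos_of_nonneg_of_le_pi hy (by linarith) (by linarith)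
    rw [Real.cos_sub] at h3
    nlinarith [mul_nonneg hs hsθ]
  have hc1 := Real.cos_sq_le_one θ
  have hy1 := Real.cos_le_one y
  have e : Real.sin (t + y) / (Real.cos θ - Real.cos (t + y)) +
        Real.sin (t - y) / (Real.cos θ - Real.cos (t - y)) -
      2 * (Real.sin t / (Real.cos θ - Real.cos t)) =
      2 * Real.sin t * ((1 - Real.cos y) * (1 + Real.cos y - Real.cos θ ^ 2 -
        Real.cos θ * Real.cos t)) / ((Real.cos θ - Real.cos (t + y)) *
          (Real.cos θ - Real.cos (t - y)) * (Real.cos θ - Real.cos t)) := by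
    rw [eq_div_iff (by positivity)]
    rw [sub_mul, add_mul]
    have q1 := p1.ne'
    have q2 := p2.ne'
    have q0 := p0.ne'
    have f1 : Real.sin (t + y) / (Real.cos θ - Real.cos (t + y)) *
        ((Real.cos θ - Real.cos (t + y)) * (Real.cos θ - Real.cos (t - y)) *
          (Real.cos θ - Real.cos t)) =
        Real.sin (t + y) * (Real.cos θ - Real.cos (t - y)) * (Real.cos θ - Real.cos t) := by
      field_simp
    have f2 : Real.sin (t - y) / (Real.cos θ - Real.cos (t - y)) *
        ((Real.cos θ - Real.cos (t + y)) * (Real.cos θ - Real.cos (t - y)) *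
          (Real.cos θ - Real.cos t)) =
        Real.sin (t - y) * (Real.cos θ - Real.cos (t + y)) * (Real.cos θ - Real.cos t) := by
      field_simp
    have f3 : 2 * (Real.sin t / (Real.cos θ - Real.cos t)) *
        ((Real.cos θ - Real.cos (t + y)) * (Real.cos θ - Real.cos (t - y)) *
          (Real.cos θ - Real.cos t)) =
        2 * Real.sin t * ((Real.cos θ - Real.cos (t + y)) * (Real.cos θ - Real.cos (t - y))) := by
      field_simp
    rw [f1, f2, f3]
    simp only [Real.cos_add, Real.cos_sub, Real.sin_add, Real.sin_sub]
    have g1 := Real.sin_sq_add_cos_sq t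
    have g2 := Real.sin_sq_add_cos_sq y
    linear_combination (2 * Real.sin t * Real.sin y ^ 2) * g1 +
      (2 * Real.sin t * (1 - Real.cos t ^ 2) -
        2 * Real.sin t * Real.cos t * (Real.cos θ - Real.cos t)) * g2
  have : 0 ≤ 2 * Real.sin t * ((1 - Real.cos y) * (1 + Real.cos y - Real.cos θ ^ 2 -
        Real.cos θ * Real.cos t)) / ((Real.cos θ - Real.cos (t + y)) *
          (Real.cos θ - Real.cos (t - y)) * (Real.cos θ - Real.cos t)) := by
    refine div_nonneg (mul_nonneg (by linarith) (mul_nonneg (by linarith) ?_)) (by positivity)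
    linarith
  linarith

/-- The midpoint rule underestimates the integral of `sin t / (cos θ - cos t)`. -/
theorem midpoint_sum_le_log {θ t φ : ℝ} (hθ : 0 ≤ θ) (hφ : 0 ≤ φ) (h1 : θ < t - φ)
    (h2 : t + φ ≤ Real.pi) :
    2 * φ * (Real.sin t / (Real.cos θ - Real.cos t)) ≤
      Real.log (Real.cos θ - Real.cos (t + φ)) - Real.log (Real.cos θ - Real.cos (t - φ)) := by
  set D : ℝ → ℝ := fun y => Real.log (Real.cos θ - Real.cos (t + y)) -
    Real.log (Real.cos θ - Real.cos (t - y)) - 2 * y * (Real.sin t / (Real.cos θ - Real.cos t))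
    with hD
  have hder : ∀ y ∈ Set.Icc 0 φ, HasDerivAt D
      (Real.sin (t + y) / (Real.cos θ - Real.cos (t + y)) +
        Real.sin (t - y) / (Real.cos θ - Real.cos (t - y)) -
        2 * (Real.sin t / (Real.cos θ - Real.cos t))) y := by
    intro y hy
    have p1 := cos_sub_cos_pos hθ (by linarith [hy.1] : θ < t + y) (by linarith [hy.2])
    have p2 := cos_sub_cos_pos hθ (by linarith [hy.2] : θ < t - y) (by linarith [hy.1])
    have d1 := ((((hasDerivAt_id y).const_add t).cos).const_sub (Real.cos θ)).log p1.ne'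
    have d2 := ((((hasDerivAt_id y).const_sub t).cos).const_sub (Real.cos θ)).log p2.ne'
    have d3 := ((hasDerivAt_id y).const_mul 2).mul_const
      (Real.sin t / (Real.cos θ - Real.cos t))
    refine ((d1.sub d2).sub d3).congr_deriv ?_
    simp only [id_eq]
    ring
  have hmono : MonotoneOn D (Set.Icc 0 φ) := by
    refine monotoneOn_of_deriv_nonneg (convex_Icc _ _)
      (fun y hy => (hder y hy).continuousAt.continuousWithinAt)
      (fun y hy => (hder y (interior_subset hy)).differentiableAt.differentiableWithinAt) ?_
    intro y hy
    have hy' := interior_subset hy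
    rw [(hder y hy').deriv]
    have := midpoint_le_add hθ hy'.1 (by linarith [hy'.2] : θ < t - y) (by linarith [hy'.2])
    linarith
  have := hmono (Set.left_mem_Icc.2 hφ) (Set.right_mem_Icc.2 hφ) hφ
  simp only [hD, add_zero, sub_zero, mul_zero, zero_mul, sub_self] at this
  linarith

theorem midpoint_sum_le_log' {θ t φ : ℝ} (hθ : θ ≤ Real.pi) (hφ : 0 ≤ φ) (h1 : t + φ < θ)
    (h2 : 0 ≤ t - φ) :
    2 * φ * (Real.sin t / (Real.cos t - Real.cos θ)) ≤
      Real.log (Real.cos (t - φ) - Real.cos θ) - Real.log (Real.cos (t + φ) - Real.cos θ) := by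
  have h := midpoint_sum_le_log (θ := Real.pi - θ) (t := Real.pi - t) (φ := φ) (by linarith) hφ
    (by linarith) (by linarith)
  have e1 : Real.pi - t + φ = Real.pi - (t - φ) := by ring
  have e2 : Real.pi - t - φ = Real.pi - (t + φ) := by ring
  rw [e1, e2] at h
  simp only [Real.cos_pi_sub, Real.sin_pi_sub] at h
  have e3 : ∀ x, -Real.cos θ - -Real.cos x = Real.cos x - Real.cos θ := fun x => by ring
  simpa only [e3] using h

/-- The contribution of the two nodes adjacent to `θ`, at distances `x` and `y`. -/
lemma near_sum_le {θ x y : ℝ} (hx : 0 < x) (hy : 0 < y) (h1 : 0 < θ - x) (h2 : θ + y < Real.pi) :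
    Real.sin (θ - x) / (Real.cos (θ - x) - Real.cos θ) +
      Real.sin (θ + y) / (Real.cos θ - Real.cos (θ + y)) ≤ 1 / x + 1 / y := by
  have cot_le : ∀ z, 0 < z → z < Real.pi → Real.cos (z / 2) / Real.sin (z / 2) ≤ 2 / z := by
    intro z hz hz'
    have hs : 0 < Real.sin (z / 2) := Real.sin_pos_of_pos_of_lt_pi (by linarith) (by linarith)
    have hc : 0 < Real.cos (z / 2) := Real.cos_pos_of_mem_Ioo ⟨by linarith, by linarith⟩
    have := Real.lt_tan (x := z / 2) (by linarith) (by linarith)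
    rw [Real.tan_eq_sin_div_cos, lt_div_iff₀ hc] at this
    rw [div_le_div_iff₀ hs hz]
    linarith
  -- `sin t / (cos t - cos θ)` splits into two cotangents
  have split1 : Real.sin (θ - x) / (Real.cos (θ - x) - Real.cos θ) =
      (Real.cos (x / 2) / Real.sin (x / 2) -
        Real.cos (θ - x / 2) / Real.sin (θ - x / 2)) / 2 := by
    have hs : 0 < Real.sin (x / 2) := Real.sin_pos_of_pos_of_lt_pi (by linarith) (by linarith)
    have hs' : 0 < Real.sin (θ - x / 2) :=
      Real.sin_pos_of_pos_of_lt_pi (by linarith) (by linarith)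
    have e1 : Real.cos (θ - x) - Real.cos θ = 2 * Real.sin (θ - x / 2) * Real.sin (x / 2) := by
      rw [Real.cos_sub_cos]
      rw [show (θ - x + θ) / 2 = θ - x / 2 by ring, show (θ - x - θ) / 2 = -(x / 2) by ring,
        Real.sin_neg]
      ring
    have e2 : Real.sin (θ - x) = Real.sin (θ - x / 2) * Real.cos (x / 2) -
        Real.cos (θ - x / 2) * Real.sin (x / 2) := by
      rw [← Real.sin_sub]; congr 1; ring
    rw [e1, e2]
    generalize Real.sin (θ - x / 2) = S at *
    field_simp
  have split2 : Real.sin (θ + y) / (Real.cos θ - Real.cos (θ + y)) =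
      (Real.cos (y / 2) / Real.sin (y / 2) +
        Real.cos (θ + y / 2) / Real.sin (θ + y / 2)) / 2 := by
    have hs : 0 < Real.sin (y / 2) := Real.sin_pos_of_pos_of_lt_pi (by linarith) (by linarith)
    have hs' : 0 < Real.sin (θ + y / 2) :=
      Real.sin_pos_of_pos_of_lt_pi (by linarith) (by linarith)
    have e1 : Real.cos θ - Real.cos (θ + y) = 2 * Real.sin (θ + y / 2) * Real.sin (y / 2) := by
      rw [Real.cos_sub_cos]
      rw [show (θ + (θ + y)) / 2 = θ + y / 2 by ring, show (θ - (θ + y)) / 2 = -(y / 2) by ring,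
        Real.sin_neg]
      ring
    have e2 : Real.sin (θ + y) = Real.sin (θ + y / 2) * Real.cos (y / 2) +
        Real.cos (θ + y / 2) * Real.sin (y / 2) := by
      rw [← Real.sin_add]; congr 1; ring
    rw [e1, e2]
    generalize Real.sin (θ + y / 2) = S at *
    field_simp
  have hmono : Real.cos (θ + y / 2) / Real.sin (θ + y / 2) ≤
      Real.cos (θ - x / 2) / Real.sin (θ - x / 2) := by
    have hs : 0 < Real.sin (θ + y / 2) :=
      Real.sin_pos_of_pos_of_lt_pi (by linarith) (by linarith)
    have hs' : 0 < Real.sin (θ - x / 2) :=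
      Real.sin_pos_of_pos_of_lt_pi (by linarith) (by linarith)
    rw [div_le_div_iff₀ hs hs']
    have : 0 ≤ Real.sin ((θ + y / 2) - (θ - x / 2)) :=
      Real.sin_nonneg_of_nonneg_of_le_pi (by linarith) (by linarith)
    rw [Real.sin_sub] at this
    linarith
  have c1 := cot_le x hx (by linarith)
  have c2 := cot_le y hy (by linarith)
  rw [split1, split2]
  have e1 : 1 / x = 2 / x / 2 := by ring
  have e2 : 1 / y = 2 / y / 2 := by ring
  rw [e1, e2]
  linarith

/-- A concave quadratic exceeds `f` between two points at which it does. -/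
lemma le_quadratic_of_le_endpoints {u v z z₁ z₂ f : ℝ} (h1 : z₁ ≤ z) (h2 : z ≤ z₂)
    (f1 : f ≤ (u + z₁) * (v - z₁))
    (f2 : f ≤ (u + z₂) * (v - z₂)) : f ≤ (u + z) * (v - z) := by
  rcases h1.eq_or_lt with rfl | h1'
  · exact f1
  have h12 : 0 < z₂ - z₁ := by linarith
  have : 0 ≤ (z₂ - z₁) * ((u + z) * (v - z) - f) := by
    have e : (z₂ - z₁) * ((u + z) * (v - z) - f) = (z₂ - z) * ((u + z₁) * (v - z₁) - f) +
        (z - z₁) * ((u + z₂) * (v - z₂) - f) + (z - z₁) * (z₂ - z) * (z₂ - z₁) := by ring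
    rw [e]
    have := mul_nonneg (sub_nonneg.2 h2) (sub_nonneg.2 f1)
    have := mul_nonneg (sub_nonneg.2 h1) (sub_nonneg.2 f2)
    have := mul_nonneg (mul_nonneg (sub_nonneg.2 h1) (sub_nonneg.2 h2)) h12.le
    linarith
  have := nonneg_of_mul_nonneg_right this h12
  linarith

/-- The contribution of the nodes that are not adjacent to `θ` is governed by the logarithm of the
product on the right. In terms of the cotangent `z` of `θ` this product, divided by `sin ^ 2 θ`, is a
concave quadratic, so that it is enough to bound it at the extreme values of `z`. -/
lemma far_product_ge {θ α β b : ℝ} (hα : 0 < α) (hβ : 0 < β) (h1 : 2 * β ≤ θ)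
    (h2 : θ + 2 * α ≤ Real.pi) (hαb : α ≤ b) (hβb : β ≤ b) (hb : b < Real.pi / 2) :
    (1 - Real.cos (α + β) ^ 2 / Real.cos b ^ 2) * Real.sin θ ^ 2 ≤
      (Real.cos θ - Real.cos (θ + 2 * α)) * (Real.cos (θ - 2 * β) - Real.cos θ) := by
  have hS : 0 < Real.sin θ := Real.sin_pos_of_pos_of_lt_pi (by linarith) (by linarith)
  have hsa : 0 < Real.sin α := Real.sin_pos_of_pos_of_lt_pi hα (by linarith)
  have hsb : 0 < Real.sin β := Real.sin_pos_of_pos_of_lt_pi hβ (by linarith)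
  have hcb : 0 < Real.cos b := Real.cos_pos_of_mem_Ioo ⟨by linarith, hb⟩
  have hca : Real.cos b ≤ Real.cos α :=
    Real.cos_le_cos_of_nonneg_of_le_pi hα.le (by linarith) hαb
  have hcβ : Real.cos b ≤ Real.cos β :=
    Real.cos_le_cos_of_nonneg_of_le_pi hβ.le (by linarith) hβb
  have hca0 := hcb.trans_le hca
  have hcβ0 := hcb.trans_le hcβ
  set z := Real.cos θ / Real.sin θ with hz
  set u := Real.cos α / Real.sin α with hu
  set v := Real.cos β / Real.sin β with hv
  have g1 := Real.sin_sq_add_cos_sq α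
  have g2 := Real.sin_sq_add_cos_sq β
  have hprod : (Real.cos θ - Real.cos (θ + 2 * α)) * (Real.cos (θ - 2 * β) - Real.cos θ) =
      4 * Real.sin α ^ 2 * Real.sin β ^ 2 * ((u + z) * (v - z)) * Real.sin θ ^ 2 := by
    rw [Real.cos_sub_cos, Real.cos_sub_cos,
      show (θ + (θ + 2 * α)) / 2 = θ + α by ring, show (θ - (θ + 2 * α)) / 2 = -α by ring,
      show (θ - 2 * β + θ) / 2 = θ - β by ring, show (θ - 2 * β - θ) / 2 = -β by ring,
      Real.sin_neg, Real.sin_neg, Real.sin_add, Real.sin_sub, hz, hu, hv]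
    field_simp
    ring
  -- the cotangent of `θ` lies between `-cot (2 α)` and `cot (2 β)`
  have hz2 : z ≤ (v - 1 / v) / 2 := by
    have hs : 0 ≤ Real.sin (θ - 2 * β) :=
      Real.sin_nonneg_of_nonneg_of_le_pi (by linarith) (by linarith)
    rw [Real.sin_sub, Real.sin_two_mul, Real.cos_two_mul'] at hs
    have e : (v - 1 / v) / 2 = (Real.cos β ^ 2 - Real.sin β ^ 2) / (2 * Real.sin β * Real.cos β) := by
      rw [hv]; field_simp
    rw [e, hz, div_le_div_iff₀ hS (by positivity)]
    linarith
  have hz1 : -((u - 1 / u) / 2) ≤ z := by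
    have hs : 0 ≤ Real.sin (θ + 2 * α) :=
      Real.sin_nonneg_of_nonneg_of_le_pi (by linarith) (by linarith)
    rw [Real.sin_add, Real.sin_two_mul, Real.cos_two_mul'] at hs
    have e : -((u - 1 / u) / 2) =
        (-(Real.cos α ^ 2 - Real.sin α ^ 2)) / (2 * Real.sin α * Real.cos α) := by
      rw [hu]; field_simp
    rw [e, hz, div_le_div_iff₀ (by positivity) hS]
    linarith
  have hend : ∀ x y : ℝ, 0 < Real.sin x → 0 < Real.sin y → 0 < Real.cos x → Real.cos b ≤ Real.cos y →
      (1 - Real.cos (x + y) ^ 2 / Real.cos b ^ 2) / (4 * Real.sin x ^ 2 * Real.sin y ^ 2) ≤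
        (Real.cos x / Real.sin x + (Real.cos y / Real.sin y - 1 / (Real.cos y / Real.sin y)) / 2) *
        (Real.cos y / Real.sin y - (Real.cos y / Real.sin y - 1 / (Real.cos y / Real.sin y)) / 2) := by
    intro x y hx hy hcx hcy
    have hcy0 := hcb.trans_le hcy
    rw [div_le_iff₀ (by positivity)]
    have e : (Real.cos x / Real.sin x + (Real.cos y / Real.sin y - 1 / (Real.cos y / Real.sin y)) / 2) *
        (Real.cos y / Real.sin y - (Real.cos y / Real.sin y - 1 / (Real.cos y / Real.sin y)) / 2) *
        (4 * Real.sin x ^ 2 * Real.sin y ^ 2) = 1 - Real.cos (x + y) ^ 2 / Real.cos y ^ 2 := by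
      have k1 := Real.sin_sq_add_cos_sq x
      have k2 := Real.sin_sq_add_cos_sq y
      rw [Real.cos_add]
      have e1 : Real.cos x / Real.sin x +
          (Real.cos y / Real.sin y - 1 / (Real.cos y / Real.sin y)) / 2 =
          (2 * Real.cos x * Real.sin y * Real.cos y +
            Real.sin x * (Real.cos y ^ 2 - Real.sin y ^ 2)) /
            (2 * Real.sin x * Real.sin y * Real.cos y) := by
        field_simp
      have e2 : Real.cos y / Real.sin y -
          (Real.cos y / Real.sin y - 1 / (Real.cos y / Real.sin y)) / 2 =
          1 / (2 * Real.sin y * Real.cos y) := by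
        field_simp
        linear_combination k2
      rw [e1, e2]
      field_simp
      linear_combination (4 * Real.cos y ^ 2) * k1
    rw [e]
    have : Real.cos (x + y) ^ 2 / Real.cos y ^ 2 ≤ Real.cos (x + y) ^ 2 / Real.cos b ^ 2 := by
      gcongr
    linarith
  have hpos : 0 < 4 * Real.sin α ^ 2 * Real.sin β ^ 2 := by positivity
  have := le_quadratic_of_le_endpoints (u := u) (v := v) hz1 hz2
    (f := (1 - Real.cos (α + β) ^ 2 / Real.cos b ^ 2) / (4 * Real.sin α ^ 2 * Real.sin β ^ 2))
    (by
      have := hend β α hsb hsa hcβ0 hca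
      rw [← hu, ← hv, add_comm β α] at this
      convert this using 1
      · congr 1; ring
      · ring)
    (hend α β hsa hsb hca0 hcβ)
  rw [hprod]
  rw [div_le_iff₀ hpos] at this
  have h3 := mul_le_mul_of_nonneg_right this (sq_nonneg (Real.sin θ))
  linarith

/-- The numerical inequality behind `one_sub_cos_ratio_ge`, for `φ = π / (2n)` with `4 ≤ n`. -/
lemma eight_div_pi_sq_le {φ B : ℝ} (hφ0 : 0 < φ) (hφ1 : φ ≤ 0.394) (hB1 : φ ≤ B)
    (hB2 : B ≤ 1.5 * φ) :
    8 / Real.pi ^ 2 ≤ (1 - (2 * φ - B) ^ 2 / 6) * (1 - (2 * φ + B) ^ 2 / 6) * (B ^ 2 + 1) := by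
  have hpi' := Real.pi_gt_d2
  have h8 : 8 / Real.pi ^ 2 ≤ 0.82 := by
    rw [div_le_iff₀ (by positivity)]; nlinarith
  refine h8.trans ?_
  have hP : φ ^ 2 ≤ 0.156 := by
    nlinarith
  have hBP1 : φ ^ 2 ≤ B ^ 2 := by gcongr
  have hBP2 : B ^ 2 ≤ 2.25 * φ ^ 2 := by nlinarith
  have : 1 - (4 * φ ^ 2 + B ^ 2) / 3 ≤ (1 - (2 * φ - B) ^ 2 / 6) * (1 - (2 * φ + B) ^ 2 / 6) := by
    have : 0 ≤ (2 * φ - B) ^ 2 / 6 * ((2 * φ + B) ^ 2 / 6) := by positivity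
    linear_combination this
  have h3 : (1 - (4 * φ ^ 2 + B ^ 2) / 3) * (B ^ 2 + 1) ≤ (1 - (2 * φ - B) ^ 2 / 6) * (1 - (2 * φ + B) ^ 2 / 6) * (B ^ 2 + 1) := by
    gcongr
  refine le_trans ?_ h3
  have h4 := sq_nonneg φ
  generalize φ ^ 2 = P at *
  generalize B ^ 2 = Q at *
  have h5 := mul_nonneg (sub_nonneg.2 hBP1) (by linarith : 0 ≤ 2 - 4 * P - Q)
  have h6 := mul_nonneg h4 (sub_nonneg.2 hBP2)
  have h7 := mul_nonneg h4 (sub_nonneg.2 hP)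
  linarith

lemma one_sub_cos_ratio_ge {n : ℕ} (hn : 4 ≤ n) {b : ℝ} (hb0 : 0 ≤ b) (hb1 : b ≤ 1) :
    (6 - 2 * b - b ^ 2 / 2) / n ^ 2 ≤ 1 - Real.cos (2 * (Real.pi / (2 * n))) ^ 2 /
      Real.cos (Real.pi / (2 * n) * (1 + b / 2)) ^ 2 := by
  have hn' : (4 : ℝ) ≤ n := by exact_mod_cast hn
  have hn0 : (0 : ℝ) < n := by linarith
  set φ := Real.pi / (2 * n) with hφ
  clear_value φ
  have hφ0 : 0 < φ := by rw [hφ]; have := Real.pi_pos; positivity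
  have hφ1 : φ ≤ Real.pi / 8 := by
    rw [hφ]; apply div_le_div_of_nonneg_left Real.pi_pos.le (by norm_num); linarith
  have hpi := Real.pi_lt_d2
  have hpi' := Real.pi_gt_d2
  set B := φ * (1 + b / 2) with hB
  clear_value B
  have hB1 : φ ≤ B := by rw [hB]; nlinarith
  have hB2 : B ≤ 1.5 * φ := by rw [hB]; nlinarith
  have hcb : 0 < Real.cos B := Real.cos_pos_of_mem_Ioo ⟨by linarith, by linarith⟩
  have hx : 0 < 2 * φ - B := by linarith
  have hy : 0 < 2 * φ + B := by linarith
  have e : 1 - Real.cos (2 * φ) ^ 2 / Real.cos B ^ 2 =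
      Real.sin (2 * φ - B) * Real.sin (2 * φ + B) / Real.cos B ^ 2 := by
    rw [eq_div_iff (by positivity), sub_mul, div_mul_cancel₀ _ (by positivity), Real.sin_sub,
      Real.sin_add]
    have k1 := Real.sin_sq_add_cos_sq (2 * φ)
    have k2 := Real.sin_sq_add_cos_sq B
    linear_combination (-(Real.cos B ^ 2)) * k1 + Real.cos (2 * φ) ^ 2 * k2
  rw [e]
  have hcos : Real.cos B ^ 2 ≤ 1 / (B ^ 2 + 1) := by
    have := Real.cos_le_one_div_sqrt_sq_add_one (x := B) (by linarith) (by linarith)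
    calc Real.cos B ^ 2 ≤ (1 / √(B ^ 2 + 1)) ^ 2 := by gcongr
      _ = 1 / (B ^ 2 + 1) := by rw [div_pow, Real.sq_sqrt (by positivity), one_pow]
  have s1 := Real.sin_ge_sub_cube hx.le
  have s2 := Real.sin_ge_sub_cube hy.le
  have s1' : 0 ≤ (2 * φ - B) - (2 * φ - B) ^ 3 / 6 := by
    have : 2 * φ - B ≤ 1.5 := by linarith
    have : (2 * φ - B) ^ 2 ≤ 1.5 ^ 2 := by gcongr
    nlinarith
  have s2' : 0 ≤ (2 * φ + B) - (2 * φ + B) ^ 3 / 6 := by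
    have : 2 * φ + B ≤ 1.5 := by linarith
    have : (2 * φ + B) ^ 2 ≤ 1.5 ^ 2 := by gcongr
    nlinarith
  rw [div_le_div_iff₀ (by positivity) (by positivity)]
  have hkey := eight_div_pi_sq_le hφ0 (by linarith) hB1 hB2
  have hpos : 0 ≤ 6 - 2 * b - b ^ 2 / 2 := by nlinarith
  calc (6 - 2 * b - b ^ 2 / 2) * Real.cos B ^ 2
      ≤ (6 - 2 * b - b ^ 2 / 2) * (1 / (B ^ 2 + 1)) := by gcongr
    _ = (8 / Real.pi ^ 2) * ((2 * φ - B) * (2 * φ + B)) * n ^ 2 / (B ^ 2 + 1) := by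
        have hxy : (2 * φ - B) * (2 * φ + B) = φ ^ 2 * (3 - b - b ^ 2 / 4) := by rw [hB]; ring
        have hφn : φ ^ 2 * (n : ℝ) ^ 2 = Real.pi ^ 2 / 4 := by
          rw [hφ, div_pow]
          field_simp
          norm_num
        have e8 : 8 / Real.pi ^ 2 * (φ ^ 2 * (3 - b - b ^ 2 / 4)) * (n : ℝ) ^ 2 =
            (3 - b - b ^ 2 / 4) * (8 / Real.pi ^ 2 * (φ ^ 2 * (n : ℝ) ^ 2)) := by ring
        have e9 : 8 / Real.pi ^ 2 * (Real.pi ^ 2 / 4) = 2 := by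
          field_simp
          norm_num
        rw [hxy, e8, hφn, e9]
        ring
    _ ≤ ((1 - (2 * φ - B) ^ 2 / 6) * (1 - (2 * φ + B) ^ 2 / 6) * (B ^ 2 + 1)) *
          ((2 * φ - B) * (2 * φ + B)) * n ^ 2 / (B ^ 2 + 1) := by gcongr
    _ = ((2 * φ - B) - (2 * φ - B) ^ 3 / 6) * ((2 * φ + B) - (2 * φ + B) ^ 3 / 6) * n ^ 2 := by
        rw [div_eq_iff (by positivity)]
        ring
    _ ≤ Real.sin (2 * φ - B) * Real.sin (2 * φ + B) * n ^ 2 := by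
        have := s1'.trans s1
        gcongr

/-- The adjacent nodes contribute at most `4` and the others at most `q * (-log D)` to `π` times the
Lebesgue function, where `q = |cos (n θ)|` and `b` measures the distance of `θ` from the midpoint of
the two adjacent nodes. -/
lemma four_add_mul_neg_log_le {n : ℕ} (hn : 4 ≤ n) {b q D : ℝ} (hb0 : 0 ≤ b) (hb1 : b ≤ 1) (hq0 : 0 ≤ q)
    (hq : q ≤ 1 - b ^ 2) (hD : (6 - 2 * b - b ^ 2 / 2) / n ^ 2 ≤ D) :
    4 + q * (-Real.log D) ≤ 2 * Real.log n + 3 * Real.pi / 4 := by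
  have hn' : (4 : ℝ) ≤ n := by exact_mod_cast hn
  have hn0 : (0 : ℝ) < n := by linarith
  have hpi' := Real.pi_gt_d2
  have hl2 := Real.log_two_gt_d9
  have hl4 : 1.386 ≤ Real.log 4 := by
    rw [show (4 : ℝ) = 2 ^ 2 by norm_num, Real.log_pow]; push_cast; linarith
  have hln : 1.386 ≤ Real.log n := hl4.trans (Real.log_le_log (by norm_num) hn')
  rcases le_or_gt (-Real.log D) 0 with h | h
  · have := mul_nonpos_of_nonneg_of_nonpos hq0 h
    linarith
  set y := 6 - 2 * b - b ^ 2 / 2 with hy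
  clear_value y
  have hy0 : 3.5 ≤ y := by nlinarith
  have hlD : -Real.log D ≤ 2 * Real.log n - Real.log y := by
    have := Real.log_le_log (by positivity) hD
    rw [Real.log_div (by positivity) (by positivity), Real.log_pow] at this
    push_cast at this
    linarith
  have hly : 2.386 - 4 / y ≤ Real.log y := by
    have := Real.one_sub_inv_le_log_of_pos (x := y / 4) (by positivity)
    rw [Real.log_div (by positivity) (by norm_num), inv_div] at this
    linarith
  have h1 : q * (-Real.log D) ≤ (1 - b ^ 2) * (2 * Real.log n - (2.386 - 4 / y)) := by
    calc q * (-Real.log D) ≤ (1 - b ^ 2) * (-Real.log D) := by gcongr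
      _ ≤ _ := by
        gcongr
        · nlinarith
        · linarith
  have h2 : 1.645 ≤ b ^ 2 * (2 * 1.386) + (1 - b ^ 2) * (2.386 - 4 / y) := by
    have hy' : 0 < y := by linarith
    have e : b ^ 2 * (2 * 1.386) + (1 - b ^ 2) * (2.386 - 4 / y) =
      (b ^ 2 * (2 * 1.386) * y + (1 - b ^ 2) * (2.386 * y - 4)) / y := by field_simp
    rw [e, le_div_iff₀ hy', hy]
    nlinarith [mul_nonneg hb0 (sub_nonneg.2 hb1), sq_nonneg (b - 0.1), sq_nonneg b,
      mul_nonneg (sq_nonneg b) (sub_nonneg.2 hb1), mul_nonneg (mul_nonneg (sq_nonneg b) hb0) (sub_nonneg.2 hb1)]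
  have h3 : b ^ 2 * (2 * 1.386) ≤ b ^ 2 * (2 * Real.log n) := by gcongr
  linarith

lemma sum_abs_basis_of_eq_node {ι : Type*} [Fintype ι] [DecidableEq ι] (v : ι → ℝ)
    (hv : Function.Injective v) (k : ι) :
    ∑ i, |(Lagrange.basis Finset.univ v i).eval (v k)| = 1 := by
  rw [Finset.sum_eq_single k]
  · rw [Lagrange.eval_basis_self hv.injOn (Finset.mem_univ _), abs_one]
  · intro i _ hi
    rw [Lagrange.eval_basis_of_ne hi (Finset.mem_univ _), abs_zero]
  · simp

lemma cos_le_one_sub_sq {x : ℝ} (hx : |x| ≤ 1) : Real.cos (Real.pi / 2 * x) ≤ 1 - x ^ 2 := by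
  wlog h0 : 0 ≤ x generalizing x
  · have := this (x := -x) (by simpa using hx) (by linarith)
    simpa using this
  rw [abs_of_nonneg h0] at hx
  have hs : x * (√2 / 2) ≤ Real.sin (Real.pi / 4 * x) := by
    have := strictConcaveOn_sin_Icc.concaveOn.2
      (show (0 : ℝ) ∈ Set.Icc 0 Real.pi from ⟨le_rfl, Real.pi_pos.le⟩)
      (show Real.pi / 4 ∈ Set.Icc 0 Real.pi from ⟨by positivity, by linarith [Real.pi_pos]⟩)
      (sub_nonneg.2 hx) h0 (sub_add_cancel 1 x)
    simp only [smul_eq_mul, Real.sin_zero, mul_zero, zero_add, Real.sin_pi_div_four] at this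
    rwa [mul_comm (Real.pi / 4) x]
  have h2 : Real.pi / 2 * x = 2 * (Real.pi / 4 * x) := by ring
  have h3 := Real.sin_sq_add_cos_sq (Real.pi / 4 * x)
  rw [h2, Real.cos_two_mul]
  have h4 : (x * (√2 / 2)) ^ 2 ≤ Real.sin (Real.pi / 4 * x) ^ 2 := by
    gcongr
  have h5 : (x * (√2 / 2)) ^ 2 = x ^ 2 / 2 := by
    rw [mul_pow, div_pow, Real.sq_sqrt (by norm_num)]; ring
  linarith

lemma sum_far_right_le {n m : ℕ} (hm : m + 2 ≤ n) {θ : ℝ} (h0 : 0 ≤ θ)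
    (h1 : θ < (2 * (m + 2 : ℕ)) * (Real.pi / (2 * n))) :
    2 * (Real.pi / (2 * n)) * ∑ k ∈ Finset.Ico (m + 2) n,
      (Real.sin (chebAngle n k) / (Real.cos θ - Real.cos (chebAngle n k))) ≤
    Real.log (1 + Real.cos θ) -
      Real.log (Real.cos θ - Real.cos (2 * (m + 2 : ℕ) * (Real.pi / (2 * n)))) := by
  have hn : (0 : ℝ) < n := by exact_mod_cast (by omega : 0 < n)
  set φ := Real.pi / (2 * n) with hφ
  have hφ0 : 0 < φ := by have := Real.pi_pos; positivity
  have hnφ : 2 * n * φ = Real.pi := by rw [hφ]; field_simp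
  clear_value φ
  set e : ℕ → ℝ := fun k => Real.log (Real.cos θ - Real.cos (2 * (k : ℝ) * φ)) with he
  have ha : ∀ k, chebAngle n k = 2 * k * φ + φ := fun k => by
    unfold chebAngle; rw [hφ]; field_simp
  have := Finset.sum_Ico_sub e hm
  have hlast : Real.log (1 + Real.cos θ) = e n := by
    simp only [he]
    rw [hnφ, Real.cos_pi]
    congr 1; ring
  rw [hlast]
  rw [show Real.log (Real.cos θ - Real.cos (2 * (m + 2 : ℕ) * φ)) = e (m + 2) from rfl, ← this,
    Finset.mul_sum]
  refine Finset.sum_le_sum fun k hk => ?_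
  rw [Finset.mem_Ico] at hk
  have hk1 : ((m + 2 : ℕ) : ℝ) ≤ k := by exact_mod_cast hk.1
  have hk2 : (k : ℝ) + 1 ≤ n := by exact_mod_cast hk.2
  have := midpoint_sum_le_log (θ := θ) (t := chebAngle n k) (φ := φ) h0 hφ0.le
    (by rw [ha]; nlinarith) (by rw [ha]; nlinarith)
  refine this.trans_eq ?_
  simp only [he, ha]
  push_cast
  congr 3 <;> ring_nf

lemma sum_far_left_le {n m : ℕ} (hn : 0 < n) {θ : ℝ} (h0 : θ ≤ Real.pi)
    (h1 : (2 * m) * (Real.pi / (2 * n)) < θ) :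
    2 * (Real.pi / (2 * n)) * ∑ k ∈ Finset.range m,
      (Real.sin (chebAngle n k) / (Real.cos (chebAngle n k) - Real.cos θ)) ≤
    Real.log (1 - Real.cos θ) -
      Real.log (Real.cos (2 * m * (Real.pi / (2 * n))) - Real.cos θ) := by
  have hn : (0 : ℝ) < n := by exact_mod_cast hn
  set φ := Real.pi / (2 * n) with hφ
  have hφ0 : 0 < φ := by have := Real.pi_pos; positivity
  have hnφ : 2 * n * φ = Real.pi := by rw [hφ]; field_simp
  clear_value φ
  set e : ℕ → ℝ := fun k => Real.log (Real.cos (2 * (k : ℝ) * φ) - Real.cos θ) with he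
  have ha : ∀ k, chebAngle n k = 2 * k * φ + φ := fun k => by
    unfold chebAngle; rw [hφ]; field_simp
  have := Finset.sum_range_sub' e m
  have hlast : Real.log (1 - Real.cos θ) = e 0 := by
    simp [he]
  rw [hlast]
  rw [show Real.log (Real.cos (2 * m * φ) - Real.cos θ) = e m from rfl, ← this,
    Finset.mul_sum]
  refine Finset.sum_le_sum fun k hk => ?_
  rw [Finset.mem_range] at hk
  have hk2 : (k : ℝ) + 1 ≤ m := by exact_mod_cast hk
  have hk0 : (0 : ℝ) ≤ k := k.cast_nonneg
  have := midpoint_sum_le_log' (θ := θ) (t := chebAngle n k) (φ := φ) h0 hφ0.le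
    (by rw [ha]; nlinarith) (by rw [ha]; nlinarith)
  refine this.trans_eq ?_
  simp only [he, ha]
  push_cast
  congr 3 <;> ring_nf

set_option maxHeartbeats 1000000 in
/-- The Lebesgue function of the zeros of `T_n` at `cos θ`, for `θ` strictly between two consecutive
angles. The two adjacent nodes are treated by `near_sum_le`, the others by comparison with an
integral. -/
theorem chebyshev_lebesgue_function_le {n m : ℕ} (hn : 4 ≤ n) (hm : m + 2 ≤ n) {θ : ℝ}
    (h1 : chebAngle n m < θ) (h2 : θ < chebAngle n (m + 1)) :
    |Real.cos (n * θ)| / n * ∑ k ∈ Finset.range n,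
      Real.sin (chebAngle n k) / |Real.cos θ - Real.cos (chebAngle n k)| ≤
    2 / Real.pi * Real.log n + 3 / 4 := by
  have hn0 : (0 : ℝ) < n := by exact_mod_cast (by omega : 0 < n)
  have hpi := Real.pi_pos
  set φ := Real.pi / (2 * n) with hφ
  have hφ0 : 0 < φ := by positivity
  have hnφ : n * φ = Real.pi / 2 := by rw [hφ]; field_simp
  have hφ4 : 8 * φ ≤ Real.pi := by
    have hn' : (4 : ℝ) ≤ n := by exact_mod_cast hn
    nlinarith
  have ha : ∀ k, chebAngle n k = 2 * k * φ + φ := fun k => by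
    unfold chebAngle; rw [hφ]; field_simp
  have hθ0 : 0 < θ := lt_trans (chebAngle_mem (by omega)).1 h1
  have hθπ : θ < Real.pi := lt_trans h2 (chebAngle_mem (by omega)).2
  -- `δ` locates `θ` between the two neighbouring nodes
  obtain ⟨δ, hδ⟩ : ∃ δ, θ = 2 * (m + 1) * φ - φ * δ :=
    ⟨(2 * (m + 1) * φ - θ) / φ, by field_simp; ring⟩
  have hm1 := ha (m + 1)
  push_cast at hm1
  have hδ1 : -1 < δ := by
    rw [hm1, hδ] at h2; nlinarith
  have hδ2 : δ < 1 := by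
    rw [ha m, hδ] at h1; nlinarith
  have hδabs : |δ| ≤ 1 := abs_le.2 ⟨hδ1.le, hδ2.le⟩
  have hm0 : (0 : ℝ) ≤ m := m.cast_nonneg
  have hmn : (m : ℝ) + 2 ≤ n := by exact_mod_cast hm
  have k1 : φ * δ < φ := by simpa using mul_lt_mul_of_pos_left hδ2 hφ0
  have k2 : -φ < φ * δ := by simpa using mul_lt_mul_of_pos_left hδ1 hφ0
  have k3 : φ * |δ| ≤ φ := by simpa using mul_le_mul_of_nonneg_left hδabs hφ0.le
  have k4 : 0 ≤ m * φ := mul_nonneg hm0 hφ0.le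
  have k5 : (m + 2) * φ ≤ Real.pi / 2 := hnφ ▸ mul_le_mul_of_nonneg_right hmn hφ0.le
  set q := |Real.cos (n * θ)| with hq
  have hqe : q = Real.cos (Real.pi / 2 * δ) := by
    have e : n * θ = -(Real.pi / 2 * δ) + (m + 1 : ℕ) * Real.pi := by
      rw [hδ]; push_cast
      linear_combination (2 * (m + 1) - δ) * hnφ
    rw [hq, e, Real.cos_add_nat_mul_pi, abs_mul, abs_pow, abs_neg, abs_one, one_pow, one_mul,
      Real.cos_neg, abs_of_nonneg]
    have k6 := mul_lt_mul_of_pos_left hδ2 hpi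
    have k7 := mul_lt_mul_of_pos_left hδ1 hpi
    exact Real.cos_nonneg_of_mem_Icc ⟨by linarith, by linarith⟩
  have hq0 : 0 ≤ q := abs_nonneg _
  have hq1 : q ≤ 1 - |δ| ^ 2 := by rw [hqe, sq_abs]; exact cos_le_one_sub_sq hδabs
  clear_value q
  have hcosm : 0 < Real.cos (chebAngle n m) - Real.cos θ :=
    cos_sub_cos_pos (chebAngle_mem (by omega)).1.le h1 hθπ.le
  have hcosm1 : 0 < Real.cos θ - Real.cos (chebAngle n (m + 1)) :=
    cos_sub_cos_pos hθ0.le h2 (chebAngle_mem (by omega)).2.le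
  have hsplit : ∑ k ∈ Finset.range n,
      Real.sin (chebAngle n k) / |Real.cos θ - Real.cos (chebAngle n k)| =
      (∑ k ∈ Finset.range m,
        Real.sin (chebAngle n k) / (Real.cos (chebAngle n k) - Real.cos θ)) +
      (Real.sin (chebAngle n m) / (Real.cos (chebAngle n m) - Real.cos θ) +
        Real.sin (chebAngle n (m + 1)) / (Real.cos θ - Real.cos (chebAngle n (m + 1)))) +
      ∑ k ∈ Finset.Ico (m + 2) n,
        Real.sin (chebAngle n k) / (Real.cos θ - Real.cos (chebAngle n k)) := by
    rw [Finset.range_eq_Ico, ← Finset.sum_Ico_consecutive _ (Nat.zero_le (m + 2)) hm,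
      ← Finset.range_eq_Ico, Finset.sum_range_succ, Finset.sum_range_succ, ← add_assoc]
    rw [abs_of_pos hcosm1, abs_sub_comm (Real.cos θ) (Real.cos (chebAngle n m)),
      abs_of_pos hcosm]
    congr 1
    · congr 2
      refine Finset.sum_congr rfl fun k hk => ?_
      rw [Finset.mem_range] at hk
      rw [abs_sub_comm, abs_of_pos]
      exact cos_sub_cos_pos (chebAngle_mem (by omega)).1.le
        (lt_trans (chebAngle_strictMono (by omega) hk) h1) hθπ.le
    · refine Finset.sum_congr rfl fun k hk => ?_
      rw [Finset.mem_Ico] at hk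
      rw [abs_of_pos]
      exact cos_sub_cos_pos hθ0.le
        (lt_trans h2 (chebAngle_strictMono (by omega) (by omega))) (chebAngle_mem hk.2).2.le
  rw [hsplit]
  have hR := sum_far_right_le hm hθ0.le (by rw [← hφ, hδ]; push_cast; linarith)
  have hL := sum_far_left_le (n := n) (m := m) (by omega) hθπ.le (by rw [← hφ, hδ]; linarith)
  have hN := near_sum_le (θ := θ) (x := φ * (1 - δ)) (y := φ * (1 + δ))
    (mul_pos hφ0 (by linarith)) (mul_pos hφ0 (by linarith)) (by rw [hδ]; linarith)
    (by rw [hδ]; linarith)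
  rw [show θ - φ * (1 - δ) = chebAngle n m by rw [ha, hδ]; ring,
    show θ + φ * (1 + δ) = chebAngle n (m + 1) by rw [hm1, hδ]; ring] at hN
  rw [← hφ] at hR hL
  have eα : θ + 2 * (φ * (1 + δ / 2)) = 2 * (m + 2 : ℕ) * φ := by rw [hδ]; push_cast; ring
  have eβ : θ - 2 * (φ * (1 - δ / 2)) = 2 * m * φ := by rw [hδ]; ring
  have hle := le_abs_self δ
  have hle' := neg_abs_le δ
  have hD := far_product_ge (θ := θ) (α := φ * (1 + δ / 2)) (β := φ * (1 - δ / 2))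
    (b := φ * (1 + |δ| / 2)) (mul_pos hφ0 (by linarith)) (mul_pos hφ0 (by linarith))
    (by linarith) (by rw [eα]; push_cast; linarith)
    (by gcongr) (by gcongr; linarith) (by linarith)
  rw [eα, eβ, show φ * (1 + δ / 2) + φ * (1 - δ / 2) = 2 * φ by ring] at hD
  have hE := one_sub_cos_ratio_ge hn (abs_nonneg δ) hδabs
  rw [← hφ] at hE
  have hsθ : 0 < Real.sin θ := Real.sin_pos_of_pos_of_lt_pi hθ0 hθπ
  have hA : 0 < Real.cos θ - Real.cos (2 * (m + 2 : ℕ) * φ) :=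
    cos_sub_cos_pos hθ0.le (by rw [← eα]; linarith) (by push_cast; linarith)
  have hB : 0 < Real.cos (2 * m * φ) - Real.cos θ :=
    cos_sub_cos_pos (by positivity) (by rw [← eβ]; linarith) hθπ.le
  have hlog := four_add_mul_neg_log_le hn (b := |δ|) (q := q)
    (D := (Real.cos θ - Real.cos (2 * (m + 2 : ℕ) * φ)) * (Real.cos (2 * m * φ) - Real.cos θ) /
      Real.sin θ ^ 2) (abs_nonneg _) hδabs hq0 hq1
    (hE.trans (by rw [le_div_iff₀ (by positivity)]; exact hD))
  have hc1 : 0 < 1 + Real.cos θ := by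
    have := cos_sub_cos_pos hθ0.le hθπ le_rfl
    rw [Real.cos_pi] at this; linarith
  have hc2 : 0 < 1 - Real.cos θ := by
    have := cos_sub_cos_pos le_rfl hθ0 hθπ.le
    rw [Real.cos_zero] at this; linarith
  have hs2 : Real.sin θ ^ 2 = (1 + Real.cos θ) * (1 - Real.cos θ) := by
    rw [Real.sin_sq]; ring
  rw [hs2, Real.log_div (by positivity) (by positivity), Real.log_mul hA.ne' hB.ne',
    Real.log_mul hc1.ne' hc2.ne'] at hlog
  generalize Real.log (1 + Real.cos θ) = l1 at *
  generalize Real.log (1 - Real.cos θ) = l2 at *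
  generalize Real.log (Real.cos θ - Real.cos (2 * (m + 2 : ℕ) * φ)) = l3 at *
  generalize Real.log (Real.cos (2 * m * φ) - Real.cos θ) = l4 at *
  generalize (∑ k ∈ Finset.Ico (m + 2) n,
        Real.sin (chebAngle n k) / (Real.cos θ - Real.cos (chebAngle n k))) = SR at *
  generalize (∑ k ∈ Finset.range m,
        Real.sin (chebAngle n k) / (Real.cos (chebAngle n k) - Real.cos θ)) = SL at *
  generalize Real.sin (chebAngle n m) / (Real.cos (chebAngle n m) - Real.cos θ) +
        Real.sin (chebAngle n (m + 1)) / (Real.cos θ - Real.cos (chebAngle n (m + 1))) = SN at *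
  -- the two neighbouring nodes contribute at most `4 / π`
  have hq' : q ≤ 1 - δ ^ 2 := by rwa [sq_abs] at hq1
  have hp : 0 < 1 - δ ^ 2 := by
    have := mul_pos (sub_pos.2 hδ2) (neg_lt_iff_pos_add.1 hδ1)
    linarith
  have hN' : q * (2 * φ * SN) ≤ 4 := by
    have e : 1 / (φ * (1 - δ)) + 1 / (φ * (1 + δ)) = 2 / (φ * (1 - δ ^ 2)) := by
      have : 1 - δ ≠ 0 := by linarith
      have : 1 + δ ≠ 0 := by linarith
      have : 1 - δ ^ 2 ≠ 0 := hp.ne'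
      rw [show 1 - δ ^ 2 = (1 - δ) * (1 + δ) by ring]
      field_simp
      ring
    rw [e] at hN
    calc q * (2 * φ * SN) ≤ q * (2 * φ * (2 / (φ * (1 - δ ^ 2)))) := by gcongr
      _ = 4 * (q / (1 - δ ^ 2)) := by field_simp; ring
      _ ≤ 4 * 1 := by gcongr; rw [div_le_one hp]; exact hq'
      _ = 4 := by norm_num
  have hfar : q * (2 * φ * (SL + SR)) ≤ q * (-(l3 + l4 - (l1 + l2))) := by
    gcongr
    linarith
  have hfin : q * (2 * φ * (SL + SN + SR)) ≤ 2 * Real.log n + 3 * Real.pi / 4 := by linarith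
  calc q / n * (SL + SN + SR) = q * (2 * φ * (SL + SN + SR)) / Real.pi := by
        rw [hφ]; field_simp
    _ ≤ (2 * Real.log n + 3 * Real.pi / 4) / Real.pi := by gcongr
    _ = 2 / Real.pi * Real.log n + 3 / 4 := by field_simp

theorem sum_abs_basis_chebZero_le {n : ℕ} (hn : 4 ≤ n) {z : ℝ}
    (hz : |z| ≤ Real.cos (Real.pi / (2 * n))) :
    ∑ k, |(Lagrange.basis Finset.univ (chebZero n) k).eval z| ≤
      2 / Real.pi * Real.log n + 3 / 4 := by
  have hn' : (4 : ℝ) ≤ n := by exact_mod_cast hn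
  have hpi := Real.pi_pos
  by_cases hnode : ∃ k, z = chebZero n k
  · obtain ⟨k, rfl⟩ := hnode
    rw [sum_abs_basis_of_eq_node _ (chebZero_injective n)]
    have h1 : 2 * 0.69 ≤ Real.log n := by
      have h2 := Real.log_two_gt_d9
      have : Real.log 4 ≤ Real.log n := Real.log_le_log (by norm_num) hn'
      rw [show (4 : ℝ) = 2 ^ 2 by norm_num, Real.log_pow] at this
      push_cast at this
      linarith
    have h2 : 1 / 2 ≤ 2 / Real.pi := by
      rw [div_le_div_iff₀ (by norm_num) hpi]; linarith [Real.pi_le_four]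
    have : 1 / 2 * (2 * 0.69) ≤ 2 / Real.pi * Real.log n := by gcongr
    linarith
  push Not at hnode
  have hφ : Real.pi / (2 * n) ≤ Real.pi := by
    rw [div_le_iff₀ (by positivity)]; nlinarith
  have hφ0 : 0 ≤ Real.pi / (2 * n) := by positivity
  have hz1 : |z| ≤ 1 := hz.trans (Real.cos_le_one _)
  rw [abs_le] at hz hz1
  set θ := Real.arccos z with hθ
  have hcos : Real.cos θ = z := Real.cos_arccos hz1.1 hz1.2
  have hθ1 : Real.pi / (2 * n) ≤ θ := by
    rw [hθ, ← Real.arccos_cos hφ0 hφ]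
    exact Real.arccos_le_arccos hz.2
  have hθ2 : θ ≤ Real.pi - Real.pi / (2 * n) := by
    rw [hθ, ← Real.arccos_cos (x := Real.pi - Real.pi / (2 * n)) (by linarith) (by linarith)]
    refine Real.arccos_le_arccos ?_
    rw [Real.cos_pi_sub]; exact hz.1
  have hne : ∀ k < n, θ ≠ chebAngle n k := fun k hk h => hnode ⟨k, hk⟩ (by
    rw [chebZero_eq, ← h, hcos])
  have hlast : θ < chebAngle n (n - 1) := by
    refine lt_of_le_of_ne (hθ2.trans_eq ?_) (hne _ (by omega))
    unfold chebAngle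
    rw [Nat.cast_sub (by omega)]
    field_simp
    push_cast
    ring
  have hex : ∃ k, θ < chebAngle n k := ⟨_, hlast⟩
  classical
  have hspec := Nat.find_spec hex
  have hmin : ∀ k < Nat.find hex, ¬ θ < chebAngle n k := fun k hk => Nat.find_min hex hk
  have hlt : Nat.find hex ≤ n - 1 := Nat.find_min' hex hlast
  have hpos : Nat.find hex ≠ 0 := by
    intro h0
    rw [h0] at hspec
    simp only [chebAngle, Nat.cast_zero, mul_zero, zero_add, one_mul] at hspec
    linarith
  obtain ⟨m, hm⟩ := Nat.exists_eq_succ_of_ne_zero hpos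
  rw [hm] at hspec hmin hlt
  have hm1 : chebAngle n m < θ :=
    lt_of_le_of_ne (not_lt.1 (hmin m (Nat.lt_succ_self m))) (hne m (by omega)).symm
  refine le_trans (le_of_eq ?_) (chebyshev_lebesgue_function_le hn (by omega) hm1 hspec)
  rw [Finset.mul_sum, Finset.sum_range]
  refine Finset.sum_congr rfl fun k _ => ?_
  rw [abs_basis_chebZero k (hnode k), chebZero_eq, ← hcos]
  congr 2
  have := T_real_cos θ n
  push_cast at this
  rw [this]

/-! ### The extended Chebyshev points -/

lemma chat_eq (r k : ℕ) : chat r k = 0 + (-1 / Real.cos (Real.pi / (2 * r + 2))) *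
    Real.cos (chebAngle (r + 1) k) := by
  unfold chat chebAngle
  have : (2 * k + 1) / (2 * r + 2) * Real.pi =
    (2 * (k : ℝ) + 1) * Real.pi / (2 * ((r + 1 : ℕ) : ℝ)) := by push_cast; ring
  rw [this]
  ring

lemma chat_mem_Icc {r : ℕ} (hr : 1 ≤ r) (k : Fin (r + 1)) : chat r k ∈ Set.Icc (-1 : ℝ) 1 := by
  have h1 := (chat_strictMono hr).monotone (Fin.zero_le k)
  have h2 := (chat_strictMono hr).monotone (Fin.le_last k)
  simp only [Fin.val_zero, Fin.val_last, chat_zero hr, chat_last hr] at h1 h2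
  exact ⟨h1, h2⟩

lemma chat_two (k : Fin 3) : chat 2 k = k - 1 := by
  have hc := (cos_pos_aux (r := 2) (by norm_num)).ne'
  fin_cases k
  · simpa using chat_zero (r := 2) (by norm_num)
  · have : (2 * ((1 : ℕ) : ℝ) + 1) / (2 * (2 : ℕ) + 2) * Real.pi = Real.pi / 2 := by
      push_cast; ring
    simp [chat, -Nat.cast_one, -Nat.cast_ofNat, this]
    simp
  · simpa using (chat_last (r := 2) (by norm_num)).trans (by norm_num)

/-- The Lebesgue constant of the extended Chebyshev points is at most `ψ(r)`. The points are a
rescaling of the zeros of `T_{r+1}`, for which `chebyshev_lebesgue_function_le` needs `4 ≤ r + 1`;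
for `r = 2` they are `-1, 0, 1` and the constant is `5 / 4`. -/
theorem sum_abs_basis_chat_le {r : ℕ} (hr : 2 ≤ r) {y : ℝ} (hy : |y| ≤ 1) :
    ∑ k, |(Lagrange.basis Finset.univ (fun k : Fin (r + 1) => chat r k) k).eval y| ≤ psi r := by
  rcases hr.eq_or_lt with rfl | hr3
  · have e : (fun k : Fin 3 => chat 2 k) = fun k : Fin 3 => ((k : ℕ) : ℝ) - 1 :=
      funext chat_two
    rw [e]
    have h5 : (5 : ℝ) / 4 ≤ psi 2 := by
      unfold psi
      have : 1 ≤ Real.log (2 + 1) := by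
        rw [Real.le_log_iff_exp_le (by norm_num)]
        linarith [Real.exp_one_lt_d9]
      have h2 : 1 / 2 ≤ 2 / Real.pi := by
        rw [div_le_div_iff₀ (by norm_num) Real.pi_pos]; linarith [Real.pi_le_four]
      have : 1 / 2 * 1 ≤ 2 / Real.pi * Real.log (2 + 1) := by gcongr
      push_cast
      linarith
    refine le_trans ?_ h5
    have u0 : (Finset.univ.erase (0 : Fin 3)) = {1, 2} := by decide
    have u1 : (Finset.univ.erase (1 : Fin 3)) = {0, 2} := by decide
    have u2 : (Finset.univ.erase (2 : Fin 3)) = {0, 1} := by decide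
    rw [Fin.sum_univ_three]
    simp only [Lagrange.basis, u0, u1, u2, eval_prod, Lagrange.basisDivisor, eval_mul, eval_C,
      eval_sub, eval_X]
    rw [Finset.prod_pair (by decide), Finset.prod_pair (by decide), Finset.prod_pair (by decide)]
    norm_num
    rw [abs_le] at hy
    have a1 : |(y : ℝ) - 1| = 1 - y := by rw [abs_of_nonpos (by linarith)]; ring
    have a2 : |y + 1| = y + 1 := abs_of_nonneg (by linarith)
    have a3 : |1 - y| = 1 - y := abs_of_nonneg (by linarith)
    rw [a1, a2, a3]
    have a4 := sq_nonneg (|y| - 1 / 2)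
    have a5 := sq_abs y
    linarith
  · have hc := cos_pos_aux (r := r) (by omega)
    set c := Real.cos (Real.pi / (2 * r + 2)) with hcdef
    have e : (fun k : Fin (r + 1) => chat r k) =
        fun k => 0 + (-1 / c) * chebZero (r + 1) k := funext fun k => chat_eq r k
    have hy' : y = 0 + (-1 / c) * (-c * y) := by field_simp; ring
    rw [e]
    have hz : |-c * y| ≤ Real.cos (Real.pi / (2 * ((r + 1 : ℕ) : ℝ))) := by
      have : 2 * ((r + 1 : ℕ) : ℝ) = 2 * r + 2 := by push_cast; ring
      rw [this, abs_mul, abs_neg, abs_of_pos hc]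
      exact mul_le_of_le_one_right hc.le hy
    have := sum_abs_basis_chebZero_le (n := r + 1) (by omega) hz
    unfold psi
    push_cast at this
    refine le_trans (le_of_eq ?_) this
    refine Finset.sum_congr rfl fun k _ => ?_
    conv_lhs => rw [hy']
    rw [eval_basis_affine _ (by simpa using hc.ne')]

/-- The nodal polynomial of the extended Chebyshev points is a rescaling of `T_{r+1}`. -/
theorem prod_abs_sub_chat_le {r : ℕ} (hr : 1 ≤ r) {y : ℝ} (hy : |y| ≤ 1) :
    ∏ k : Fin (r + 1), |y - chat r k| ≤
      (1 / Real.cos (Real.pi / (2 * r + 2))) ^ (r + 1) * (1 / 2 ^ r) := by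
  have hc := cos_pos_aux hr
  have h1 := T_eq_nodal (r + 1)
  set c := Real.cos (Real.pi / (2 * r + 2)) with hcdef
  have hcy : |-c * y| ≤ 1 := by
    rw [abs_mul, abs_neg, abs_of_pos hc]
    exact mul_le_one₀ (Real.cos_le_one _) (abs_nonneg _) hy
  have h2 := abs_eval_T_real_le_one (r + 1 : ℕ) hcy
  rw [h1, eval_mul, eval_C, Lagrange.eval_nodal, abs_mul, Finset.abs_prod, Nat.add_sub_cancel,
    abs_of_pos (by positivity)] at h2
  have h3 : ∀ k : Fin (r + 1), |y - chat r k| = 1 / c * |-c * y - chebZero (r + 1) k| := by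
    intro k
    have e : -(y - chat r k) = 1 / c * (-c * y - chebZero (r + 1) k) := by
      rw [chat_eq, ← hcdef, chebZero_eq]
      field_simp
      ring
    rw [← abs_neg, e, abs_mul, abs_of_pos (show 0 < 1 / c by positivity)]
  rw [Finset.prod_congr rfl fun k _ => h3 k, Finset.prod_mul_distrib]
  simp only [Finset.prod_const, Finset.card_univ, Fintype.card_fin]
  gcongr
  rw [le_div_iff₀ (by positivity), mul_comm]
  exact h2

end Chebyshev

/-! ### The interpolation error for shifted powers -/

section Remainder

open Polynomial

/-- Iterated Rolle theorem, for a sequence `f 0, f 1, …` of functions each of which is the derivative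
of the preceding one. -/
theorem exists_zero_of_card_zeros {a b : ℝ} (m : ℕ) (f : ℕ → ℝ → ℝ)
    (hf : ∀ i, ∀ x ∈ Set.Icc a b, HasDerivAt (f i) (f (i + 1) x) x) (z : Fin (m + 1) → ℝ)
    (hz : StrictMono z) (hmem : ∀ k, z k ∈ Set.Icc a b) (h0 : ∀ k, f 0 (z k) = 0) :
    ∃ ζ ∈ Set.Icc a b, f m ζ = 0 := by
  induction m generalizing f with
  | zero => exact ⟨z 0, hmem 0, h0 0⟩
  | succ m ih =>
    have hw : ∀ k : Fin (m + 1), ∃ w ∈ Set.Ioo (z k.castSucc) (z k.succ), f 1 w = 0 := by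
      intro k
      have hsub : Set.Icc (z k.castSucc) (z k.succ) ⊆ Set.Icc a b :=
        Set.Icc_subset_Icc (hmem _).1 (hmem _).2
      obtain ⟨w, hw, h⟩ := exists_hasDerivAt_eq_zero (f := f 0) (f' := f 1)
        (hz (Fin.castSucc_lt_succ (i := k)))
        (fun x hx => (hf 0 x (hsub hx)).continuousAt.continuousWithinAt)
        (by rw [h0, h0]) (fun x hx => hf 0 x (hsub (Set.Ioo_subset_Icc_self hx)))
      exact ⟨w, hw, h⟩
    choose w hw hw0 using hw
    obtain ⟨ζ, hζ, h⟩ := ih (fun i => f (i + 1)) (fun i => hf (i + 1)) w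
      (Fin.strictMono_iff_lt_succ.2 fun i => (hw _).2.trans (by
        have := (hw i.succ).1
        rwa [← Fin.succ_castSucc] at this))
      (fun k => ⟨(hmem _).1.trans (hw k).1.le, (hw k).2.le.trans (hmem _).2⟩) hw0
    exact ⟨ζ, hζ, h⟩

/-- The Lagrange form of the interpolation remainder; `f i` is the `i`-th derivative of `f 0`. -/
theorem interpolation_remainder {a b : ℝ} {r : ℕ} (f : ℕ → ℝ → ℝ)
    (hf : ∀ i, ∀ x ∈ Set.Icc a b, HasDerivAt (f i) (f (i + 1) x) x) (v : Fin (r + 1) → ℝ)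
    (hv : Function.Injective v) (hmem : ∀ k, v k ∈ Set.Icc a b) {x : ℝ} (hx : x ∈ Set.Icc a b) :
    ∃ ζ ∈ Set.Icc a b, f 0 x - ∑ k, (Lagrange.basis Finset.univ v k).eval x * f 0 (v k) =
      f (r + 1) ζ / (r + 1).factorial * ∏ k, (x - v k) := by
  set p := Lagrange.interpolate Finset.univ v fun k => f 0 (v k) with hp
  have hpx : ∑ k, (Lagrange.basis Finset.univ v k).eval x * f 0 (v k) = p.eval x := by
    rw [hp, Lagrange.interpolate_apply, eval_finsetSum]
    refine Finset.sum_congr rfl fun k _ => ?_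
    rw [eval_mul, eval_C, mul_comm]
  rw [hpx]
  have hpv : ∀ k, p.eval (v k) = f 0 (v k) := fun k =>
    Lagrange.eval_interpolate_at_node _ hv.injOn (Finset.mem_univ k)
  by_cases hnode : ∃ k, x = v k
  · obtain ⟨k, rfl⟩ := hnode
    refine ⟨v k, hx, ?_⟩
    rw [hpv, sub_self, Finset.prod_eq_zero (Finset.mem_univ k) (sub_self _), mul_zero]
  push Not at hnode
  set N := Lagrange.nodal Finset.univ v with hN
  have hNx : N.eval x = ∏ k, (x - v k) := Lagrange.eval_nodal
  have hN0 : N.eval x ≠ 0 := by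
    rw [hNx]; exact Finset.prod_ne_zero_iff.2 fun k _ => sub_ne_zero.2 (hnode k)
  set K := (f 0 x - p.eval x) / N.eval x with hK
  have hcard : (insert x (Finset.univ.image v)).card = r + 1 + 1 := by
    rw [Finset.card_insert_of_notMem, Finset.card_image_of_injective _ hv]
    · simp
    · simp only [Finset.mem_image, Finset.mem_univ, true_and, not_exists]
      exact fun k hk => hnode k hk.symm
  have hmemz : ∀ y ∈ insert x (Finset.univ.image v), y ∈ Set.Icc a b ∧
      f 0 y - p.eval y - K * N.eval y = 0 := by
    intro y hy
    rcases Finset.mem_insert.1 hy with rfl | hy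
    · refine ⟨hx, ?_⟩
      rw [hK]; field_simp; ring
    · obtain ⟨k, -, rfl⟩ := Finset.mem_image.1 hy
      refine ⟨hmem k, ?_⟩
      rw [hpv, hN, Lagrange.eval_nodal_at_node (Finset.mem_univ k)]
      ring
  obtain ⟨ζ, hζ, h⟩ := exists_zero_of_card_zeros (a := a) (b := b) (r + 1)
    (fun i y => f i y - (derivative^[i] p).eval y - K * (derivative^[i] N).eval y)
    (fun i y hy => by
      simp only [Function.iterate_succ_apply']
      exact ((hf i y hy).sub (Polynomial.hasDerivAt _ _)).sub
        ((Polynomial.hasDerivAt _ _).const_mul K))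
    ((insert x (Finset.univ.image v)).orderEmbOfFin hcard)
    (OrderEmbedding.strictMono _)
    (fun k => (hmemz _ (Finset.orderEmbOfFin_mem _ _ k)).1)
    (fun k => (hmemz _ (Finset.orderEmbOfFin_mem _ _ k)).2)
  refine ⟨ζ, hζ, ?_⟩
  have hp0 : derivative^[r + 1] p = 0 := by
    apply iterate_derivative_eq_zero_of_degree_lt
    have := Lagrange.degree_interpolate_lt (fun k => f 0 (v k)) hv.injOn (s := Finset.univ)
    rw [← hp] at this
    simpa using this
  have hNd : (derivative^[r + 1] N).eval ζ = (r + 1).factorial := by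
    have hdeg : N.natDegree = r + 1 := by rw [hN, Lagrange.natDegree_nodal]; simp
    have hd0 : (derivative^[r + 1] N).natDegree ≤ 0 :=
      (natDegree_iterate_derivative N (r + 1)).trans (by rw [hdeg, Nat.sub_self])
    have hlead : N.coeff (0 + (r + 1)) = 1 := by
      rw [zero_add, ← hdeg]
      exact Lagrange.nodal_monic
    rw [eq_C_of_natDegree_le_zero hd0, eval_C, coeff_iterate_derivative, hlead, zero_add,
      Nat.descFactorial_self]
    simp
  simp only [hp0, eval_zero, sub_zero, hNd] at h
  have hfac : ((r + 1).factorial : ℝ) ≠ 0 := by positivity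
  rw [← hNx, sub_eq_zero.1 h, hK]
  field_simp

/-- The `i`-th derivative of `x ↦ (x + ρ) ^ (-σ)`. -/
def powDeriv (σ ρ : ℝ) (i : ℕ) (x : ℝ) : ℝ :=
  (∏ j ∈ Finset.range i, -(σ + j)) * (x + ρ) ^ (-σ - i)

lemma hasDerivAt_powDeriv (σ ρ : ℝ) (i : ℕ) {x : ℝ} (hx : 0 < x + ρ) :
    HasDerivAt (powDeriv σ ρ i) (powDeriv σ ρ (i + 1) x) x := by
  have h1 : HasDerivAt (fun y : ℝ => y + ρ) 1 x := (hasDerivAt_id x).add_const ρ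
  have h2 := (h1.rpow_const (p := -σ - i) (Or.inl hx.ne')).const_mul
    (∏ j ∈ Finset.range i, -(σ + j))
  refine h2.congr_deriv ?_
  rw [powDeriv, Finset.prod_range_succ]
  push_cast
  rw [show -σ - (i : ℝ) - 1 = -σ - (i + 1) by ring]
  ring

/-- The functions `x ↦ (x + ρ) ^ (-σ)` are log-Lipschitz with constant `σ / χ` where `χ ≤ x + ρ`. -/
lemma rpow_neg_le_exp_mul {σ ρ χ x y : ℝ} (hσ : 0 ≤ σ) (hχ : 0 < χ) (hx : χ ≤ x + ρ)
    (hy : χ ≤ y + ρ) :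
    (x + ρ) ^ (-σ) ≤ (y + ρ) ^ (-σ) * Real.exp (σ / χ * |x - y|) := by
  have hx0 := hχ.trans_le hx
  have hy0 := hχ.trans_le hy
  have h1 : (y + ρ) / (x + ρ) ≤ Real.exp (|x - y| / χ) := by
    have h2 : (y + ρ) / (x + ρ) ≤ |x - y| / χ + 1 := by
      have h3 : (y - x) / (x + ρ) ≤ |x - y| / χ := by
        rw [abs_sub_comm]
        exact (div_le_div_of_nonneg_right (le_abs_self _) hx0.le).trans
          (div_le_div_of_nonneg_left (abs_nonneg _) hχ hx)
      have h4 : (y + ρ) / (x + ρ) = (y - x) / (x + ρ) + 1 := by field_simp; ring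
      linarith
    exact h2.trans (Real.add_one_le_exp _)
  have h2 := Real.rpow_le_rpow (by positivity) h1 hσ
  rw [Real.div_rpow hy0.le hx0.le, ← Real.exp_mul] at h2
  rw [Real.rpow_neg hx0.le, Real.rpow_neg hy0.le]
  have e : |x - y| / χ * σ = σ / χ * |x - y| := by ring
  rw [e] at h2
  have p1 : 0 < (y + ρ) ^ σ := Real.rpow_pos_of_pos hy0 _
  have p2 : 0 < (x + ρ) ^ σ := Real.rpow_pos_of_pos hx0 _
  rw [div_le_iff₀ p2] at h2
  rw [inv_mul_eq_div, inv_eq_one_div, div_le_div_iff₀ p2 p1]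
  linarith

/-- The relative interpolation error for `x ↦ (x + ρ) ^ (-σ)` on an interval of length `h` on which
`χ ≤ x + ρ`, without the factor `h ^ (r + 1)`. It is `Gconst` with `σ = 2 s` and a free `χ`. -/
def errConst (σ : ℝ) (r : ℕ) (h χ : ℝ) : ℝ :=
  (∏ j ∈ Finset.range (r + 1), (σ + j)) / χ ^ (r + 1) * Real.exp (σ * h / χ) *
    (1 / ((r + 1).factorial : ℝ)) * (1 / (2 * Real.cos (Real.pi / (2 * r + 2)))) ^ (r + 1) *
    (1 / 2 ^ r)

lemma Gconst_eq (𝓑 : Digits) (s : ℝ) (r : ℕ) (h : ℝ) :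
    Gconst 𝓑 s r h = errConst (2 * s) r h 𝓑.χ := rfl

theorem abs_interpolation_error_rpow_le {σ ρ χ t₀ d : ℝ} {r : ℕ} (hr : 1 ≤ r) (hσ : 0 ≤ σ)
    (hχ : 0 < χ) (hd : 0 < d) (ht : χ ≤ t₀ + ρ) {x : ℝ} (hx : x ∈ Set.Icc t₀ (t₀ + d)) :
    |(x + ρ) ^ (-σ) - ∑ k : Fin (r + 1), (Lagrange.basis Finset.univ
        (fun k : Fin (r + 1) => t₀ + d * (1 + chat r k) / 2) k).eval x *
        (t₀ + d * (1 + chat r k) / 2 + ρ) ^ (-σ)| ≤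
      errConst σ r d χ * d ^ (r + 1) * (x + ρ) ^ (-σ) := by
  set v : Fin (r + 1) → ℝ := fun k => t₀ + d * (1 + chat r k) / 2 with hv
  have hc := cos_pos_aux hr
  have hchat : ∀ k : Fin (r + 1), chat r k ∈ Set.Icc (-1 : ℝ) 1 := chat_mem_Icc hr
  have hinj : Function.Injective v := by
    intro k l hkl
    apply (chat_strictMono hr).injective
    simp only [hv] at hkl
    have : d * (chat r k - chat r l) = 0 := by linarith
    rcases mul_eq_zero.1 this with h | h
    · exact absurd h hd.ne'
    · simp only; linarith
  have hvmem : ∀ k, v k ∈ Set.Icc t₀ (t₀ + d) := fun k => by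
    have := hchat k
    constructor
    · have := mul_nonneg hd.le (by linarith [this.1] : 0 ≤ 1 + chat r k)
      simp only [hv]; linarith
    · have := mul_nonneg hd.le (by linarith [this.2] : 0 ≤ 1 - chat r k)
      simp only [hv]; linarith
  obtain ⟨ζ, hζ, h⟩ := interpolation_remainder (a := t₀) (b := t₀ + d) (powDeriv σ ρ)
    (fun i y hy => hasDerivAt_powDeriv σ ρ i (by linarith [hy.1])) v hinj hvmem hx
  have e0 : ∀ y, powDeriv σ ρ 0 y = (y + ρ) ^ (-σ) := fun y => by simp [powDeriv]
  simp only [e0] at h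
  rw [h]
  obtain ⟨y, hy, hxy⟩ : ∃ y, |y| ≤ 1 ∧ x = t₀ + d * (1 + y) / 2 := by
    refine ⟨2 * (x - t₀) / d - 1, ?_, by field_simp; ring⟩
    have h1 : 0 ≤ (x - t₀) / d := div_nonneg (by linarith [hx.1]) hd.le
    have h2 : (x - t₀) / d ≤ 1 := by rw [div_le_one hd]; linarith [hx.2]
    rw [abs_le]
    constructor <;> · rw [mul_div_assoc]; linarith
  have hprod : |∏ k, (x - v k)| ≤ (d / 2) ^ (r + 1) *
      ((1 / Real.cos (Real.pi / (2 * r + 2))) ^ (r + 1) * (1 / 2 ^ r)) := by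
    have e : ∀ k, |x - v k| = d / 2 * |y - chat r k| := fun k => by
      have e1 : x - v k = d / 2 * (y - chat r k) := by rw [hxy]; simp only [hv]; ring
      rw [e1, abs_mul, abs_of_pos (show 0 < d / 2 by positivity)]
    rw [Finset.abs_prod, Finset.prod_congr rfl fun k _ => e k, Finset.prod_mul_distrib]
    simp only [Finset.prod_const, Finset.card_univ, Fintype.card_fin]
    gcongr
    exact prod_abs_sub_chat_le hr hy
  have hζρ : χ ≤ ζ + ρ := by linarith [hζ.1]
  have hxρ : χ ≤ x + ρ := by linarith [hx.1]
  have hder : |powDeriv σ ρ (r + 1) ζ| ≤ (∏ j ∈ Finset.range (r + 1), (σ + j)) / χ ^ (r + 1) *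
      (Real.exp (σ * d / χ) * (x + ρ) ^ (-σ)) := by
    have hP : |∏ j ∈ Finset.range (r + 1), -(σ + (j : ℝ))| =
        ∏ j ∈ Finset.range (r + 1), (σ + (j : ℝ)) := by
      rw [Finset.abs_prod]
      exact Finset.prod_congr rfl fun j _ => by rw [abs_neg, abs_of_nonneg (by positivity)]
    have hP0 : 0 ≤ ∏ j ∈ Finset.range (r + 1), (σ + (j : ℝ)) :=
      Finset.prod_nonneg fun j _ => by positivity
    rw [powDeriv, abs_mul, hP, abs_of_nonneg (Real.rpow_nonneg (hχ.le.trans hζρ) _),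
      Real.rpow_sub (hχ.trans_le hζρ), Real.rpow_natCast, div_mul_eq_mul_div, mul_div_assoc]
    have h1 := rpow_neg_le_exp_mul (σ := σ) hσ hχ hζρ hxρ
    have h2 : |ζ - x| ≤ d := abs_le.2 ⟨by linarith [hζ.1, hx.2], by linarith [hζ.2, hx.1]⟩
    have h3 : (ζ + ρ) ^ (-σ) ≤ Real.exp (σ * d / χ) * (x + ρ) ^ (-σ) := by
      refine h1.trans ?_
      rw [mul_comm]
      have : 0 ≤ (x + ρ) ^ (-σ) := Real.rpow_nonneg (hχ.le.trans hxρ) _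
      have e : σ * d / χ = σ / χ * d := by ring
      rw [e]
      gcongr
    have h4 : 0 ≤ Real.exp (σ * d / χ) * (x + ρ) ^ (-σ) :=
      mul_nonneg (Real.exp_pos _).le (Real.rpow_nonneg (hχ.le.trans hxρ) _)
    gcongr
  rw [abs_mul, abs_div, abs_of_pos (show (0 : ℝ) < (r + 1).factorial by positivity)]
  refine (mul_le_mul (div_le_div_of_nonneg_right hder (by positivity)) hprod (abs_nonneg _)
    ((div_nonneg (abs_nonneg _) (by positivity)).trans
      (div_le_div_of_nonneg_right hder (by positivity)))).trans_eq ?_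
  unfold errConst
  rw [div_pow, one_div_pow, one_div_pow, mul_pow]
  field_simp

end Remainder

/-! ### The endpoints `𝔞_k`, `𝔟_k` and the interval `S` -/

namespace Digits

variable (𝓑 : Digits)

lemma γ_mem : 𝓑.γ ∈ 𝓑.carrier := Finset.min'_mem _ _

lemma γ_le {β : ℝ} (hβ : β ∈ 𝓑.carrier) : 𝓑.γ ≤ β := Finset.min'_le _ _ hβ

lemma le_Γ {β : ℝ} (hβ : β ∈ 𝓑.carrier) : β ≤ 𝓑.Γ := Finset.le_max' _ _ hβ

lemma one_le_γ : 1 ≤ 𝓑.γ := 𝓑.one_le _ 𝓑.γ_mem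

lemma γ_lt_Γ : 𝓑.γ < 𝓑.Γ := Finset.min'_lt_max'_of_card _ (by
  have := Finset.one_lt_card_iff_nontrivial.2 𝓑.nontrivial
  omega)

lemma aInf_pos : 0 < 𝓑.aInf := by
  have h1 := 𝓑.one_le_γ
  have h2 := 𝓑.γ_lt_Γ
  have : 𝓑.γ / 2 < √((𝓑.γ / 2) ^ 2 + 𝓑.γ / 𝓑.Γ) := by
    apply Real.lt_sqrt_of_sq_lt
    have : 0 < 𝓑.γ / 𝓑.Γ := div_pos (by linarith) (by linarith)
    linarith
  unfold aInf
  linarith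

lemma aInf_mul : 𝓑.aInf * (𝓑.aInf + 𝓑.γ) = 𝓑.γ / 𝓑.Γ := by
  have h1 := 𝓑.one_le_γ
  have h2 := 𝓑.γ_lt_Γ
  have : 0 < 𝓑.γ / 𝓑.Γ := div_pos (by linarith) (by linarith)
  have := Real.sq_sqrt (show 0 ≤ (𝓑.γ / 2) ^ 2 + 𝓑.γ / 𝓑.Γ by positivity)
  unfold aInf
  linarith

lemma bInf_pos : 0 < 𝓑.bInf := by
  have h1 := 𝓑.one_le_γ
  have h2 := 𝓑.γ_lt_Γ
  have : 𝓑.Γ / 2 < √((𝓑.Γ / 2) ^ 2 + 𝓑.Γ / 𝓑.γ) := by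
    apply Real.lt_sqrt_of_sq_lt
    have : 0 < 𝓑.Γ / 𝓑.γ := div_pos (by linarith) (by linarith)
    linarith
  unfold bInf
  linarith

lemma bInf_mul : 𝓑.bInf * (𝓑.bInf + 𝓑.Γ) = 𝓑.Γ / 𝓑.γ := by
  have h1 := 𝓑.one_le_γ
  have h2 := 𝓑.γ_lt_Γ
  have : 0 < 𝓑.Γ / 𝓑.γ := div_pos (by linarith) (by linarith)
  have := Real.sq_sqrt (show 0 ≤ (𝓑.Γ / 2) ^ 2 + 𝓑.Γ / 𝓑.γ by positivity)
  unfold bInf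
  linarith

lemma γ_mul_bInf : 𝓑.γ * 𝓑.bInf = 𝓑.Γ * 𝓑.aInf := by
  have h1 := 𝓑.one_le_γ
  have h2 := 𝓑.γ_lt_Γ
  have ha := 𝓑.aInf_pos
  have hb := 𝓑.bInf_pos
  have e1 := 𝓑.aInf_mul
  have e2 := 𝓑.bInf_mul
  have hΓ : 0 < 𝓑.Γ := by linarith
  have hγ : 0 < 𝓑.γ := by linarith
  rw [eq_div_iff hΓ.ne'] at e1
  rw [eq_div_iff hγ.ne'] at e2
  have h0 : (𝓑.γ * 𝓑.bInf - 𝓑.Γ * 𝓑.aInf) *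
      (𝓑.γ * 𝓑.bInf + 𝓑.Γ * 𝓑.aInf + 𝓑.γ * 𝓑.Γ) = 0 := by
    linear_combination 𝓑.γ * e2 - 𝓑.Γ * e1
  rcases mul_eq_zero.1 h0 with h | h
  · linarith
  · have : 0 < 𝓑.γ * 𝓑.bInf + 𝓑.Γ * 𝓑.aInf + 𝓑.γ * 𝓑.Γ := by positivity
    linarith

lemma theta_γ_aInf : theta 𝓑.γ 𝓑.aInf = 𝓑.bInf := by
  have h1 := 𝓑.one_le_γ
  have h2 := 𝓑.γ_lt_Γ
  have ha := 𝓑.aInf_pos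
  have e1 := 𝓑.aInf_mul
  have e2 := 𝓑.γ_mul_bInf
  rw [eq_div_iff (by linarith)] at e1
  unfold theta
  rw [div_eq_iff (by linarith)]
  have hγ : 𝓑.γ ≠ 0 := by linarith
  apply mul_left_cancel₀ hγ
  linear_combination (-1) * e1 - (𝓑.aInf + 𝓑.γ) * e2

lemma theta_Γ_bInf : theta 𝓑.Γ 𝓑.bInf = 𝓑.aInf := by
  have h1 := 𝓑.one_le_γ
  have h2 := 𝓑.γ_lt_Γ
  have hb := 𝓑.bInf_pos
  have e1 := 𝓑.bInf_mul
  have e2 := 𝓑.γ_mul_bInf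
  rw [eq_div_iff (by linarith)] at e1
  unfold theta
  rw [div_eq_iff (by linarith)]
  have hγ : 𝓑.Γ ≠ 0 := by linarith
  apply mul_left_cancel₀ hγ
  linear_combination (-1) * e1 + (𝓑.bInf + 𝓑.Γ) * e2

lemma aInf_lt_bInf : 𝓑.aInf < 𝓑.bInf := by
  have h1 := 𝓑.one_le_γ
  have h2 := 𝓑.γ_lt_Γ
  have ha := 𝓑.aInf_pos
  have e2 := 𝓑.γ_mul_bInf
  nlinarith

lemma bInf_lt_one : 𝓑.bInf < 1 := by
  have h1 := 𝓑.one_le_γ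
  have ha := 𝓑.aInf_pos
  rw [← 𝓑.theta_γ_aInf, theta, div_lt_one (by linarith)]
  linarith

lemma S_subset : 𝓑.S ⊆ Set.Icc 0 1 := Set.Icc_subset_Icc 𝓑.aInf_pos.le 𝓑.bInf_lt_one.le

lemma theta_anti {β x y : ℝ} (hβ : 1 ≤ β) (hx : 0 ≤ x) (hxy : x ≤ y) :
    theta β y ≤ theta β x := by
  unfold theta
  exact one_div_le_one_div_of_le (by linarith) (by linarith)

lemma ends_bounds (k : ℕ) : 0 ≤ (𝓑.ends k).1 ∧ (𝓑.ends k).1 ≤ 𝓑.aInf ∧ 𝓑.bInf ≤ (𝓑.ends k).2 := by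
  have h1 := 𝓑.one_le_γ
  have h2 := 𝓑.γ_lt_Γ
  have ha := 𝓑.aInf_pos
  have hb := 𝓑.bInf_pos
  induction k with
  | zero =>
    refine ⟨le_rfl, ha.le, ?_⟩
    rw [← 𝓑.theta_γ_aInf]
    simp only [ends, theta]
    exact one_div_le_one_div_of_le (by linarith) (by linarith)
  | succ k ih =>
    refine ⟨?_, ?_, ?_⟩
    · simp only [ends, theta]
      exact div_nonneg zero_le_one (by linarith [ih.2.2])
    · conv_rhs => rw [← 𝓑.theta_Γ_bInf]
      exact theta_anti (by linarith) hb.le ih.2.2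
    · conv_lhs => rw [← 𝓑.theta_γ_aInf]
      exact theta_anti h1 ih.1 ih.2.1

lemma ends_mono (k : ℕ) : (𝓑.ends k).1 ≤ (𝓑.ends (k + 1)).1 ∧
    (𝓑.ends (k + 1)).2 ≤ (𝓑.ends k).2 := by
  have h1 := 𝓑.one_le_γ
  have h2 := 𝓑.γ_lt_Γ
  induction k with
  | zero =>
    refine ⟨(𝓑.ends_bounds 1).1, ?_⟩
    simp [ends, theta]
  | succ k ih =>
    have hk := 𝓑.ends_bounds k
    have hk1 := 𝓑.ends_bounds (k + 1)
    have hb := 𝓑.bInf_pos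
    exact ⟨theta_anti (by linarith) (by linarith) ih.2, theta_anti h1 hk.1 ih.1⟩

lemma ends_fst_mono : Monotone fun k => (𝓑.ends k).1 :=
  monotone_nat_of_le_succ fun k => (𝓑.ends_mono k).1

/-- The total distance of `(𝔞_k, 𝔟_k)` from the limit contracts by the factor `𝔟_∞ < 1`. -/
lemma ends_dist_le (k : ℕ) : (𝓑.aInf - (𝓑.ends (k + 1)).1) + ((𝓑.ends (k + 1)).2 - 𝓑.bInf) ≤
    𝓑.bInf * ((𝓑.aInf - (𝓑.ends k).1) + ((𝓑.ends k).2 - 𝓑.bInf)) := by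
  have h1 := 𝓑.one_le_γ
  have h2 := 𝓑.γ_lt_Γ
  have ha := 𝓑.aInf_pos
  have hb := 𝓑.bInf_pos
  have hab := 𝓑.aInf_lt_bInf
  obtain ⟨p0, p1, p2⟩ := 𝓑.ends_bounds k
  have e1 : 𝓑.aInf - (𝓑.ends (k + 1)).1 =
      𝓑.aInf * ((𝓑.ends k).2 - 𝓑.bInf) / ((𝓑.ends k).2 + 𝓑.Γ) := by
    have : (𝓑.ends k).2 + 𝓑.Γ ≠ 0 := by linarith
    have : 𝓑.bInf + 𝓑.Γ ≠ 0 := by linarith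
    rw [← 𝓑.theta_Γ_bInf]
    simp only [ends, theta]
    field_simp
    ring
  have e2 : (𝓑.ends (k + 1)).2 - 𝓑.bInf =
      𝓑.bInf * (𝓑.aInf - (𝓑.ends k).1) / ((𝓑.ends k).1 + 𝓑.γ) := by
    have : (𝓑.ends k).1 + 𝓑.γ ≠ 0 := by linarith
    have : 𝓑.aInf + 𝓑.γ ≠ 0 := by linarith
    rw [← 𝓑.theta_γ_aInf]
    simp only [ends, theta]
    field_simp
    ring
  have e3 : 𝓑.aInf * ((𝓑.ends k).2 - 𝓑.bInf) / ((𝓑.ends k).2 + 𝓑.Γ) ≤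
      𝓑.bInf * ((𝓑.ends k).2 - 𝓑.bInf) :=
    (div_le_self (mul_nonneg ha.le (by linarith)) (by linarith)).trans
      (mul_le_mul_of_nonneg_right hab.le (by linarith))
  have e4 : 𝓑.bInf * (𝓑.aInf - (𝓑.ends k).1) / ((𝓑.ends k).1 + 𝓑.γ) ≤
      𝓑.bInf * (𝓑.aInf - (𝓑.ends k).1) :=
    div_le_self (mul_nonneg hb.le (by linarith)) (by linarith)
  rw [e1, e2]
  linarith

lemma tendsto_ends_fst : Filter.Tendsto (fun k => (𝓑.ends k).1) Filter.atTop (nhds 𝓑.aInf) := by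
  set d : ℕ → ℝ := fun k => (𝓑.aInf - (𝓑.ends k).1) + ((𝓑.ends k).2 - 𝓑.bInf) with hd
  have hle : ∀ k, d k ≤ 𝓑.bInf ^ k * d 0 := by
    intro k
    induction k with
    | zero => simp
    | succ k ih =>
      refine (𝓑.ends_dist_le k).trans ?_
      rw [pow_succ', mul_assoc]
      exact mul_le_mul_of_nonneg_left ih 𝓑.bInf_pos.le
  have hlim : Filter.Tendsto (fun k => 𝓑.aInf - 𝓑.bInf ^ k * d 0) Filter.atTop
      (nhds (𝓑.aInf - 0 * d 0)) :=
    ((tendsto_pow_atTop_nhds_zero_of_lt_one 𝓑.bInf_pos.le 𝓑.bInf_lt_one).mul_const _).const_sub _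
  rw [zero_mul, sub_zero] at hlim
  refine tendsto_of_tendsto_of_tendsto_of_le_of_le hlim tendsto_const_nhds (fun k => ?_)
    fun k => (𝓑.ends_bounds k).2.1
  have h1 := hle k
  have h2 := (𝓑.ends_bounds k).2.2
  simp only [hd] at h1 ⊢
  linarith

/-- The lower bound on `S` of the arguments `x + ρ` of the powers in `L_s ^ (n + 1) 1`; it increases to
`χ`. -/
def shift (n : ℕ) : ℝ := 𝓑.aInf + (𝓑.γ + (𝓑.ends n).1)

lemma shift_pos (n : ℕ) : 0 < 𝓑.shift n := by
  unfold shift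
  linarith [𝓑.aInf_pos, 𝓑.one_le_γ, (𝓑.ends_bounds n).1]

lemma shift_mono : Monotone 𝓑.shift := fun m n hmn => by
  have := 𝓑.ends_fst_mono hmn
  unfold shift
  linarith

lemma tendsto_shift : Filter.Tendsto 𝓑.shift Filter.atTop (nhds 𝓑.χ) := by
  have := (𝓑.tendsto_ends_fst.const_add 𝓑.γ).const_add 𝓑.aInf
  rwa [show 𝓑.aInf + (𝓑.γ + 𝓑.aInf) = 𝓑.χ by unfold χ; ring] at this

lemma Btilde_pos (k : ℕ) : 0 < 𝓑.Btilde k := by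
  have h1 := 𝓑.one_le_γ
  induction k using Nat.twoStepInduction with
  | zero => simp [Btilde]
  | one => simp only [Btilde]; linarith
  | more k h0 h1' =>
    simp only [Btilde]
    have : 0 < 𝓑.γ * 𝓑.Btilde (k + 1) := mul_pos (by linarith) h1'
    linarith

end Digits

/-! ### Words -/

section Words

variable {𝓑 : Digits}

lemma thetaWord_zero (ω : 𝓑.Word 0) (x : ℝ) : thetaWord ω x = x := by simp [thetaWord]

lemma thetaWord_cons {ν : ℕ} (β : 𝓑.carrier) (ω : 𝓑.Word ν) (x : ℝ) :
    thetaWord (Fin.cons β ω : 𝓑.Word (ν + 1)) x = theta β (thetaWord ω x) := by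
  simp [thetaWord, List.ofFn_succ]

lemma digit_one_le (β : 𝓑.carrier) : 1 ≤ (β : ℝ) := 𝓑.one_le β β.2

lemma theta_nonneg {β x : ℝ} (hβ : 1 ≤ β) (hx : 0 ≤ x) : 0 ≤ theta β x :=
  div_nonneg zero_le_one (by linarith)

lemma abs_deriv_theta {β x : ℝ} (h : x + β ≠ 0) : |deriv (theta β) x| = 1 / (x + β) ^ 2 := by
  rw [(hasDerivAt_theta h).deriv, abs_neg, abs_of_pos (by positivity)]

lemma thetaWord_nonneg {ν : ℕ} (ω : 𝓑.Word ν) {x : ℝ} (hx : 0 ≤ x) : 0 ≤ thetaWord ω x := by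
  induction ν with
  | zero => rwa [thetaWord_zero]
  | succ ν ih =>
    rw [← Fin.cons_self_tail ω, thetaWord_cons]
    exact theta_nonneg (digit_one_le _) (ih _)

lemma differentiableAt_thetaWord {ν : ℕ} (ω : 𝓑.Word ν) {x : ℝ} (hx : 0 ≤ x) :
    DifferentiableAt ℝ (thetaWord ω) x := by
  induction ν with
  | zero =>
    rw [funext (thetaWord_zero ω)]
    exact differentiableAt_id
  | succ ν ih =>
    rw [← Fin.cons_self_tail ω, funext (thetaWord_cons _ _)]
    have h1 := digit_one_le (ω 0)
    have h2 := thetaWord_nonneg (Fin.tail ω) hx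
    exact (hasDerivAt_theta (by linarith)).differentiableAt.comp x (ih _)

lemma gWord_zero (ω : 𝓑.Word 0) (x : ℝ) : gWord ω x = 1 := by
  rw [gWord, funext (thetaWord_zero ω)]
  simp

lemma gWord_cons {ν : ℕ} (β : 𝓑.carrier) (ω : 𝓑.Word ν) {x : ℝ} (hx : 0 ≤ x) :
    gWord (Fin.cons β ω : 𝓑.Word (ν + 1)) x =
      |deriv (theta β) (thetaWord ω x)| * gWord ω x := by
  have h1 := digit_one_le β
  have h2 := thetaWord_nonneg ω hx
  rw [gWord, funext (thetaWord_cons β ω), gWord, ← abs_mul]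
  congr 1
  exact deriv_comp x (hasDerivAt_theta (by linarith)).differentiableAt
    (differentiableAt_thetaWord ω hx)

lemma gWord_nonneg {ν : ℕ} (ω : 𝓑.Word ν) (x : ℝ) : 0 ≤ gWord ω x := abs_nonneg _

lemma gWord_le_one {ν : ℕ} (ω : 𝓑.Word ν) {x : ℝ} (hx : 0 ≤ x) : gWord ω x ≤ 1 := by
  induction ν with
  | zero => rw [gWord_zero]
  | succ ν ih =>
    rw [← Fin.cons_self_tail ω, gWord_cons _ _ hx]
    have h1 := digit_one_le (ω 0)
    have h2 := thetaWord_nonneg (Fin.tail ω) hx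
    refine mul_le_one₀ ?_ (gWord_nonneg _ _) (ih _)
    rw [abs_deriv_theta (by linarith), div_le_one (by positivity)]
    exact one_le_pow₀ (by linarith)

/-- `θ_ω` is a Möbius transformation of determinant `±1` with the entries of its matrix bounded below
by the `B̃_j`; the bound on `A` is stated in the form in which the induction uses it. -/
lemma thetaWord_moebius {k : ℕ} (ω : 𝓑.Word (k + 1)) :
    ∃ A B C D : ℝ, |A * D - B * C| = 1 ∧ 𝓑.Btilde (k + 1) ≤ A + 𝓑.γ * 𝓑.Btilde k ∧
      𝓑.Btilde k ≤ B ∧ 𝓑.Btilde k ≤ C ∧ 𝓑.Btilde (k + 1) ≤ D ∧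
      ∀ x, 0 ≤ x → thetaWord ω x = (A * x + B) / (C * x + D) := by
  induction k with
  | zero =>
    refine ⟨0, 1, 1, ω 0, by norm_num, by simp [Digits.Btilde], by simp [Digits.Btilde],
      by simp [Digits.Btilde], by simpa [Digits.Btilde] using 𝓑.γ_le (ω 0).2, fun x _ => ?_⟩
    rw [← Fin.cons_self_tail ω, thetaWord_cons, thetaWord_zero]
    simp [theta]
  | succ k ih =>
    obtain ⟨A, B, C, D, hdet, hA, hB, hC, hD, h⟩ := ih (Fin.tail ω)
    have hβ := 𝓑.γ_le (ω 0).2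
    have hγ := 𝓑.one_le_γ
    have p0 := 𝓑.Btilde_pos k
    have p1 := 𝓑.Btilde_pos (k + 1)
    have hrec : 𝓑.Btilde (k + 1 + 1) = 𝓑.Btilde k + 𝓑.γ * 𝓑.Btilde (k + 1) := rfl
    have q1 : 𝓑.γ * 𝓑.Btilde k ≤ (ω 0 : ℝ) * C := mul_le_mul hβ hC p0.le (by linarith)
    have q2 : 𝓑.γ * 𝓑.Btilde (k + 1) ≤ (ω 0 : ℝ) * D := mul_le_mul hβ hD p1.le (by linarith)
    refine ⟨C, D, A + ω 0 * C, B + ω 0 * D, ?_, ?_, hD, by linarith, by linarith, fun x hx => ?_⟩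
    · rw [← hdet, ← abs_neg]; congr 1; ring
    · rw [hrec]; linarith
    · rw [← Fin.cons_self_tail ω, thetaWord_cons, h x hx, theta]
      have hden : 0 < C * x + D := by
        have := mul_nonneg (p0.le.trans hC) hx
        linarith
      simp only [Fin.cons_zero]
      rw [div_add' _ _ _ hden.ne', one_div_div]
      congr 1
      ring

/-- `θ_ω` is Lipschitz with constant `c(ν)` on `[𝔞_∞, ∞)`. -/
lemma abs_thetaWord_sub_le {ν : ℕ} (hν : 1 ≤ ν) (ω : 𝓑.Word ν) {x y : ℝ} (hx : 𝓑.aInf ≤ x)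
    (hy : 𝓑.aInf ≤ y) : |thetaWord ω x - thetaWord ω y| ≤ 𝓑.c ν * |x - y| := by
  obtain ⟨k, rfl⟩ := Nat.exists_eq_add_of_le' hν
  obtain ⟨A, B, C, D, hdet, -, -, hC, hD, h⟩ := thetaWord_moebius ω
  have ha := 𝓑.aInf_pos
  have p0 := 𝓑.Btilde_pos k
  have p1 := 𝓑.Btilde_pos (k + 1)
  set m := 𝓑.Btilde k * 𝓑.aInf + 𝓑.Btilde (k + 1) with hm
  have hm0 : 0 < m := by positivity
  have hden : ∀ z, 𝓑.aInf ≤ z → m ≤ C * z + D := fun z hz => by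
    have := mul_le_mul hC hz ha.le (p0.le.trans hC)
    linarith
  have hx' := hden x hx
  have hy' := hden y hy
  have hx0 := hm0.trans_le hx'
  have hy0 := hm0.trans_le hy'
  rw [h x (ha.le.trans hx), h y (ha.le.trans hy)]
  have e : (A * x + B) / (C * x + D) - (A * y + B) / (C * y + D) =
      (A * D - B * C) * (x - y) / ((C * x + D) * (C * y + D)) := by
    rw [div_sub_div _ _ hx0.ne' hy0.ne']
    congr 1
    ring
  rw [e, abs_div, abs_mul, hdet, one_mul, abs_of_pos (mul_pos hx0 hy0), Digits.c,
    Nat.add_sub_cancel, ← hm, inv_mul_eq_div]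
  refine div_le_div_of_nonneg_left (abs_nonneg _) (by positivity) ?_
  rw [sq]
  exact mul_le_mul hx' hy' hm0.le hx0.le

end Words

/-! ### The iterates `L_s ^ n 1` -/

/-- The transfer operator on arbitrary real functions of a real variable. -/
def realTransfer (𝓑 : Digits) (s : ℝ) (f : ℝ → ℝ) (x : ℝ) : ℝ :=
  ∑ β : 𝓑.carrier, |deriv (theta β) x| ^ s * f (theta β x)

/-- `L_s ^ n 1`, as a function of a real variable; only its values on `[0, ∞)` matter. -/
def transferIter (𝓑 : Digits) (s : ℝ) (n : ℕ) : ℝ → ℝ := (realTransfer 𝓑 s)^[n] fun _ => 1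

lemma transferIter_succ (𝓑 : Digits) (s : ℝ) (n : ℕ) :
    transferIter 𝓑 s (n + 1) = realTransfer 𝓑 s (transferIter 𝓑 s n) :=
  Function.iterate_succ_apply' _ _ _

lemma iterate_realTransfer (𝓑 : Digits) (s : ℝ) (ν : ℕ) (f : ℝ → ℝ) {x : ℝ} (hx : 0 ≤ x) :
    (realTransfer 𝓑 s)^[ν] f x = ∑ ω : 𝓑.Word ν, gWord ω x ^ s * f (thetaWord ω x) := by
  induction ν generalizing f with
  | zero =>
    rw [Fintype.sum_unique]
    simp [gWord_zero, thetaWord_zero]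
  | succ ν ih =>
    rw [Function.iterate_succ_apply, ih, ← (Fin.consEquiv fun _ => 𝓑.carrier).sum_comp,
      Fintype.sum_prod_type, Finset.sum_comm]
    refine Finset.sum_congr rfl fun ω _ => ?_
    rw [realTransfer, Finset.mul_sum]
    refine Finset.sum_congr rfl fun β _ => ?_
    have e : (Fin.consEquiv fun _ => 𝓑.carrier) (β, ω) = (Fin.cons β ω : 𝓑.Word (ν + 1)) := rfl
    rw [e]
    rw [thetaWord_cons, gWord_cons β ω hx, Real.mul_rpow (abs_nonneg _) (gWord_nonneg _ _)]
    ring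

lemma transferIter_add (𝓑 : Digits) (s : ℝ) (n ν : ℕ) {x : ℝ} (hx : 0 ≤ x) :
    transferIter 𝓑 s (n + ν) x =
      ∑ ω : 𝓑.Word ν, gWord ω x ^ s * transferIter 𝓑 s n (thetaWord ω x) := by
  rw [← iterate_realTransfer _ _ _ _ hx, transferIter, transferIter, add_comm,
    Function.iterate_add_apply]

/-- On `[0, ∞)`, `f` is a finite nonnegative combination of the functions `x ↦ (x + ρ) ^ (-σ)` with
`ρ` between `lo` and `hi`. -/
def IsPowerMixture (σ lo hi : ℝ) (f : ℝ → ℝ) : Prop :=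
  ∃ (ι : Type) (_ : Fintype ι) (c ρ : ι → ℝ), (∀ i, 0 ≤ c i) ∧ (∀ i, ρ i ∈ Set.Icc lo hi) ∧
    ∀ x, 0 ≤ x → f x = ∑ i, c i * (x + ρ i) ^ (-σ)

lemma abs_deriv_theta_rpow {β x s : ℝ} (hβ : 0 < x + β) :
    |deriv (theta β) x| ^ s = (x + β) ^ (-(2 * s)) := by
  rw [abs_deriv_theta hβ.ne', one_div, Real.inv_rpow (by positivity), Real.rpow_neg hβ.le,
    Real.rpow_mul hβ.le]
  norm_num

/-- The transfer operator preserves mixtures, because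
`(x + β) * (θ_β x + ρ) = ρ * (x + β + 1 / ρ)`. -/
lemma IsPowerMixture.realTransfer {𝓑 : Digits} {s lo hi : ℝ} {f : ℝ → ℝ}
    (hlo : 0 < lo) (hf : IsPowerMixture (2 * s) lo hi f) :
    IsPowerMixture (2 * s) (𝓑.γ + 1 / hi) (𝓑.Γ + 1 / lo) (realTransfer 𝓑 s f) := by
  obtain ⟨ι, _, c, ρ, hc, hρ, h⟩ := hf
  refine ⟨𝓑.carrier × ι, inferInstance, fun p => c p.2 * ρ p.2 ^ (-(2 * s)),
    fun p => p.1 + 1 / ρ p.2, fun p => mul_nonneg (hc _) (Real.rpow_nonneg (hlo.le.trans (hρ _).1) _),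
    fun p => ?_, fun x hx => ?_⟩
  · have hp := hlo.trans_le (hρ p.2).1
    exact ⟨add_le_add (𝓑.γ_le p.1.2) (one_div_le_one_div_of_le hp (hρ p.2).2),
      add_le_add (𝓑.le_Γ p.1.2) (one_div_le_one_div_of_le hlo (hρ p.2).1)⟩
  · rw [CFTransfer.realTransfer, Fintype.sum_prod_type]
    refine Finset.sum_congr rfl fun β _ => ?_
    have hβ := digit_one_le β
    rw [h _ (theta_nonneg hβ hx), Finset.mul_sum]
    refine Finset.sum_congr rfl fun i _ => ?_
    have hp := hlo.trans_le (hρ i).1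
    have hxβ : 0 < x + β := by linarith
    rw [abs_deriv_theta_rpow hxβ]
    have e : (x + β) * (theta β x + ρ i) = ρ i * (x + (β + 1 / ρ i)) := by
      unfold theta; field_simp; ring
    have h3 : 0 ≤ theta β x + ρ i := add_nonneg (theta_nonneg hβ hx) hp.le
    calc (x + β) ^ (-(2 * s)) * (c i * (theta β x + ρ i) ^ (-(2 * s)))
        = c i * ((x + β) * (theta β x + ρ i)) ^ (-(2 * s)) := by
          rw [Real.mul_rpow hxβ.le h3]; ring
      _ = _ := by
          rw [e, Real.mul_rpow hp.le (by positivity)]; ring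

lemma IsPowerMixture.mono {σ lo hi lo' hi' : ℝ} {f : ℝ → ℝ} (hf : IsPowerMixture σ lo hi f)
    (h1 : lo' ≤ lo) (h2 : hi ≤ hi') : IsPowerMixture σ lo' hi' f := by
  obtain ⟨ι, _, c, ρ, hc, hρ, h⟩ := hf
  exact ⟨ι, _, c, ρ, hc, fun i => Set.Icc_subset_Icc h1 h2 (hρ i), h⟩

lemma isPowerMixture_transferIter (𝓑 : Digits) (s : ℝ) (n : ℕ) :
    IsPowerMixture (2 * s) (𝓑.γ + (𝓑.ends n).1) (𝓑.Γ + (𝓑.ends n).2)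
      (transferIter 𝓑 s (n + 1)) := by
  have h1 := 𝓑.one_le_γ
  induction n with
  | zero =>
    refine ⟨𝓑.carrier, inferInstance, fun _ => 1, fun β => β, fun _ => zero_le_one,
      fun β => ⟨?_, ?_⟩, fun x hx => ?_⟩
    · simpa [Digits.ends] using 𝓑.γ_le β.2
    · have : 0 ≤ 1 / 𝓑.γ := by positivity
      have := 𝓑.le_Γ β.2
      simp only [Digits.ends]; linarith
    · rw [transferIter_succ, realTransfer]
      refine Finset.sum_congr rfl fun β _ => ?_
      have hβ := digit_one_le β
      rw [abs_deriv_theta_rpow (by linarith), mul_comm]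
      rfl
  | succ n ih =>
    rw [transferIter_succ]
    have hn := 𝓑.ends_bounds n
    refine (ih.realTransfer (𝓑 := 𝓑) (by linarith)).mono ?_ ?_
    · simp only [Digits.ends, theta]; rw [add_comm 𝓑.Γ]
    · simp only [Digits.ends, theta]; rw [add_comm 𝓑.γ (𝓑.ends n).1]

lemma IsPowerMixture.nonneg {σ lo hi : ℝ} {f : ℝ → ℝ} (hf : IsPowerMixture σ lo hi f)
    (hlo : 0 ≤ lo) {x : ℝ} (hx : 0 ≤ x) : 0 ≤ f x := by
  obtain ⟨ι, _, c, ρ, hc, hρ, h⟩ := hf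
  rw [h x hx]
  exact Finset.sum_nonneg fun i _ => mul_nonneg (hc i)
    (Real.rpow_nonneg (add_nonneg hx (hlo.trans (hρ i).1)) _)

lemma IsPowerMixture.le_mul_exp {σ lo hi a : ℝ} {f : ℝ → ℝ} (hf : IsPowerMixture σ lo hi f)
    (hσ : 0 ≤ σ) (ha : 0 ≤ a) (hlo : 0 < lo) {x y : ℝ} (hx : a ≤ x) (hy : a ≤ y) :
    f x ≤ f y * Real.exp (σ / (a + lo) * |x - y|) := by
  obtain ⟨ι, _, c, ρ, hc, hρ, h⟩ := hf
  rw [h x (ha.trans hx), h y (ha.trans hy), Finset.sum_mul]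
  refine Finset.sum_le_sum fun i _ => ?_
  rw [mul_assoc]
  exact mul_le_mul_of_nonneg_left (rpow_neg_le_exp_mul hσ (by linarith)
    (add_le_add hx (hρ i).1) (add_le_add hy (hρ i).1)) (hc i)

lemma IsPowerMixture.abs_interpolation_error_le {σ lo hi a t₀ d : ℝ} {f : ℝ → ℝ} {r : ℕ}
    (hf : IsPowerMixture σ lo hi f) (hr : 1 ≤ r) (hσ : 0 ≤ σ) (ha : 0 ≤ a) (hlo : 0 < lo)
    (hd : 0 < d) (ht : a ≤ t₀) {x : ℝ} (hx : x ∈ Set.Icc t₀ (t₀ + d)) :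
    |f x - ∑ k : Fin (r + 1), (Lagrange.basis Finset.univ
        (fun k : Fin (r + 1) => t₀ + d * (1 + chat r k) / 2) k).eval x *
        f (t₀ + d * (1 + chat r k) / 2)| ≤
      errConst σ r d (a + lo) * d ^ (r + 1) * f x := by
  obtain ⟨ι, _, c, ρ, hc, hρ, h⟩ := hf
  have hnode : ∀ k : Fin (r + 1), 0 ≤ t₀ + d * (1 + chat r k) / 2 := fun k => by
    have := mul_nonneg hd.le (by linarith [(chat_mem_Icc hr k).1] : 0 ≤ 1 + chat r k)
    linarith
  have hx0 : 0 ≤ x := by linarith [hx.1]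
  have e : f x - ∑ k : Fin (r + 1), (Lagrange.basis Finset.univ
        (fun k : Fin (r + 1) => t₀ + d * (1 + chat r k) / 2) k).eval x *
        f (t₀ + d * (1 + chat r k) / 2) =
      ∑ i, c i * ((x + ρ i) ^ (-σ) - ∑ k : Fin (r + 1), (Lagrange.basis Finset.univ
        (fun k : Fin (r + 1) => t₀ + d * (1 + chat r k) / 2) k).eval x *
        (t₀ + d * (1 + chat r k) / 2 + ρ i) ^ (-σ)) := by
    simp only [mul_sub, Finset.sum_sub_distrib]
    rw [h x hx0]
    congr 1
    simp only [Finset.mul_sum]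
    rw [Finset.sum_comm]
    refine Finset.sum_congr rfl fun k _ => ?_
    rw [h _ (hnode k), Finset.mul_sum]
    exact Finset.sum_congr rfl fun i _ => by ring
  rw [e, h x hx0, Finset.mul_sum]
  refine (Finset.abs_sum_le_sum_abs _ _).trans (Finset.sum_le_sum fun i _ => ?_)
  rw [abs_mul, abs_of_nonneg (hc i)]
  refine (mul_le_mul_of_nonneg_left (abs_interpolation_error_rpow_le hr hσ
    (χ := a + lo) (by linarith) hd (add_le_add ht (hρ i).1) hx) (hc i)).trans_eq (by ring)

lemma IsPowerMixture.le_exp_mul {σ lo hi : ℝ} {f : ℝ → ℝ} (hf : IsPowerMixture σ lo hi f)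
    (hσ : 0 ≤ σ) (hlo : 1 ≤ lo) {x y : ℝ} (hx : x ∈ Set.Icc (0 : ℝ) 1)
    (hy : y ∈ Set.Icc (0 : ℝ) 1) : f x ≤ Real.exp σ * f y := by
  refine (hf.le_mul_exp hσ le_rfl (by linarith) hx.1 hy.1).trans ?_
  rw [mul_comm]
  refine mul_le_mul_of_nonneg_right (Real.exp_le_exp.2 ?_) (hf.nonneg (by linarith) hy.1)
  have h1 : |x - y| ≤ 1 := abs_le.2 ⟨by linarith [hx.1, hy.2], by linarith [hx.2, hy.1]⟩
  have h2 : σ / (0 + lo) ≤ σ := by rw [zero_add]; exact div_le_self hσ hlo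
  calc σ / (0 + lo) * |x - y| ≤ σ * 1 := by gcongr
    _ = σ := mul_one σ

lemma transferIter_pos (𝓑 : Digits) (s : ℝ) (n : ℕ) {x : ℝ} (hx : 0 ≤ x) :
    0 < transferIter 𝓑 s n x := by
  induction n generalizing x with
  | zero => simp [transferIter]
  | succ n ih =>
    rw [transferIter_succ, realTransfer]
    refine Finset.sum_pos (fun β _ => ?_) ⟨⟨_, 𝓑.γ_mem⟩, Finset.mem_univ _⟩
    have hβ := digit_one_le β
    have hxβ : 0 < x + (β : ℝ) := by linarith
    rw [abs_deriv_theta_rpow hxβ]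
    exact mul_pos (Real.rpow_pos_of_pos hxβ _) (ih (theta_nonneg hβ hx))

/-! ### Spacing of the extended Chebyshev points -/

lemma sin_two_mul_le_of_mem {φ x : ℝ} (hφ : 0 < φ) (h1 : 2 * φ ≤ x) (h2 : x ≤ Real.pi - 2 * φ) :
    Real.sin (2 * φ) ≤ Real.sin x := by
  rcases le_total x (Real.pi / 2) with h | h
  · exact Real.sin_le_sin_of_le_of_le_pi_div_two (by linarith) h h1
  · rw [← Real.sin_pi_sub x]
    exact Real.sin_le_sin_of_le_of_le_pi_div_two (by linarith) (by linarith) (by linarith)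

/-- The extended Chebyshev points are closest to each other at the ends of `[-1, 1]`. -/
lemma four_mul_sin_sq_le_chat_succ_sub {r k : ℕ} (hr : 1 ≤ r) (hk : k + 1 ≤ r) :
    4 * Real.sin (Real.pi / (2 * r + 2)) ^ 2 ≤ chat r (k + 1) - chat r k := by
  have hc := cos_pos_aux hr
  obtain ⟨φ, hφ⟩ : ∃ φ, φ = Real.pi / (2 * r + 2) := ⟨_, rfl⟩
  have hφ0 : 0 < φ := by have := Real.pi_pos; rw [hφ]; positivity
  have hφr : 2 * (r + 1) * φ = Real.pi := by rw [hφ]; field_simp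
  have e : ∀ j : ℕ, (2 * (j : ℝ) + 1) / (2 * r + 2) * Real.pi = (2 * j + 1) * φ := fun j => by
    rw [hφ]; ring
  rw [chat, chat, e, e, ← sub_div, neg_sub_neg, ← hφ]
  rw [← hφ] at hc
  rw [le_div_iff₀ hc]
  have hkr : (k : ℝ) + 1 ≤ r := by exact_mod_cast hk
  have hkr' := mul_le_mul_of_nonneg_right hkr hφ0.le
  have hk0 : 0 ≤ (k : ℝ) * φ := by positivity
  have hsin := sin_two_mul_le_of_mem hφ0 (x := 2 * ((k : ℝ) + 1) * φ) (by linarith) (by linarith)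
  rw [Real.sin_two_mul] at hsin
  have hsφ : 0 ≤ Real.sin φ := Real.sin_nonneg_of_nonneg_of_le_pi hφ0.le (by linarith)
  rw [Real.cos_sub_cos]
  rw [show ((2 * (k : ℝ) + 1) * φ + (2 * ((k + 1 : ℕ) : ℝ) + 1) * φ) / 2 =
    2 * ((k : ℝ) + 1) * φ by push_cast; ring,
    show ((2 * (k : ℝ) + 1) * φ - (2 * ((k + 1 : ℕ) : ℝ) + 1) * φ) / 2 = -φ by
      push_cast; ring, Real.sin_neg]
  have := mul_le_mul_of_nonneg_right hsin hsφ
  linarith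

lemma four_mul_sin_sq_le_chat_sub {r : ℕ} (hr : 1 ≤ r) {k l : Fin (r + 1)} (hkl : k < l) :
    4 * Real.sin (Real.pi / (2 * r + 2)) ^ 2 ≤ chat r l - chat r k := by
  have hkl' : k.val + 1 ≤ l.val := hkl
  have hk1 : k.val + 1 < r + 1 := hkl'.trans_lt l.2
  have hmono := (chat_strictMono hr).monotone (a := (⟨k.val + 1, hk1⟩ : Fin (r + 1))) (b := l) hkl'
  exact (four_mul_sin_sq_le_chat_succ_sub hr (Nat.lt_succ_iff.1 hk1)).trans
    (sub_le_sub_right hmono _)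

/-- The middle point with index `r / 2` (rounded down) has distance at most `2 η(r)` from all others. -/
lemma abs_chat_sub_mid_le {r : ℕ} (hr : 1 ≤ r) (k : Fin (r + 1)) :
    |chat r k - chat r (r / 2 : ℕ)| ≤ 2 * eta r := by
  have hk := chat_mem_Icc hr k
  have hc := cos_pos_aux hr
  unfold eta
  split_ifs with h
  · obtain ⟨m, hm⟩ := h
    have hm2 : r / 2 = m := by omega
    have : chat r m = 0 := by
      have e : (2 * (m : ℝ) + 1) / (2 * r + 2) * Real.pi = Real.pi / 2 := by
        have : (r : ℝ) = m + m := by exact_mod_cast hm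
        rw [this]
        have : 2 * ((m : ℝ) + m) + 2 ≠ 0 := by positivity
        field_simp
        ring
      rw [chat, e]; simp
    rw [hm2, this, sub_zero, abs_le]
    constructor <;> linarith [hk.1, hk.2]
  · obtain ⟨m, hm⟩ := Nat.not_even_iff_odd.1 h
    have hm2 : r / 2 = m := by omega
    have htan : 0 ≤ Real.tan (Real.pi / (2 * r + 2)) := by
      have hr' : (1 : ℝ) ≤ r := by exact_mod_cast hr
      refine Real.tan_nonneg_of_nonneg_of_le_pi_div_two (by have := Real.pi_pos; positivity) ?_
      exact div_le_div_of_nonneg_left Real.pi_pos.le (by norm_num) (by linarith)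
    have : chat r m = -Real.tan (Real.pi / (2 * r + 2)) := by
      have e : (2 * (m : ℝ) + 1) / (2 * r + 2) * Real.pi =
          Real.pi / 2 - Real.pi / (2 * r + 2) := by
        have : (r : ℝ) = 2 * m + 1 := by exact_mod_cast hm
        rw [this]
        have : 2 * (2 * (m : ℝ) + 1) + 2 ≠ 0 := by positivity
        field_simp
        ring
      rw [chat, e, Real.cos_pi_div_two_sub, Real.tan_eq_sin_div_cos, neg_div]
    rw [hm2, this, abs_le]
    constructor <;> linarith [hk.1, hk.2]

lemma sin_pi_div_pos {r : ℕ} : 0 < Real.sin (Real.pi / (2 * r + 2)) := by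
  have hr : (0 : ℝ) ≤ r := Nat.cast_nonneg r
  refine Real.sin_pos_of_pos_of_lt_pi (by have := Real.pi_pos; positivity) ?_
  rw [div_lt_iff₀ (by positivity)]
  have := mul_nonneg Real.pi_pos.le hr
  linarith [Real.pi_pos]

lemma psi_pos (r : ℕ) : 0 < psi r := by
  unfold psi
  have : 0 ≤ Real.log ((r : ℝ) + 1) := Real.log_nonneg (by linarith [(Nat.cast_nonneg r : (0:ℝ) ≤ r)])
  have := Real.pi_pos
  positivity

lemma eta_pos {r : ℕ} (hr : 1 ≤ r) : 0 < eta r := by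
  unfold eta
  split_ifs
  · norm_num
  · have hr' : (1 : ℝ) ≤ r := by exact_mod_cast hr
    have : 0 ≤ Real.tan (Real.pi / (2 * r + 2)) :=
      Real.tan_nonneg_of_nonneg_of_le_pi_div_two (by have := Real.pi_pos; positivity)
        (div_le_div_of_nonneg_left Real.pi_pos.le (by norm_num) (by linarith))
    linarith

/-- A log-Lipschitz bound on consecutive intervals holds on their union. -/
lemma le_mul_exp_of_pieces {g : ℝ → ℝ} {κ : ℝ} {t : ℕ → ℝ} (ht : Monotone t) (N : ℕ)
    (h : ∀ j < N, ∀ x ∈ Set.Icc (t j) (t (j + 1)), ∀ y ∈ Set.Icc (t j) (t (j + 1)),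
      g x ≤ g y * Real.exp (κ * |x - y|)) (hN : 0 < N) :
    ∀ x ∈ Set.Icc (t 0) (t N), ∀ y ∈ Set.Icc (t 0) (t N),
      g x ≤ g y * Real.exp (κ * |x - y|) := by
  induction N, hN using Nat.le_induction with
  | base => exact h 0 (by norm_num)
  | succ n hn ih =>
    have ih' := ih fun j hj => h j (by omega)
    have hc := h n (by omega)
    have h0n : t 0 ≤ t n := ht (Nat.zero_le n)
    have hnn : t n ≤ t (n + 1) := ht (Nat.le_succ n)
    have trans : ∀ x y, |x - t n| + |t n - y| = |x - y| → g x ≤ g (t n) * Real.exp (κ * |x - t n|) →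
        g (t n) ≤ g y * Real.exp (κ * |t n - y|) → g x ≤ g y * Real.exp (κ * |x - y|) := by
      intro x y hxy h1 h2
      rw [← hxy, mul_add, Real.exp_add, mul_comm (Real.exp _) (Real.exp _), ← mul_assoc]
      exact h1.trans (mul_le_mul_of_nonneg_right h2 (Real.exp_pos _).le)
    intro x hx y hy
    rcases le_total x (t n) with hxn | hxn <;> rcases le_total y (t n) with hyn | hyn
    · exact ih' x ⟨hx.1, hxn⟩ y ⟨hy.1, hyn⟩
    · refine trans x y ?_ (ih' x ⟨hx.1, hxn⟩ _ ⟨h0n, le_rfl⟩) (hc _ ⟨le_rfl, hnn⟩ y ⟨hyn, hy.2⟩)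
      rw [abs_of_nonpos (by linarith), abs_of_nonpos (by linarith), abs_of_nonpos (by linarith)]
      ring
    · refine trans x y ?_ (hc x ⟨hxn, hx.2⟩ _ ⟨le_rfl, hnn⟩) (ih' _ ⟨h0n, le_rfl⟩ y ⟨hy.1, hyn⟩)
      rw [abs_of_nonneg (by linarith), abs_of_nonneg (by linarith), abs_of_nonneg (by linarith)]
      ring
    · exact hc x ⟨hxn, hx.2⟩ y ⟨hyn, hy.2⟩

/-! ### Meshes and the invariant cone -/

namespace Mesh

open Polynomial

variable {𝓑 : Digits} {ν : ℕ} (𝓣 : Mesh 𝓑 ν)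

lemma nonempty_I : Nonempty (Fin 𝓣.I) := by
  obtain ⟨i, -⟩ := 𝓣.mapsTo fun _ => ⟨_, 𝓑.γ_mem⟩
  exact ⟨i⟩

lemma hi_le_h (i : Fin 𝓣.I) : 𝓣.hi i ≤ 𝓣.h := le_ciSup (Set.finite_range _).bddAbove i

lemma h_pos : 0 < 𝓣.h := by
  obtain ⟨i⟩ := 𝓣.nonempty_I
  exact (𝓣.hi_pos i).trans_le (𝓣.hi_le_h i)

lemma iInf_hi_pos : 0 < ⨅ i, 𝓣.hi i := by
  have := 𝓣.nonempty_I
  obtain ⟨i, hi⟩ := exists_eq_ciInf_of_finite (f := 𝓣.hi)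
  rw [← hi]
  exact 𝓣.hi_pos i

lemma one_le_μ : 1 ≤ 𝓣.μ := by
  obtain ⟨i⟩ := 𝓣.nonempty_I
  rw [μ, one_le_div 𝓣.iInf_hi_pos]
  exact (ciInf_le (Set.finite_range _).bddBelow i).trans (𝓣.hi_le_h i)

lemma h_div_μ_le (i : Fin 𝓣.I) : 𝓣.h / 𝓣.μ ≤ 𝓣.hi i := by
  rw [μ, div_div_cancel₀ 𝓣.h_pos.ne']
  exact ciInf_le (Set.finite_range _).bddBelow i

lemma t_zero (i : Fin 𝓣.I) : 𝓣.t i 0 = 𝓣.a i := by simp [t]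

lemma t_N (i : Fin 𝓣.I) : 𝓣.t i (𝓣.N i) = 𝓣.b i := by
  have : ((𝓣.N i : ℕ) : ℝ) ≠ 0 := by exact_mod_cast (𝓣.N_pos i).ne'
  simp only [t, hi]
  field_simp
  ring

lemma t_succ (i : Fin 𝓣.I) (j : ℕ) : 𝓣.t i (j + 1) = 𝓣.t i j + 𝓣.hi i := by
  simp only [t]; push_cast; ring

lemma exists_cell {i : Fin 𝓣.I} {x : ℝ} (hx : x ∈ Set.Icc (𝓣.a i) (𝓣.b i)) :
    ∃ j, x ∈ 𝓣.cell ⟨i, j⟩ := by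
  have hex : ∃ n, x ≤ 𝓣.t i (n + 1) := ⟨𝓣.N i - 1, by
    rw [Nat.sub_add_cancel (𝓣.N_pos i), t_N]; exact hx.2⟩
  classical
  have hle : Nat.find hex ≤ 𝓣.N i - 1 := Nat.find_min' hex (by
    rw [Nat.sub_add_cancel (𝓣.N_pos i), t_N]; exact hx.2)
  have hN := 𝓣.N_pos i
  refine ⟨⟨Nat.find hex, by omega⟩, ?_, Nat.find_spec hex⟩
  rcases Nat.eq_zero_or_pos (Nat.find hex) with h0 | h0
  · simp only [h0, t_zero]; exact hx.1
  · have := Nat.find_min hex (Nat.sub_lt h0 Nat.one_pos)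
    rw [show Nat.find hex - 1 + 1 = Nat.find hex from Nat.sub_add_cancel h0] at this
    exact (not_le.1 this).le

lemma node_mem_cell {r : ℕ} (hr : 1 ≤ r) (p : 𝓣.Cell) (k : Fin (r + 1)) :
    𝓣.node r p k ∈ 𝓣.cell p := by
  have h := chat_mem_Icc hr k
  have hd := 𝓣.hi_pos p.1
  have h1 := mul_nonneg hd.le (by linarith [h.1] : 0 ≤ 1 + chat r k)
  have h2 := mul_nonneg hd.le (by linarith [h.2] : 0 ≤ 1 - chat r k)
  refine ⟨by simp only [node]; linarith, ?_⟩
  rw [t_succ]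
  simp only [node]; linarith

lemma cell_subset_S (p : 𝓣.Cell) : 𝓣.cell p ⊆ 𝓑.S := (𝓣.cell_subset p).trans (𝓣.subset _)

lemma exists_node_eq {r : ℕ} (ξ : 𝓣.T r) : ∃ p k, 𝓣.node r p k = ξ := by
  obtain ⟨⟨p, k⟩, -, h⟩ := Finset.mem_image.1 ξ.2
  exact ⟨p, k, h⟩

lemma T_mem_S {r : ℕ} (hr : 1 ≤ r) (ξ : 𝓣.T r) : (ξ : ℝ) ∈ 𝓑.S := by
  obtain ⟨p, k, h⟩ := 𝓣.exists_node_eq ξ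
  rw [← h]
  exact 𝓣.cell_subset_S p (𝓣.node_mem_cell hr p k)

/-- A lower bound for the distance of two points of `T` in the same interval `[a_i, b_i]`; see
`gap_le_sub`. -/
def gap (r : ℕ) : ℝ := 2 * Real.sin (Real.pi / (2 * r + 2)) ^ 2 * (𝓣.h / 𝓣.μ)

lemma gap_le_node_sub {r : ℕ} (hr : 1 ≤ r) (p : 𝓣.Cell) {k l : Fin (r + 1)} (hkl : k < l) :
    𝓣.gap r ≤ 𝓣.node r p l - 𝓣.node r p k := by
  have h1 := four_mul_sin_sq_le_chat_sub hr hkl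
  have h2 := 𝓣.h_div_μ_le p.1
  have hd := 𝓣.hi_pos p.1
  calc 𝓣.gap r ≤ 2 * Real.sin (Real.pi / (2 * r + 2)) ^ 2 * 𝓣.hi p.1 := by
        unfold gap; gcongr
    _ = 𝓣.hi p.1 * (4 * Real.sin (Real.pi / (2 * r + 2)) ^ 2) / 2 := by ring
    _ ≤ 𝓣.hi p.1 * (chat r l - chat r k) / 2 := by gcongr
    _ = _ := by simp only [node]; ring

lemma gap_le_node_sub_left {r : ℕ} (hr : 1 ≤ r) (p : 𝓣.Cell) (l : Fin (r + 1))
    (h : 𝓣.t p.1 p.2 < 𝓣.node r p l) : 𝓣.gap r ≤ 𝓣.node r p l - 𝓣.t p.1 p.2 := by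
  rw [← 𝓣.node_zero hr] at h ⊢
  refine 𝓣.gap_le_node_sub hr p (Fin.pos_iff_ne_zero.2 ?_)
  rintro rfl
  exact lt_irrefl _ h

lemma gap_le_sub_node_right {r : ℕ} (hr : 1 ≤ r) (p : 𝓣.Cell) (k : Fin (r + 1))
    (h : 𝓣.node r p k < 𝓣.t p.1 (p.2 + 1)) : 𝓣.gap r ≤ 𝓣.t p.1 (p.2 + 1) - 𝓣.node r p k := by
  rw [← 𝓣.node_last hr] at h ⊢
  refine 𝓣.gap_le_node_sub hr p (lt_of_le_of_ne (Fin.le_last k) ?_)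
  rintro rfl
  exact lt_irrefl _ h

lemma gap_le_hi {r : ℕ} (hr : 1 ≤ r) (p : 𝓣.Cell) : 𝓣.gap r ≤ 𝓣.hi p.1 := by
  have := 𝓣.gap_le_node_sub hr p (k := 0) (l := Fin.last r) (by
    rw [Fin.lt_def]; simp; omega)
  rw [node_zero 𝓣 hr, node_last 𝓣 hr, t_succ] at this
  linarith

lemma gap_le_sub {r : ℕ} (hr : 1 ≤ r) {i : Fin 𝓣.I} {ξ η : 𝓣.T r}
    (hξ : (ξ : ℝ) ∈ Set.Icc (𝓣.a i) (𝓣.b i)) (hη : (η : ℝ) ∈ Set.Icc (𝓣.a i) (𝓣.b i))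
    (hlt : (ξ : ℝ) < η) : 𝓣.gap r ≤ η - ξ := by
  obtain ⟨⟨i₁, j⟩, k, hk⟩ := 𝓣.exists_node_eq ξ
  obtain ⟨⟨i₂, j'⟩, l, hl⟩ := 𝓣.exists_node_eq η
  have mk := 𝓣.node_mem_cell hr ⟨i₁, j⟩ k
  have ml := 𝓣.node_mem_cell hr ⟨i₂, j'⟩ l
  rw [hk] at mk
  rw [hl] at ml
  have e1 : i₁ = i := by
    by_contra hne
    exact Set.disjoint_left.1 (𝓣.disjoint _ _ hne) (𝓣.cell_subset _ mk) hξ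
  have e2 : i₂ = i := by
    by_contra hne
    exact Set.disjoint_left.1 (𝓣.disjoint _ _ hne) (𝓣.cell_subset _ ml) hη
  subst e1
  subst e2
  rcases lt_trichotomy j j' with h | rfl | h
  · have hjj : 𝓣.t i₂ (j + 1) ≤ 𝓣.t i₂ j' := 𝓣.t_mono i₂ h
    rcases mk.2.lt_or_eq with h1 | h1
    · have := 𝓣.gap_le_sub_node_right hr ⟨i₂, j⟩ k (by rwa [hk])
      rw [hk] at this
      have := ml.1
      simp only at *
      linarith
    rcases ml.1.lt_or_eq with h2 | h2
    · have := 𝓣.gap_le_node_sub_left hr ⟨i₂, j'⟩ l (by rwa [hl])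
      rw [hl] at this
      simp only at *
      linarith
    · have h3 : ((j : ℕ) + 1 : ℕ) < (j' : ℕ) := by
        by_contra hcon
        have h5 : ((j : ℕ) + 1 : ℕ) = (j' : ℕ) := by
          have : (j : ℕ) < j' := h
          omega
        simp only at h1 h2
        rw [h5] at h1
        linarith
      have h4 : 𝓣.t i₂ (j + 1 + 1) ≤ 𝓣.t i₂ j' := 𝓣.t_mono i₂ h3
      rw [t_succ] at h4
      have := 𝓣.gap_le_hi hr ⟨i₂, j⟩
      simp only at *
      linarith
  · have hkl : k < l := by
      by_contra hcon
      have : 𝓣.node r ⟨i₂, j⟩ l ≤ 𝓣.node r ⟨i₂, j⟩ k := by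
        have h1 := (chat_strictMono hr).monotone (not_lt.1 hcon)
        have h2 := mul_le_mul_of_nonneg_left h1 (𝓣.hi_pos i₂).le
        simp only [node] at h2 ⊢
        linarith
      rw [hk, hl] at this
      linarith
    have := 𝓣.gap_le_node_sub hr ⟨i₂, j⟩ hkl
    rwa [hk, hl] at this
  · have hjj : 𝓣.t i₂ (j' + 1) ≤ 𝓣.t i₂ j := 𝓣.t_mono i₂ h
    have h1 := mk.1
    have h2 := ml.2
    simp only at *
    linarith

/-- The interpolation polynomial on a subinterval, in the coordinate that runs over `[-1, 1]`. -/
def refInterp (r : ℕ) (F : 𝓣.T r → ℝ) (p : 𝓣.Cell) : ℝ[X] :=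
  Lagrange.interpolate Finset.univ (fun k : Fin (r + 1) => chat r k)
    fun k => F ⟨𝓣.node r p k, 𝓣.node_mem r p k⟩

lemma refInterp_eval (r : ℕ) (F : 𝓣.T r → ℝ) (p : 𝓣.Cell) (y : ℝ) :
    (𝓣.refInterp r F p).eval y =
      ∑ k : Fin (r + 1), (Lagrange.basis Finset.univ (fun k : Fin (r + 1) => chat r k) k).eval y *
        F ⟨𝓣.node r p k, 𝓣.node_mem r p k⟩ := by
  rw [refInterp, Lagrange.interpolate_apply, eval_finsetSum]
  exact Finset.sum_congr rfl fun k _ => by rw [eval_mul, eval_C, mul_comm]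

lemma localInterp_eq_refInterp (r : ℕ) (F : 𝓣.T r → ℝ) (p : 𝓣.Cell) (y : ℝ) :
    𝓣.localInterp r F p (𝓣.t p.1 p.2 + 𝓣.hi p.1 * (1 + y) / 2) = (𝓣.refInterp r F p).eval y := by
  rw [refInterp_eval, localInterp]
  refine Finset.sum_congr rfl fun k _ => ?_
  congr 1
  have hd := (𝓣.hi_pos p.1).ne'
  have e : 𝓣.node r p = fun k : Fin (r + 1) =>
      (𝓣.t p.1 p.2 + 𝓣.hi p.1 / 2) + 𝓣.hi p.1 / 2 * chat r k := by
    funext k; simp only [node]; ring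
  rw [e, show 𝓣.t p.1 p.2 + 𝓣.hi p.1 * (1 + y) / 2 =
    (𝓣.t p.1 p.2 + 𝓣.hi p.1 / 2) + 𝓣.hi p.1 / 2 * y by ring,
    eval_basis_affine (fun k : Fin (r + 1) => chat r k) (by simpa using hd)]

lemma exists_ref {p : 𝓣.Cell} {x : ℝ} (hx : x ∈ 𝓣.cell p) :
    ∃ y, |y| ≤ 1 ∧ x = 𝓣.t p.1 p.2 + 𝓣.hi p.1 * (1 + y) / 2 := by
  have hd := 𝓣.hi_pos p.1
  obtain ⟨h1, h2⟩ := hx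
  rw [t_succ] at h2
  refine ⟨2 * ((x - 𝓣.t p.1 p.2) / 𝓣.hi p.1) - 1, ?_, by field_simp; ring⟩
  have h3 : 0 ≤ (x - 𝓣.t p.1 p.2) / 𝓣.hi p.1 := div_nonneg (by linarith) hd.le
  have h4 : (x - 𝓣.t p.1 p.2) / 𝓣.hi p.1 ≤ 1 := by rw [div_le_one hd]; linarith
  rw [abs_le]
  constructor <;> linarith

lemma natDegree_refInterp_le {r : ℕ} (hr : 1 ≤ r) (F : 𝓣.T r → ℝ) (p : 𝓣.Cell) :
    (𝓣.refInterp r F p).natDegree ≤ r := by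
  have := Lagrange.degree_interpolate_le (s := Finset.univ)
    (fun k : Fin (r + 1) => F ⟨𝓣.node r p k, 𝓣.node_mem r p k⟩)
    ((chat_strictMono hr).injective.injOn)
  refine natDegree_le_of_degree_le ?_
  simpa [refInterp] using this

/-- The interpolant deviates from a constant `m` by at most `ψ(r)` times the deviation of the data. -/
lemma abs_refInterp_sub_le {r : ℕ} (hr : 2 ≤ r) (F : 𝓣.T r → ℝ) (p : 𝓣.Cell) {m K : ℝ}
    (hF : ∀ k, |F ⟨𝓣.node r p k, 𝓣.node_mem r p k⟩ - m| ≤ K) {y : ℝ} (hy : |y| ≤ 1) :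
    |(𝓣.refInterp r F p).eval y - m| ≤ psi r * K := by
  have hK : 0 ≤ K := (abs_nonneg _).trans (hF 0)
  have h1 := congrArg (eval y) (Lagrange.sum_basis (s := Finset.univ)
    (v := fun k : Fin (r + 1) => chat r k)
    ((chat_strictMono (by omega : 1 ≤ r)).injective.injOn) Finset.univ_nonempty)
  rw [eval_finsetSum, eval_one] at h1
  have e : (𝓣.refInterp r F p).eval y - m = ∑ k : Fin (r + 1),
      (Lagrange.basis Finset.univ (fun k : Fin (r + 1) => chat r k) k).eval y *
        (F ⟨𝓣.node r p k, 𝓣.node_mem r p k⟩ - m) := by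
    simp only [mul_sub, Finset.sum_sub_distrib]
    rw [← Finset.sum_mul, h1, one_mul, refInterp_eval]
  rw [e]
  refine (Finset.abs_sum_le_sum_abs _ _).trans ?_
  refine le_trans (Finset.sum_le_sum fun k _ => ?_)
    ((Finset.sum_mul _ _ _).symm.le.trans
      (mul_le_mul_of_nonneg_right (sum_abs_basis_chat_le hr hy) hK))
  rw [abs_mul]
  exact mul_le_mul_of_nonneg_left (hF k) (abs_nonneg _)

/-- The cone `K(M)` of the nonnegative functions on `T` with `F ξ ≤ F η * exp (M |ξ - η|)`. Only
points of the same interval `[a_i, b_i]` are compared: points of distinct intervals can be arbitrarily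
close to each other. -/
def cone (r : ℕ) (M : ℝ) : Set (𝓣.T r → ℝ) :=
  {F | (∀ ξ, 0 ≤ F ξ) ∧ ∀ i, ∀ ξ η : 𝓣.T r, (ξ : ℝ) ∈ Set.Icc (𝓣.a i) (𝓣.b i) →
    (η : ℝ) ∈ Set.Icc (𝓣.a i) (𝓣.b i) → F ξ ≤ F η * Real.exp (M * |(ξ : ℝ) - η|)}

variable {𝓣}

lemma cone_add {r : ℕ} {M : ℝ} {F G : 𝓣.T r → ℝ} (hF : F ∈ 𝓣.cone r M) (hG : G ∈ 𝓣.cone r M) :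
    F + G ∈ 𝓣.cone r M := by
  refine ⟨fun ξ => add_nonneg (hF.1 ξ) (hG.1 ξ), fun i ξ η hξ hη => ?_⟩
  simp only [Pi.add_apply, add_mul]
  exact add_le_add (hF.2 i ξ η hξ hη) (hG.2 i ξ η hξ hη)

lemma cone_smul {r : ℕ} {M c : ℝ} {F : 𝓣.T r → ℝ} (hc : 0 ≤ c) (hF : F ∈ 𝓣.cone r M) :
    c • F ∈ 𝓣.cone r M := by
  refine ⟨fun ξ => mul_nonneg hc (hF.1 ξ), fun i ξ η hξ hη => ?_⟩
  simp only [Pi.smul_apply, smul_eq_mul, mul_assoc]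
  exact mul_le_mul_of_nonneg_left (hF.2 i ξ η hξ hη) hc

lemma cone_mono {r : ℕ} {M M' : ℝ} (h : M ≤ M') : 𝓣.cone r M ⊆ 𝓣.cone r M' := by
  intro F hF
  refine ⟨hF.1, fun i ξ η hξ hη => (hF.2 i ξ η hξ hη).trans ?_⟩
  have := hF.1 η
  gcongr

variable (𝓣)

/-- On one subinterval the interpolant of `F ∈ K(M)` is nonnegative and log-Lipschitz. With `m` the
value of `F` at the middle node, `F` differs from `m` by at most `u e ^ u m` at the nodes, so the
interpolant `P` is at least `(1 - ψ u e ^ u) m`; its derivative is bounded by Markov's inequality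
applied to `P - m`. -/
lemma refInterp_of_mem_cone {r : ℕ} (hr : 2 ≤ r) {M u : ℝ} (hM : 0 ≤ M)
    (hu : u = M * eta r * 𝓣.h) (hψ : psi r * u * Real.exp u < 1) {F : 𝓣.T r → ℝ}
    (hF : F ∈ 𝓣.cone r M) (p : 𝓣.Cell) {x y : ℝ} (hx : x ∈ 𝓣.cell p) (hy : y ∈ 𝓣.cell p) :
    0 ≤ 𝓣.localInterp r F p x ∧ 𝓣.localInterp r F p x ≤ 𝓣.localInterp r F p y *
      Real.exp (2 * eta r * r ^ 2 * psi r * M * Real.exp u / (1 - psi r * u * Real.exp u) *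
        |x - y|) := by
  have hr1 : 1 ≤ r := by omega
  have hη := eta_pos hr1
  have hψ0 := psi_pos r
  have hd := 𝓣.hi_pos p.1
  have hdh := 𝓣.hi_le_h p.1
  set d := 𝓣.hi p.1 with hdd
  set w := M * eta r * d with hw
  have hw0 : 0 ≤ w := by positivity
  have hwu : w ≤ u := by rw [hw, hu]; gcongr
  have hu0 : 0 ≤ u := hw0.trans hwu
  have hmid : r / 2 < r + 1 := by omega
  set k₀ : Fin (r + 1) := ⟨r / 2, hmid⟩
  set m := F ⟨𝓣.node r p k₀, 𝓣.node_mem r p k₀⟩ with hm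
  have hm0 : 0 ≤ m := hF.1 _
  have hint : ∀ k, 𝓣.node r p k ∈ Set.Icc (𝓣.a p.1) (𝓣.b p.1) := fun k =>
    𝓣.cell_subset p (𝓣.node_mem_cell hr1 p k)
  have hdist : ∀ k, M * |𝓣.node r p k - 𝓣.node r p k₀| ≤ w := fun k => by
    have h1 := abs_chat_sub_mid_le hr1 k
    have e : 𝓣.node r p k - 𝓣.node r p k₀ = d / 2 * (chat r k - chat r (r / 2 : ℕ)) := by
      simp only [node, k₀]; ring
    rw [e, abs_mul, abs_of_pos (show 0 < d / 2 by positivity), hw]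
    calc M * (d / 2 * |chat r k - chat r (r / 2 : ℕ)|) ≤ M * (d / 2 * (2 * eta r)) := by gcongr
      _ = _ := by ring
  have hexp : Real.exp w - 1 ≤ w * Real.exp w := by
    have := Real.add_one_le_exp (-w)
    have h2 := mul_le_mul_of_nonneg_right this (Real.exp_pos w).le
    rw [← Real.exp_add, neg_add_cancel, Real.exp_zero] at h2
    linarith
  have hdev : ∀ k, |F ⟨𝓣.node r p k, 𝓣.node_mem r p k⟩ - m| ≤ w * Real.exp u * m := fun k => by
    have h1 := hF.2 p.1 ⟨𝓣.node r p k, 𝓣.node_mem r p k⟩ ⟨𝓣.node r p k₀, 𝓣.node_mem r p k₀⟩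
      (hint k) (hint k₀)
    have h2 := hF.2 p.1 ⟨𝓣.node r p k₀, 𝓣.node_mem r p k₀⟩ ⟨𝓣.node r p k, 𝓣.node_mem r p k⟩
      (hint k₀) (hint k)
    rw [← hm] at h1 h2
    simp only at h1 h2
    rw [abs_sub_comm] at h2
    set A := F ⟨𝓣.node r p k, 𝓣.node_mem r p k⟩ with hA
    have hA0 : 0 ≤ A := hF.1 _
    have e1 : Real.exp (M * |𝓣.node r p k - 𝓣.node r p k₀|) ≤ Real.exp w :=
      Real.exp_le_exp.2 (hdist k)
    have h1' : A ≤ m * Real.exp w := h1.trans (by gcongr)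
    have h2' : m ≤ A * Real.exp w := h2.trans (by gcongr)
    have hwu' : w * Real.exp w * m ≤ w * Real.exp u * m := by gcongr
    have hone : 1 ≤ Real.exp w := Real.one_le_exp hw0
    rw [abs_le]
    constructor
    · have h3 : m * Real.exp (-w) ≤ A := by
        rw [Real.exp_neg, ← div_eq_mul_inv, div_le_iff₀ (Real.exp_pos _)]; exact h2'
      have h4 : m * (1 - w) ≤ m * Real.exp (-w) := by
        gcongr
        have := Real.add_one_le_exp (-w)
        linarith
      have h5 : w * m * 1 ≤ w * m * Real.exp w := by gcongr
      linarith
    · have := mul_le_mul_of_nonneg_left hexp hm0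
      linarith
  have hbd := fun (z : ℝ) (hz : |z| ≤ 1) => 𝓣.abs_refInterp_sub_le hr F p hdev hz
  set P := 𝓣.refInterp r F p with hP
  set K := psi r * (w * Real.exp u * m) with hK
  have hmarkov : ∀ z, |z| ≤ 1 → |(derivative P).eval z| ≤ r ^ 2 * K := fun z hz => by
    have h1 := markov_inequality (n := r) (K := K) (P - C m) (by
      rw [natDegree_sub_C]; exact 𝓣.natDegree_refInterp_le hr1 F p) (fun z hz => by
      rw [eval_sub, eval_C]; exact hbd z hz) hz
    simpa using h1
  obtain ⟨yx, hyx, ex⟩ := 𝓣.exists_ref hx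
  obtain ⟨yy, hyy, ey⟩ := 𝓣.exists_ref hy
  have hlip : |P.eval yx - P.eval yy| ≤ r ^ 2 * K * |yx - yy| := by
    have := (convex_Icc (-1 : ℝ) 1).norm_image_sub_le_of_norm_hasDerivWithin_le
      (f := fun z => P.eval z) (f' := fun z => (derivative P).eval z) (C := r ^ 2 * K)
      (fun z _ => (P.hasDerivAt z).hasDerivWithinAt)
      (fun z hz => hmarkov z (abs_le.2 hz)) (abs_le.1 hyy) (abs_le.1 hyx)
    simpa [Real.norm_eq_abs] using this
  have hux : 𝓣.localInterp r F p x = P.eval yx := by rw [ex, localInterp_eq_refInterp]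
  have huy : 𝓣.localInterp r F p y = P.eval yy := by rw [ey, localInterp_eq_refInterp]
  have hden : 0 < 1 - psi r * u * Real.exp u := by linarith
  have hlow : ∀ z, |z| ≤ 1 → (1 - psi r * u * Real.exp u) * m ≤ P.eval z := fun z hz => by
    have h1 := (abs_le.1 (hbd z hz)).1
    have h2 : K ≤ psi r * (u * Real.exp u * m) := by rw [hK]; gcongr
    linarith
  rw [hux, huy]
  refine ⟨(mul_nonneg hden.le hm0).trans (hlow yx hyx), ?_⟩
  set κ := 2 * eta r * r ^ 2 * psi r * M * Real.exp u / (1 - psi r * u * Real.exp u) with hκ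
  have hκ0 : 0 ≤ κ := by positivity
  have hstep : r ^ 2 * K * |yx - yy| = κ * ((1 - psi r * u * Real.exp u) * m) * |x - y| := by
    have e : x - y = d / 2 * (yx - yy) := by rw [ex, ey]; ring
    rw [e, abs_mul, abs_of_pos (show 0 < d / 2 by positivity), hκ, hK, hw]
    have hne := hden.ne'
    generalize 1 - psi r * u * Real.exp u = D at hne ⊢
    field_simp
  have h1 : P.eval yx ≤ P.eval yy + κ * |x - y| * P.eval yy := by
    have h2 := (abs_le.1 hlip).2
    rw [hstep] at h2
    have h3 : κ * ((1 - psi r * u * Real.exp u) * m) * |x - y| ≤ κ * P.eval yy * |x - y| := by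
      have := hlow yy hyy
      gcongr
    linarith
  have h4 := Real.add_one_le_exp (κ * |x - y|)
  have h5 := mul_le_mul_of_nonneg_left h4 ((mul_nonneg hden.le hm0).trans (hlow yy hyy))
  linarith

lemma interp_of_mem_cone {r : ℕ} (hr : 2 ≤ r) {M u : ℝ} (hM : 0 ≤ M)
    (hu : u = M * eta r * 𝓣.h) (hψ : psi r * u * Real.exp u < 1) {F : 𝓣.T r → ℝ}
    (hF : F ∈ 𝓣.cone r M) {i : Fin 𝓣.I} {x y : ℝ} (hx : x ∈ Set.Icc (𝓣.a i) (𝓣.b i))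
    (hy : y ∈ Set.Icc (𝓣.a i) (𝓣.b i)) :
    0 ≤ 𝓣.interp r F x ∧ 𝓣.interp r F x ≤ 𝓣.interp r F y *
      Real.exp (2 * eta r * r ^ 2 * psi r * M * Real.exp u / (1 - psi r * u * Real.exp u) *
        |x - y|) := by
  have hr1 : 1 ≤ r := by omega
  constructor
  · obtain ⟨j, hj⟩ := 𝓣.exists_cell hx
    rw [𝓣.interp_eq hr1 F _ hj]
    exact (𝓣.refInterp_of_mem_cone hr hM hu hψ hF _ hj hj).1
  · rw [← 𝓣.t_zero, ← 𝓣.t_N] at hx hy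
    refine le_mul_exp_of_pieces (𝓣.t_mono i) (𝓣.N i) (fun j hj z hz z' hz' => ?_) (𝓣.N_pos i)
      x hx y hy
    rw [𝓣.interp_eq hr1 F ⟨i, ⟨j, hj⟩⟩ hz, 𝓣.interp_eq hr1 F ⟨i, ⟨j, hj⟩⟩ hz']
    exact (𝓣.refInterp_of_mem_cone hr hM hu hψ hF ⟨i, ⟨j, hj⟩⟩ hz hz').2

/-- The discrete operator maps `K(M)` into a cone with, under the hypotheses of the theorem, a smaller
parameter. -/
theorem discreteOp_mem_cone {r : ℕ} (hr : 2 ≤ r) (hν : 1 ≤ ν) {s M M₀ u : ℝ} (hs : 0 ≤ s)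
    (hM₀ : ∀ ω : 𝓑.Word ν, ∀ x ∈ 𝓑.S, ∀ y ∈ 𝓑.S,
      gWord ω x ≤ gWord ω y * Real.exp (M₀ * |x - y|))
    (hM : 0 ≤ M) (hu : u = M * eta r * 𝓣.h) (hψ : psi r * u * Real.exp u < 1)
    {F : 𝓣.T r → ℝ} (hF : F ∈ 𝓣.cone r M) :
    𝓣.discreteOp s r F ∈ 𝓣.cone r
      (s * M₀ + kappa₁ 𝓑 r ν * Real.exp u / (1 - psi r * u * Real.exp u) * M) := by
  have hr1 : 1 ≤ r := by omega
  have hη := eta_pos hr1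
  have hψ0 := psi_pos r
  have hden : 0 < 1 - psi r * u * Real.exp u := by linarith
  refine ⟨fun ξ => ?_, fun i ξ η hξ hη' => ?_⟩
  · refine Finset.sum_nonneg fun ω _ => mul_nonneg (Real.rpow_nonneg (gWord_nonneg _ _) _) ?_
    obtain ⟨i, hi⟩ := 𝓣.mapsTo ω
    have := hi (𝓣.T_mem_S hr1 ξ)
    exact (𝓣.interp_of_mem_cone hr hM hu hψ hF this this).1
  · change (∑ ω : 𝓑.Word ν, gWord ω ξ ^ s * 𝓣.interp r F (thetaWord ω ξ)) ≤
      (∑ ω : 𝓑.Word ν, gWord ω η ^ s * 𝓣.interp r F (thetaWord ω η)) * _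
    rw [Finset.sum_mul]
    refine Finset.sum_le_sum fun ω _ => ?_
    obtain ⟨i, hi⟩ := 𝓣.mapsTo ω
    have hξS := 𝓣.T_mem_S hr1 ξ
    have hηS := 𝓣.T_mem_S hr1 η
    obtain ⟨h0, h1⟩ := 𝓣.interp_of_mem_cone hr hM hu hψ hF (hi hξS) (hi hηS)
    have h0' := (𝓣.interp_of_mem_cone hr hM hu hψ hF (hi hηS) (hi hηS)).1
    set κ := 2 * eta r * r ^ 2 * psi r * M * Real.exp u / (1 - psi r * u * Real.exp u) with hκ
    have hκ0 : 0 ≤ κ := by positivity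
    have hlip := abs_thetaWord_sub_le hν ω hξS.1 hηS.1
    have hg : gWord ω ξ ^ s ≤ gWord ω η ^ s * Real.exp (s * M₀ * |(ξ : ℝ) - η|) := by
      have := Real.rpow_le_rpow (gWord_nonneg _ _) (hM₀ ω ξ hξS η hηS) hs
      rwa [Real.mul_rpow (gWord_nonneg _ _) (Real.exp_pos _).le, ← Real.exp_mul,
        show M₀ * |(ξ : ℝ) - η| * s = s * M₀ * |(ξ : ℝ) - η| by ring] at this
    have h2 : 𝓣.interp r F (thetaWord ω ξ) ≤ 𝓣.interp r F (thetaWord ω η) *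
        Real.exp (κ * (𝓑.c ν * |(ξ : ℝ) - η|)) := h1.trans (by gcongr)
    refine (mul_le_mul hg h2 h0 (mul_nonneg (Real.rpow_nonneg (gWord_nonneg _ _) _)
      (Real.exp_pos _).le)).trans_eq ?_
    have e : (s * M₀ + kappa₁ 𝓑 r ν * Real.exp u / (1 - psi r * u * Real.exp u) * M) *
        |(ξ : ℝ) - η| = s * M₀ * |(ξ : ℝ) - η| + κ * (𝓑.c ν * |(ξ : ℝ) - η|) := by
      rw [hκ, kappa₁]; field_simp
    rw [e, Real.exp_add]
    ring

end Mesh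

/-! ### Spectral radii and the growth of powers -/

open Filter Topology in
/-- Gelfand's formula along an arithmetic progression. -/
lemma tendsto_norm_pow_rpow_spectralRadius {A : Type*} [NormedRing A] [NormedAlgebra ℂ A]
    [CompleteSpace A] [NormOneClass A] (a : A) (m : ℕ) {p : ℕ} (hp : 1 ≤ p) :
    Tendsto (fun k : ℕ => ‖a ^ (m + k * p)‖ ^ (1 / (k : ℝ))) atTop
      (𝓝 ((spectralRadius ℂ a).toReal ^ p)) := by
  have hfin : spectralRadius ℂ a ≠ ⊤ :=
    ((spectrum.spectralRadius_le_nnnorm a).trans_lt ENNReal.coe_lt_top).ne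
  have h1 : Tendsto (fun n : ℕ => ‖a ^ n‖ ^ (1 / (n : ℝ))) atTop
      (𝓝 (spectralRadius ℂ a).toReal) := by
    have := (ENNReal.tendsto_toReal hfin).comp
      (spectrum.pow_norm_pow_one_div_tendsto_nhds_spectralRadius a)
    refine this.congr fun n => ?_
    exact ENNReal.toReal_ofReal (Real.rpow_nonneg (norm_nonneg _) _)
  have hsub : Tendsto (fun k : ℕ => m + k * p) atTop atTop := by
    refine tendsto_atTop_mono (fun k => ?_) tendsto_id
    exact (Nat.le_mul_of_pos_right k hp).trans (Nat.le_add_left _ _)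
  have hexp : Tendsto (fun k : ℕ => ((m + k * p : ℕ) : ℝ) / k) atTop (𝓝 (p : ℝ)) := by
    have h2 : Tendsto (fun k : ℕ => (m : ℝ) / k + p) atTop (𝓝 (0 + p)) :=
      (tendsto_const_div_atTop_nhds_zero_nat (m : ℝ)).add_const _
    rw [zero_add] at h2
    refine h2.congr' ?_
    filter_upwards [eventually_gt_atTop 0] with k hk
    have : (k : ℝ) ≠ 0 := by exact_mod_cast hk.ne'
    push_cast
    field_simp
  have h3 := (h1.comp hsub).rpow hexp (Or.inr (by exact_mod_cast hp))
  rw [Real.rpow_natCast] at h3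
  refine h3.congr' ?_
  filter_upwards [eventually_gt_atTop 0] with k hk
  have hk' : (k : ℝ) ≠ 0 := by exact_mod_cast hk.ne'
  have hN : ((m + k * p : ℕ) : ℝ) ≠ 0 := by
    have : 0 < m + k * p := Nat.add_pos_right _ (Nat.mul_pos hk hp)
    exact_mod_cast this.ne'
  simp only [Function.comp_apply]
  rw [← Real.rpow_mul (norm_nonneg _)]
  congr 1
  field_simp

open Filter Topology in
lemma spectralRadius_pow_le_of_norm_pow_le {A B : Type*} [NormedRing A] [NormedAlgebra ℂ A]
    [CompleteSpace A] [NormOneClass A] [NormedRing B] [NormedAlgebra ℂ B]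
    [CompleteSpace B] [NormOneClass B] {a : A} {b : B} {m n p p' : ℕ} {C q : ℝ}
    (hp : 1 ≤ p) (hp' : 1 ≤ p') (hC : 0 < C) (hq : 0 ≤ q)
    (h : ∀ k : ℕ, ‖a ^ (m + k * p)‖ ≤ C * q ^ k * ‖b ^ (n + k * p')‖) :
    (spectralRadius ℂ a).toReal ^ p ≤ q * (spectralRadius ℂ b).toReal ^ p' := by
  have h1 := tendsto_norm_pow_rpow_spectralRadius a m hp
  have h2 := tendsto_norm_pow_rpow_spectralRadius b n hp'
  have h3 : Tendsto (fun k : ℕ => C ^ (1 / (k : ℝ))) atTop (𝓝 1) := by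
    have := (tendsto_const_nhds (x := C)).rpow (tendsto_const_div_atTop_nhds_zero_nat (1 : ℝ))
      (Or.inl hC.ne')
    rwa [Real.rpow_zero] at this
  have h4 := (h3.mul (tendsto_const_nhds (x := q))).mul h2
  rw [one_mul] at h4
  refine le_of_tendsto_of_tendsto h1 h4 ?_
  filter_upwards [eventually_gt_atTop 0] with k hk
  have := Real.rpow_le_rpow (norm_nonneg _) (h k) (by positivity : 0 ≤ 1 / (k : ℝ))
  rw [Real.mul_rpow (by positivity) (norm_nonneg _), Real.mul_rpow hC.le (by positivity)] at this
  rwa [one_div, Real.pow_rpow_inv_natCast hq hk.ne', ← one_div] at this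

section Transfer

variable (𝓑 : Digits) (s : ℝ)

lemma transferOp_pow_one (n : ℕ) (x : Set.Icc (0 : ℝ) 1) :
    (transferOp 𝓑 s ^ n) 1 x = (transferIter 𝓑 s n x : ℂ) := by
  induction n generalizing x with
  | zero => simp [transferIter]
  | succ n ih =>
    rw [pow_succ', mul_apply_eq_comp, transferOp_apply, transferIter_succ,
      realTransfer]
    rw [Complex.ofReal_sum]
    exact Finset.sum_congr rfl fun β _ => by rw [ih, Complex.ofReal_mul]; rfl

lemma norm_transferOp_pow_apply_le (n : ℕ) (f : C(Set.Icc (0 : ℝ) 1, ℂ)) (x : Set.Icc (0 : ℝ) 1) :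
    ‖(transferOp 𝓑 s ^ n) f x‖ ≤ ‖f‖ * transferIter 𝓑 s n x := by
  induction n generalizing x with
  | zero => simpa [transferIter] using f.norm_coe_le_norm x
  | succ n ih =>
    rw [pow_succ', mul_apply_eq_comp, transferOp_apply, transferIter_succ,
      realTransfer, Finset.mul_sum]
    refine (norm_sum_le _ _).trans (Finset.sum_le_sum fun β _ => ?_)
    have h0 : 0 ≤ |deriv (theta β) x| ^ s := Real.rpow_nonneg (abs_nonneg _) _
    rw [norm_mul, Complex.norm_real, Real.norm_of_nonneg h0, mul_left_comm]
    exact mul_le_mul_of_nonneg_left (ih _) h0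

lemma transferIter_le_norm (n : ℕ) {x : ℝ} (hx : x ∈ Set.Icc (0 : ℝ) 1) :
    transferIter 𝓑 s n x ≤ ‖transferOp 𝓑 s ^ n‖ := by
  have h1 := (transferOp 𝓑 s ^ n).le_opNorm 1
  rw [norm_one, mul_one] at h1
  have h2 := (((transferOp 𝓑 s ^ n) 1).norm_coe_le_norm ⟨x, hx⟩).trans h1
  rw [transferOp_pow_one, Complex.norm_real] at h2
  exact (le_abs_self _).trans h2

lemma norm_transferOp_pow_le {n : ℕ} {C : ℝ}
    (hC : ∀ x ∈ Set.Icc (0 : ℝ) 1, transferIter 𝓑 s n x ≤ C) : ‖transferOp 𝓑 s ^ n‖ ≤ C := by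
  have hC0 : 0 ≤ C := (transferIter_pos 𝓑 s n le_rfl).le.trans (hC 0 (by simp))
  refine ContinuousLinearMap.opNorm_le_bound _ hC0 fun f => ?_
  refine (ContinuousMap.norm_le _ (by positivity)).2 fun x => ?_
  refine (norm_transferOp_pow_apply_le 𝓑 s n f x).trans ?_
  rw [mul_comm]
  exact mul_le_mul_of_nonneg_right (hC x x.2) (norm_nonneg _)

end Transfer

section MatrixNorm

attribute [local instance] Matrix.linftyOpNormedRing Matrix.linftyOpNormedAlgebra

variable {n : Type*} [Fintype n] [DecidableEq n]

lemma norm_map_ofReal_le {A : Matrix n n ℝ} {K : ℝ} (hK : 0 ≤ K) (hA : ∀ i j, |A i j| ≤ K) :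
    ‖A.map (fun t : ℝ => (t : ℂ))‖ ≤ Fintype.card n * K := by
  rw [Matrix.linfty_opNorm_def]
  lift K to NNReal using hK
  rw [show (Fintype.card n : ℝ) * K = ((Fintype.card n * K : NNReal) : ℝ) by push_cast; rfl,
    NNReal.coe_le_coe]
  refine Finset.sup_le fun i _ => ?_
  refine (Finset.sum_le_card_nsmul _ _ K fun j _ => ?_).trans_eq (by simp)
  rw [← NNReal.coe_le_coe]
  simpa using hA i j

lemma abs_mulVec_le (A : Matrix n n ℝ) (F : n → ℝ) {K : ℝ} (hF : ∀ j, |F j| ≤ K) (i : n) :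
    |(A.mulVec F) i| ≤ ‖A.map (fun t : ℝ => (t : ℂ))‖ * K := by
  have hK : 0 ≤ K := (abs_nonneg _).trans (hF i)
  have h1 := Matrix.linfty_opNorm_mulVec (A.map (fun t : ℝ => (t : ℂ))) fun j => (F j : ℂ)
  have h2 := (norm_le_pi_norm _ i).trans h1
  have e : (A.map (fun t : ℝ => (t : ℂ))).mulVec (fun j => (F j : ℂ)) i =
      ((A.mulVec F i : ℝ) : ℂ) := by
    simp [Matrix.mulVec, dotProduct]
  rw [e, Complex.norm_real, Real.norm_eq_abs] at h2
  refine h2.trans (mul_le_mul_of_nonneg_left ?_ (norm_nonneg _))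
  exact (pi_norm_le_iff_of_nonneg hK).2 fun j => by simpa using hF j

/-- `spectralRadius_pow_le_of_norm_pow_le` with a matrix on the left. The spectral radius does not
depend on a norm, and the operator norm for the sup norm is used. -/
lemma matrixSpectralRadius_le [Nonempty n] {B : Type*} [NormedRing B] [NormedAlgebra ℂ B]
    [CompleteSpace B] [NormOneClass B] {b : B} {A : Matrix n n ℝ} {l p : ℕ} {C q : ℝ}
    (hp : 1 ≤ p) (hC : 0 < C) (hq : 0 ≤ q)
    (h : ∀ (k : ℕ) (i j), |(A ^ k) i j| ≤ C * q ^ k * ‖b ^ (l + k * p)‖) :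
    matrixSpectralRadius A ≤ q * (spectralRadius ℂ b).toReal ^ p := by
  have : CompleteSpace (Matrix n n ℂ) := FiniteDimensional.complete ℂ _
  have := spectralRadius_pow_le_of_norm_pow_le (a := A.map (fun t : ℝ => (t : ℂ))) (b := b)
    (m := 0) (n := l) (p := 1) (p' := p) (C := Fintype.card n * C) (q := q) le_rfl hp
    (mul_pos (by exact_mod_cast Fintype.card_pos) hC) hq fun k => by
      have e : A.map (fun t : ℝ => (t : ℂ)) ^ k = (A ^ k).map (fun t : ℝ => (t : ℂ)) :=
        (map_pow (RingHom.mapMatrix Complex.ofRealHom) A k).symm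
      rw [zero_add, mul_one, e]
      exact (norm_map_ofReal_le (by positivity) (h k)).trans_eq (by ring)
  rwa [pow_one] at this

/-- `spectralRadius_pow_le_of_norm_pow_le` with a matrix on the right, tested on one vector. -/
lemma le_matrixSpectralRadius [Nonempty n] {B : Type*} [NormedRing B] [NormedAlgebra ℂ B]
    [CompleteSpace B] [NormOneClass B] {b : B} {A : Matrix n n ℝ} {l p : ℕ} {C q K : ℝ}
    (hp : 1 ≤ p) (hC : 0 < C) (hq : 0 ≤ q) {F : n → ℝ} (hK : 0 < K) (hF : ∀ j, |F j| ≤ K) (i : n)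
    (h : ∀ k : ℕ, ‖b ^ (l + k * p)‖ ≤ C * q ^ k * ((A ^ k).mulVec F) i) :
    (spectralRadius ℂ b).toReal ^ p ≤ q * matrixSpectralRadius A := by
  have : CompleteSpace (Matrix n n ℂ) := FiniteDimensional.complete ℂ _
  have := spectralRadius_pow_le_of_norm_pow_le (b := A.map (fun t : ℝ => (t : ℂ))) (a := b)
    (m := l) (n := 0) (p := p) (p' := 1) (C := C * K) (q := q) hp le_rfl
    (mul_pos hC hK) hq fun k => by
      have e : A.map (fun t : ℝ => (t : ℂ)) ^ k = (A ^ k).map (fun t : ℝ => (t : ℂ)) :=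
        (map_pow (RingHom.mapMatrix Complex.ofRealHom) A k).symm
      rw [zero_add, mul_one, e]
      have h1 := (le_abs_self _).trans (abs_mulVec_le (A ^ k) F hF i)
      refine (h k).trans ((mul_le_mul_of_nonneg_left h1 (by positivity)).trans_eq (by ring))
  rwa [pow_one] at this

end MatrixNorm

namespace Mesh

variable {𝓑 : Digits} {ν : ℕ} {𝓣 : Mesh 𝓑 ν}

open Filter Topology in
/-- A positive `F` that satisfies the inequalities of `K(M)` strictly is an interior point of `K(M)`. -/
lemma exists_add_smul_mem_cone {r : ℕ} {M : ℝ} {F : 𝓣.T r → ℝ} (hF : ∀ ξ, 0 < F ξ)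
    (hlt : ∀ i, ∀ ξ η : 𝓣.T r, (ξ : ℝ) ∈ Set.Icc (𝓣.a i) (𝓣.b i) →
      (η : ℝ) ∈ Set.Icc (𝓣.a i) (𝓣.b i) → ξ ≠ η → F ξ < F η * Real.exp (M * |(ξ : ℝ) - η|))
    (G : 𝓣.T r → ℝ) : ∃ δ : ℝ, 0 < δ ∧ F + δ • G ∈ 𝓣.cone r M ∧ F - δ • G ∈ 𝓣.cone r M := by
  have key : ∀ᶠ δ : ℝ in 𝓝 0, F + δ • G ∈ 𝓣.cone r M := by
    have h1 : ∀ᶠ δ : ℝ in 𝓝 0, ∀ ξ, 0 ≤ (F + δ • G) ξ := by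
      refine eventually_all.2 fun ξ => ?_
      have : ContinuousAt (fun δ : ℝ => F ξ + δ * G ξ) 0 := by fun_prop
      filter_upwards [this.eventually_const_lt (u := 0) (by simpa using hF ξ)] with δ hδ
      exact hδ.le
    have h2 : ∀ᶠ δ : ℝ in 𝓝 0, ∀ i, ∀ ξ η : 𝓣.T r, (ξ : ℝ) ∈ Set.Icc (𝓣.a i) (𝓣.b i) →
        (η : ℝ) ∈ Set.Icc (𝓣.a i) (𝓣.b i) →
        ξ ≠ η → (F + δ • G) ξ ≤ (F + δ • G) η * Real.exp (M * |(ξ : ℝ) - η|) := by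
      refine eventually_all.2 fun i => eventually_all.2 fun ξ => eventually_all.2 fun η => ?_
      by_cases h : (ξ : ℝ) ∈ Set.Icc (𝓣.a i) (𝓣.b i) ∧
        (η : ℝ) ∈ Set.Icc (𝓣.a i) (𝓣.b i) ∧ ξ ≠ η
      · have hc : ContinuousAt (fun δ : ℝ => (F η + δ * G η) * Real.exp (M * |(ξ : ℝ) - η|) -
          (F ξ + δ * G ξ)) 0 := by fun_prop
        filter_upwards [hc.eventually_const_lt (u := 0)
          (by simpa using hlt i ξ η h.1 h.2.1 h.2.2)] with δ hδ _ _ _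
        exact (sub_pos.1 hδ).le
      · exact Eventually.of_forall fun δ a b c => absurd ⟨a, b, c⟩ h
    filter_upwards [h1, h2] with δ h1 h2
    refine ⟨h1, fun i ξ η hξ hη => ?_⟩
    by_cases h : ξ = η
    · subst h; simp
    · exact h2 i ξ η hξ hη h
  obtain ⟨e, he, hball⟩ := Metric.eventually_nhds_iff.1 key
  refine ⟨e / 2, by positivity, hball ?_, ?_⟩
  · rw [Real.dist_eq, sub_zero, abs_of_pos (by positivity)]; linarith
  · have := hball (y := -(e / 2)) (by
      rw [Real.dist_eq, sub_zero, abs_neg, abs_of_pos (by positivity)]; linarith)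
    rwa [neg_smul, ← sub_eq_add_neg] at this

lemma L_pow_mulVec (s : ℝ) (r k : ℕ) (F : 𝓣.T r → ℝ) :
    ((𝓣.L s r) ^ k).mulVec F = (𝓣.discreteOp s r ^ k) F := by
  induction k generalizing F with
  | zero => simp
  | succ k ih =>
    rw [pow_succ, ← Matrix.mulVec_mulVec, ih, L, LinearMap.toMatrix'_mulVec, pow_succ]
    rfl

end Mesh

/-! ### Iterating the discrete operator on the cone -/

namespace Mesh

variable {𝓑 : Digits} {ν : ℕ} (𝓣 : Mesh 𝓑 ν)

/-- The restriction of `L_s ^ m 1` to `T`. -/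
def sampleIter (s : ℝ) (r m : ℕ) : 𝓣.T r → ℝ := fun ξ => transferIter 𝓑 s m ξ

variable {𝓣}

lemma nonempty_T {r : ℕ} : Nonempty (𝓣.T r) := by
  obtain ⟨i⟩ := 𝓣.nonempty_I
  exact ⟨⟨_, 𝓣.node_mem r ⟨i, ⟨0, 𝓣.N_pos i⟩⟩ 0⟩⟩

lemma pow_discreteOp_mem_cone {s M : ℝ} {r : ℕ}
    (hinv : ∀ F ∈ 𝓣.cone r M, 𝓣.discreteOp s r F ∈ 𝓣.cone r M) (k : ℕ) {F : 𝓣.T r → ℝ}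
    (hF : F ∈ 𝓣.cone r M) : (𝓣.discreteOp s r ^ k) F ∈ 𝓣.cone r M := by
  induction k with
  | zero => exact hF
  | succ k ih => rw [pow_succ']; exact hinv _ ih

lemma smul_sampleIter_sub_pow_mem_cone {s M q : ℝ} {r n : ℕ} (hq : 0 ≤ q)
    (hinv : ∀ F ∈ 𝓣.cone r M, 𝓣.discreteOp s r F ∈ 𝓣.cone r M)
    (hup : ∀ m, n ≤ m →
      q • 𝓣.sampleIter s r (m + ν) - 𝓣.discreteOp s r (𝓣.sampleIter s r m) ∈ 𝓣.cone r M)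
    (h0 : (0 : 𝓣.T r → ℝ) ∈ 𝓣.cone r M) (k : ℕ) :
    q ^ k • 𝓣.sampleIter s r (n + k * ν) - (𝓣.discreteOp s r ^ k) (𝓣.sampleIter s r n) ∈
      𝓣.cone r M := by
  induction k with
  | zero => simpa using h0
  | succ k ih =>
    have h1 := cone_smul (pow_nonneg hq k) (hup (n + k * ν) (Nat.le_add_right _ _))
    have h2 := cone_add h1 (hinv _ ih)
    rw [map_sub, map_smul] at h2
    convert h2 using 1
    rw [smul_sub, smul_smul, ← pow_succ, sub_add_sub_cancel, pow_succ' (𝓣.discreteOp s r),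
      Module.End.mul_apply, add_mul, one_mul, add_assoc]

lemma pow_sub_smul_sampleIter_mem_cone {s M q : ℝ} {r n : ℕ} (hq : 0 ≤ q)
    (hinv : ∀ F ∈ 𝓣.cone r M, 𝓣.discreteOp s r F ∈ 𝓣.cone r M)
    (hlow : ∀ m, n ≤ m →
      𝓣.discreteOp s r (𝓣.sampleIter s r m) - q • 𝓣.sampleIter s r (m + ν) ∈ 𝓣.cone r M)
    (h0 : (0 : 𝓣.T r → ℝ) ∈ 𝓣.cone r M) (k : ℕ) :
    (𝓣.discreteOp s r ^ k) (𝓣.sampleIter s r n) - q ^ k • 𝓣.sampleIter s r (n + k * ν) ∈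
      𝓣.cone r M := by
  induction k with
  | zero => simpa using h0
  | succ k ih =>
    have h1 := cone_smul (pow_nonneg hq k) (hlow (n + k * ν) (Nat.le_add_right _ _))
    have h2 := cone_add (hinv _ ih) h1
    rw [map_sub, map_smul] at h2
    convert h2 using 1
    rw [smul_sub, smul_smul, ← pow_succ, sub_add_sub_cancel, pow_succ' (𝓣.discreteOp s r),
      Module.End.mul_apply, add_mul, one_mul, add_assoc]

lemma zero_mem_cone (r : ℕ) (M : ℝ) : (0 : 𝓣.T r → ℝ) ∈ 𝓣.cone r M :=
  ⟨fun _ => le_rfl, fun _ _ _ _ _ => by simp⟩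

/-- If `F ± δ G` lie in the cone, then `𝐋 ^ k G` is dominated by `𝐋 ^ k F`. -/
lemma abs_pow_apply_le {s M δ : ℝ} {r : ℕ} (hδ : 0 < δ)
    (hinv : ∀ F ∈ 𝓣.cone r M, 𝓣.discreteOp s r F ∈ 𝓣.cone r M) {F G : 𝓣.T r → ℝ}
    (h1 : F + δ • G ∈ 𝓣.cone r M) (h2 : F - δ • G ∈ 𝓣.cone r M) (k : ℕ) (ξ : 𝓣.T r) :
    |(𝓣.discreteOp s r ^ k) G ξ| ≤ δ⁻¹ * (𝓣.discreteOp s r ^ k) F ξ := by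
  have e1 := (pow_discreteOp_mem_cone hinv k h1).1 ξ
  have e2 := (pow_discreteOp_mem_cone hinv k h2).1 ξ
  rw [map_add, map_smul] at e1
  rw [map_sub, map_smul] at e2
  simp only [Pi.add_apply, Pi.sub_apply, Pi.smul_apply, smul_eq_mul] at e1 e2
  rw [inv_mul_eq_div, le_div_iff₀ hδ]
  have : |(𝓣.discreteOp s r ^ k) G ξ * δ| ≤ (𝓣.discreteOp s r ^ k) F ξ :=
    abs_le.2 ⟨by linarith, by linarith⟩
  rwa [abs_mul, abs_of_pos hδ] at this

/-- The upper bound for `R(𝐋)`: the entries of `𝐋 ^ k` are dominated by `𝐋 ^ k f_n ≤ q ^ k f_{n+kν}`, as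
`f_n` is an interior point of the cone. -/
theorem matrixSpectralRadius_L_le {s M q : ℝ} {r n : ℕ} (hr : 1 ≤ r) (hν : 1 ≤ ν) (hq : 0 ≤ q)
    (hinv : ∀ F ∈ 𝓣.cone r M, 𝓣.discreteOp s r F ∈ 𝓣.cone r M)
    (hup : ∀ m, n ≤ m →
      q • 𝓣.sampleIter s r (m + ν) - 𝓣.discreteOp s r (𝓣.sampleIter s r m) ∈ 𝓣.cone r M)
    (hlt : ∀ i, ∀ ξ η : 𝓣.T r, (ξ : ℝ) ∈ Set.Icc (𝓣.a i) (𝓣.b i) →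
      (η : ℝ) ∈ Set.Icc (𝓣.a i) (𝓣.b i) → ξ ≠ η → 𝓣.sampleIter s r n ξ <
        𝓣.sampleIter s r n η * Real.exp (M * |(ξ : ℝ) - η|)) :
    matrixSpectralRadius (𝓣.L s r) ≤ q * lam 𝓑 s ^ ν := by
  have hpos : ∀ ξ, 0 < 𝓣.sampleIter s r n ξ := fun ξ =>
    transferIter_pos 𝓑 s n (𝓑.S_subset (𝓣.T_mem_S hr ξ)).1
  choose δ hδ hadd hsub using fun η : 𝓣.T r =>
    exists_add_smul_mem_cone hpos hlt (Pi.single η (1 : ℝ))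
  have hT : Nonempty (𝓣.T r) := nonempty_T
  obtain ⟨C, hC⟩ := (Set.finite_range fun η => (δ η)⁻¹).bddAbove
  have hC' : ∀ η, (δ η)⁻¹ ≤ C := fun η => hC ⟨η, rfl⟩
  have hC0 : 0 < C := (inv_pos.2 (hδ hT.some)).trans_le (hC' _)
  refine matrixSpectralRadius_le (b := transferOp 𝓑 s) (l := n) (C := C) hν hC0 hq
    fun k ξ η => ?_
  have h1 := abs_pow_apply_le (hδ η) hinv (hadd η) (hsub η) k ξ
  rw [← L_pow_mulVec, Matrix.mulVec_single_one] at h1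
  have h2 := (smul_sampleIter_sub_pow_mem_cone hq hinv hup (zero_mem_cone r M) k).1 ξ
  simp only [Pi.sub_apply, Pi.smul_apply, smul_eq_mul, sub_nonneg] at h2
  have h3 : 𝓣.sampleIter s r (n + k * ν) ξ ≤ ‖transferOp 𝓑 s ^ (n + k * ν)‖ :=
    transferIter_le_norm 𝓑 s _ (𝓑.S_subset (𝓣.T_mem_S hr ξ))
  have h4 := inv_pos.2 (hδ η)
  calc |(𝓣.L s r ^ k) ξ η| ≤ (δ η)⁻¹ * (𝓣.discreteOp s r ^ k) (𝓣.sampleIter s r n) ξ := h1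
    _ ≤ (δ η)⁻¹ * (q ^ k * ‖transferOp 𝓑 s ^ (n + k * ν)‖) := by
        gcongr
        exact h2.trans (by gcongr)
    _ ≤ C * (q ^ k * ‖transferOp 𝓑 s ^ (n + k * ν)‖) := by
        gcongr
        exact hC' η
    _ = _ := by ring

/-- The lower bound for `R(𝐋)`: the norm of `L_s ^ (n + k ν)` is the maximum of `f_{n+kν}` on `[0, 1]`, and
the values of this function on `[0, 1]` differ by a factor of at most `exp (2 s)`. -/
theorem lam_pow_le_matrixSpectralRadius_L {s M q : ℝ} {r n : ℕ} (hr : 1 ≤ r) (hν : 1 ≤ ν)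
    (hn : 1 ≤ n) (hs : 0 ≤ s) (hq : 0 < q)
    (hinv : ∀ F ∈ 𝓣.cone r M, 𝓣.discreteOp s r F ∈ 𝓣.cone r M)
    (hlow : ∀ m, n ≤ m →
      𝓣.discreteOp s r (𝓣.sampleIter s r m) - q • 𝓣.sampleIter s r (m + ν) ∈ 𝓣.cone r M) :
    lam 𝓑 s ^ ν ≤ q⁻¹ * matrixSpectralRadius (𝓣.L s r) := by
  have hT : Nonempty (𝓣.T r) := nonempty_T
  have hS := fun ξ : 𝓣.T r => 𝓑.S_subset (𝓣.T_mem_S hr ξ)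
  have ξ₀ := hT.some
  refine le_matrixSpectralRadius (b := transferOp 𝓑 s) (l := n) (C := Real.exp (2 * s))
    (F := 𝓣.sampleIter s r n) (K := ‖transferOp 𝓑 s ^ n‖) hν (Real.exp_pos _)
    (inv_pos.2 hq).le ((transferIter_pos 𝓑 s n (hS ξ₀).1).trans_le
      (transferIter_le_norm 𝓑 s n (hS ξ₀)))
    (fun ξ => ?_) ξ₀ fun k => ?_
  · have hξ : 0 < 𝓣.sampleIter s r n ξ := transferIter_pos 𝓑 s n (hS ξ).1
    rw [abs_of_pos hξ]
    exact transferIter_le_norm 𝓑 s n (hS ξ)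
  · rw [L_pow_mulVec]
    have h2 := (pow_sub_smul_sampleIter_mem_cone hq.le hinv hlow (zero_mem_cone r M) k).1 ξ₀
    simp only [Pi.sub_apply, Pi.smul_apply, smul_eq_mul, sub_nonneg] at h2
    refine norm_transferOp_pow_le 𝓑 s fun x hx => ?_
    obtain ⟨N, hN⟩ : ∃ N, n + k * ν = N + 1 := ⟨n + k * ν - 1, by omega⟩
    have hmix := isPowerMixture_transferIter 𝓑 s N
    rw [← hN] at hmix
    have h3 := hmix.le_exp_mul (by linarith)
      (by linarith [𝓑.one_le_γ, (𝓑.ends_bounds N).1]) hx (hS ξ₀)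
    refine h3.trans ?_
    rw [mul_assoc]
    refine mul_le_mul_of_nonneg_left ?_ (Real.exp_pos _).le
    rw [inv_pow, inv_mul_eq_div, le_div_iff₀ (pow_pos hq k), mul_comm]
    exact h2

/-- The discrete operator reproduces the iterates up to the relative interpolation error. -/
lemma abs_sampleIter_sub_discreteOp_le {s : ℝ} {r n : ℕ} (hr : 1 ≤ r) (hs : 0 ≤ s)
    (ξ : 𝓣.T r) :
    |𝓣.sampleIter s r (n + 1 + ν) ξ - 𝓣.discreteOp s r (𝓣.sampleIter s r (n + 1)) ξ| ≤
      errConst (2 * s) r 𝓣.h (𝓑.shift n) * 𝓣.h ^ (r + 1) *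
        𝓣.sampleIter s r (n + 1 + ν) ξ := by
  have hγ := 𝓑.one_le_γ
  have hn := (𝓑.ends_bounds n).1
  have ha := 𝓑.aInf_pos
  have hξ := 𝓣.T_mem_S hr ξ
  have hξ0 := (𝓑.S_subset hξ).1
  change |transferIter 𝓑 s (n + 1 + ν) ξ - ∑ ω : 𝓑.Word ν, gWord ω ξ ^ s *
    𝓣.interp r (𝓣.sampleIter s r (n + 1)) (thetaWord ω ξ)| ≤ _ * transferIter 𝓑 s (n + 1 + ν) ξ
  rw [transferIter_add 𝓑 s _ ν hξ0, ← Finset.sum_sub_distrib, Finset.mul_sum]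
  refine (Finset.abs_sum_le_sum_abs _ _).trans (Finset.sum_le_sum fun ω _ => ?_)
  have hg : 0 ≤ gWord ω ξ ^ s := Real.rpow_nonneg (gWord_nonneg _ _) _
  rw [← mul_sub, abs_mul, abs_of_nonneg hg, mul_left_comm]
  refine mul_le_mul_of_nonneg_left ?_ hg
  obtain ⟨i, hi⟩ := 𝓣.mapsTo ω
  obtain ⟨j, hj⟩ := 𝓣.exists_cell (hi hξ)
  have hd := 𝓣.hi_pos i
  have hmix := isPowerMixture_transferIter 𝓑 s n
  have ht : 𝓑.aInf ≤ 𝓣.t i j :=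
    (𝓣.cell_subset_S ⟨i, j⟩ ⟨le_rfl, 𝓣.t_mono i (Nat.le_succ _)⟩).1
  have hj' : thetaWord ω ξ ∈ Set.Icc (𝓣.t i j) (𝓣.t i j + 𝓣.hi i) := by
    rw [← 𝓣.t_succ]; exact hj
  have h1 := hmix.abs_interpolation_error_le hr (by linarith : 0 ≤ 2 * s) ha.le
    (by linarith) hd ht hj'
  rw [𝓣.interp_eq hr _ ⟨i, j⟩ hj]
  refine h1.trans (mul_le_mul_of_nonneg_right ?_ (transferIter_pos 𝓑 s _
    (thetaWord_nonneg ω hξ0)).le)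
  have hdh := 𝓣.hi_le_h i
  have hc := cos_pos_aux hr
  have hsh := 𝓑.shift_pos n
  change errConst (2 * s) r (𝓣.hi i) (𝓑.shift n) * _ ≤ _
  unfold errConst
  gcongr

/-- A perturbation `E` of `ε V` that is small relative to `V` stays in `K(M)`, provided that the minimal
spacing of the points leaves enough room between the log-Lipschitz constants `a` of `V` and `M`. -/
lemma smul_add_mem_cone {r : ℕ} {ε g a M : ℝ} (hr : 1 ≤ r) (hgε : g ≤ ε) (haM : a ≤ M)
    (hexp : ε + g ≤ (ε - g) * Real.exp ((M - a) * 𝓣.gap r)) {V E : 𝓣.T r → ℝ}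
    (hV : ∀ ξ, 0 ≤ V ξ)
    (hlip : ∀ ξ η : 𝓣.T r, V ξ ≤ V η * Real.exp (a * |(ξ : ℝ) - η|))
    (hE : ∀ ξ, |E ξ| ≤ g * V ξ) : ε • V + E ∈ 𝓣.cone r M := by
  have hlow : ∀ ξ, (ε - g) * V ξ ≤ (ε • V + E) ξ := fun ξ => by
    have := (abs_le.1 (hE ξ)).1
    simp only [Pi.add_apply, Pi.smul_apply, smul_eq_mul]
    linarith
  have hup : ∀ ξ, (ε • V + E) ξ ≤ (ε + g) * V ξ := fun ξ => by
    have := (abs_le.1 (hE ξ)).2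
    simp only [Pi.add_apply, Pi.smul_apply, smul_eq_mul]
    linarith
  refine ⟨fun ξ => (mul_nonneg (by linarith) (hV ξ)).trans (hlow ξ), fun i ξ η hξ hη => ?_⟩
  by_cases h : ξ = η
  · subst h; simp
  have hgap : 𝓣.gap r ≤ |(ξ : ℝ) - η| := by
    rcases lt_or_gt_of_ne fun h' => h (Subtype.ext h') with h' | h'
    · rw [abs_sub_comm]
      exact (𝓣.gap_le_sub hr hξ hη h').trans (le_abs_self _)
    · exact (𝓣.gap_le_sub hr hη hξ h').trans (le_abs_self _)
  have h1 : ε + g ≤ (ε - g) * Real.exp ((M - a) * |(ξ : ℝ) - η|) := by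
    refine hexp.trans (mul_le_mul_of_nonneg_left (Real.exp_le_exp.2 ?_) (by linarith))
    exact mul_le_mul_of_nonneg_left hgap (by linarith)
  have hbase : (ε + g) * V ξ ≤ (ε - g) * V η * Real.exp (M * |(ξ : ℝ) - η|) := by
    rcases le_or_gt 0 (ε + g) with h0 | h0
    · calc (ε + g) * V ξ ≤ (ε + g) * (V η * Real.exp (a * |(ξ : ℝ) - η|)) := by
            gcongr; exact hlip ξ η
        _ ≤ (ε - g) * Real.exp ((M - a) * |(ξ : ℝ) - η|) *
            (V η * Real.exp (a * |(ξ : ℝ) - η|)) :=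
            mul_le_mul_of_nonneg_right h1 (mul_nonneg (hV η) (Real.exp_pos _).le)
        _ = (ε - g) * V η * (Real.exp ((M - a) * |(ξ : ℝ) - η|) *
            Real.exp (a * |(ξ : ℝ) - η|)) := by ring
        _ = _ := by rw [← Real.exp_add]; congr 2; ring
    · have := mul_nonneg (mul_nonneg (by linarith : 0 ≤ ε - g) (hV η))
        (Real.exp_pos (M * |(ξ : ℝ) - η|)).le
      exact (mul_nonpos_of_nonpos_of_nonneg h0.le (hV ξ)).trans this
  exact (hup ξ).trans (hbase.trans (mul_le_mul_of_nonneg_right (hlow η) (Real.exp_pos _).le))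

lemma sampleIter_le_mul_exp {s : ℝ} {r n : ℕ} (hr : 1 ≤ r) (hs : 0 ≤ s) (ξ η : 𝓣.T r) :
    𝓣.sampleIter s r (n + 1) ξ ≤ 𝓣.sampleIter s r (n + 1) η *
      Real.exp (2 * s / 𝓑.shift n * |(ξ : ℝ) - η|) :=
  (isPowerMixture_transferIter 𝓑 s n).le_mul_exp (by linarith) 𝓑.aInf_pos.le
    (by linarith [𝓑.one_le_γ, (𝓑.ends_bounds n).1]) (𝓣.T_mem_S hr ξ).1 (𝓣.T_mem_S hr η).1

/-- The two-sided bound, from the invariance of the cone and scalar conditions on the iterates. -/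
theorem spectralRadius_bounds {s M ε : ℝ} {r n₀ : ℕ} (hr : 1 ≤ r) (hν : 1 ≤ ν) (hs : 0 ≤ s)
    (hε : 0 ≤ ε) (hinv : ∀ F ∈ 𝓣.cone r M, 𝓣.discreteOp s r F ∈ 𝓣.cone r M)
    (hcond : ∀ n, n₀ ≤ n → 2 * s / 𝓑.shift n < M ∧
      errConst (2 * s) r 𝓣.h (𝓑.shift n) * 𝓣.h ^ (r + 1) ≤ ε ∧
      ε + errConst (2 * s) r 𝓣.h (𝓑.shift n) * 𝓣.h ^ (r + 1) ≤
        (ε - errConst (2 * s) r 𝓣.h (𝓑.shift n) * 𝓣.h ^ (r + 1)) *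
          Real.exp ((M - 2 * s / 𝓑.shift n) * 𝓣.gap r)) :
    matrixSpectralRadius (𝓣.L s r) ≤ (1 + ε) * lam 𝓑 s ^ ν ∧
      (ε < 1 → lam 𝓑 s ^ ν ≤ (1 - ε)⁻¹ * matrixSpectralRadius (𝓣.L s r)) := by
  have hpos : ∀ m ξ, 0 < 𝓣.sampleIter s r m ξ := fun m ξ =>
    transferIter_pos 𝓑 s m (𝓑.S_subset (𝓣.T_mem_S hr ξ)).1
  have key : ∀ m, n₀ + 1 ≤ m → ∀ E : 𝓣.T r → ℝ,
      (∀ ξ, |E ξ| = |𝓣.sampleIter s r (m + ν) ξ -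
        𝓣.discreteOp s r (𝓣.sampleIter s r m) ξ|) →
      ε • 𝓣.sampleIter s r (m + ν) + E ∈ 𝓣.cone r M := by
    intro m hm E hE
    obtain ⟨n, rfl⟩ : ∃ n, m = n + 1 := ⟨m - 1, by omega⟩
    obtain ⟨h1, h2, h3⟩ := hcond n (by omega)
    refine smul_add_mem_cone hr h2 h1.le h3 (fun ξ => (hpos _ ξ).le) (fun ξ η => ?_) fun ξ => ?_
    · rw [show n + 1 + ν = n + ν + 1 by ring]
      refine (sampleIter_le_mul_exp hr hs ξ η).trans ?_
      have h4 := 𝓑.shift_mono (Nat.le_add_right n ν)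
      have h5 := (hpos (n + ν + 1) η).le
      have h6 := 𝓑.shift_pos n
      gcongr
    · rw [hE]
      exact abs_sampleIter_sub_discreteOp_le hr hs ξ
  constructor
  · refine matrixSpectralRadius_L_le (n := n₀ + 1) hr hν (by linarith) hinv (fun m hm => ?_)
      fun i ξ η _ _ hne => ?_
    · convert key m hm (𝓣.sampleIter s r (m + ν) - 𝓣.discreteOp s r (𝓣.sampleIter s r m))
        (fun ξ => rfl) using 1
      rw [add_smul, one_smul]
      abel
    · obtain ⟨h1, -⟩ := hcond n₀ le_rfl
      refine (sampleIter_le_mul_exp hr hs ξ η).trans_lt ?_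
      have hd : 0 < |(ξ : ℝ) - η| := abs_pos.2 (sub_ne_zero.2 fun h => hne (Subtype.ext h))
      have := hpos (n₀ + 1) η
      gcongr
  · intro hε1
    refine lam_pow_le_matrixSpectralRadius_L (n := n₀ + 1) hr hν (by omega) hs (by linarith)
      hinv fun m hm => ?_
    convert key m hm (𝓣.discreteOp s r (𝓣.sampleIter s r m) - 𝓣.sampleIter s r (m + ν))
      (fun ξ => abs_sub_comm _ _) using 1
    rw [sub_smul, one_smul]
    abel

end Mesh

/-! ### The two-sided bound and the distance of the two matrices -/

/-- A bound for `log ((1 + x) / (1 - x)) = 2 x + 2 x ^ 3 / 3 + …` for small `x`. -/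
lemma one_add_lt_one_sub_mul_exp {x y : ℝ} (hx : 0 < x) (hx' : x ≤ 3 / 20)
    (hy : 2 * x * (1 + 16 / 9 * x ^ 2) ≤ y) : 1 + x < (1 - x) * Real.exp y := by
  set z := 2 * x * (1 + 16 / 9 * x ^ 2) with hz
  have hz2 : 2 * x ≤ z := by
    have : 0 ≤ x ^ 3 := by positivity
    rw [hz]; linarith
  have h1 := Real.quadratic_le_exp_of_nonneg (by linarith : 0 ≤ z)
  have h2 : Real.exp z ≤ Real.exp y := Real.exp_le_exp.2 hy
  have h3 : (2 * x) ^ 2 ≤ z ^ 2 := by gcongr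
  have h4 : 1 + z + 2 * x ^ 2 ≤ Real.exp y := by linarith
  have h5 := mul_le_mul_of_nonneg_left h4 (by linarith : 0 ≤ 1 - x)
  refine lt_of_lt_of_le ?_ h5
  have h6 : 0 < x ^ 3 * (14 / 9 - 32 / 9 * x) := mul_pos (by positivity) (by linarith)
  have : (1 - x) * (1 + z + 2 * x ^ 2) = 1 + x + x ^ 3 * (14 / 9 - 32 / 9 * x) := by
    rw [hz]; ring
  linarith

lemma continuousAt_errConst (σ : ℝ) (r : ℕ) (h : ℝ) {χ : ℝ} (hχ : χ ≠ 0) :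
    ContinuousAt (fun χ' => errConst σ r h χ') χ := by
  unfold errConst
  have := pow_ne_zero (r + 1) hχ
  fun_prop (disch := assumption)

lemma errConst_zero (r : ℕ) (h χ : ℝ) : errConst 0 r h χ = 0 := by
  unfold errConst
  rw [Finset.prod_eq_zero (Finset.mem_range.2 (Nat.succ_pos r)) (by simp)]
  simp

namespace Mesh

variable {𝓑 : Digits} {ν : ℕ} (𝓣 : Mesh 𝓑 ν)

lemma gap_pos (r : ℕ) : 0 < 𝓣.gap r := by
  have h1 := sin_pi_div_pos (r := r)
  have h2 := 𝓣.h_pos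
  have h3 := 𝓣.one_le_μ
  unfold gap
  positivity

lemma gap_le_half_h {r : ℕ} (hr : 2 ≤ r) : 𝓣.gap r ≤ 𝓣.h / 2 := by
  have h1 := sin_pi_div_pos (r := r)
  have h2 := 𝓣.h_pos
  have h3 := 𝓣.one_le_μ
  have hr' : (2 : ℝ) ≤ r := by exact_mod_cast hr
  have h4 : Real.sin (Real.pi / (2 * r + 2)) ≤ 1 / 2 := by
    rw [← Real.sin_pi_div_six]
    have hp := Real.pi_pos
    refine Real.sin_le_sin_of_le_of_le_pi_div_two ?_ (by linarith) ?_
    · have : 0 < Real.pi / (2 * (r : ℝ) + 2) := by positivity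
      linarith
    · exact div_le_div_of_nonneg_left hp.le (by norm_num) (by linarith)
  calc 𝓣.gap r ≤ 2 * (1 / 2) ^ 2 * 𝓣.h := by
        unfold gap
        gcongr
        exact div_le_self h2.le h3
    _ = 𝓣.h / 2 := by ring

lemma H_nonneg {s : ℝ} (hs : 0 ≤ s) {r : ℕ} (hr : 1 ≤ r) : 0 ≤ 𝓣.H s r := by
  have h1 := sin_pi_div_pos (r := r)
  have h2 := cos_pos_aux hr
  have h3 := 𝓣.one_le_μ
  have h4 : 0 < 𝓑.χ := by
    have := 𝓑.aInf_pos; have := 𝓑.one_le_γ; unfold Digits.χ; linarith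
  unfold H Hconst
  positivity

/-- The identity `ε * x = G h ^ (r + 1)` that explains the choice of `H`, where `ε = H h ^ r` and `x` is
half of `2 s / χ` times the minimal spacing. -/
lemma H_pow_mul_gap {s : ℝ} (hs : 0 < s) {r : ℕ} (hχ : 0 < 𝓑.χ) :
    𝓣.H s r * 𝓣.h ^ r * (2 * s / 𝓑.χ * 𝓣.gap r / 2) =
      errConst (2 * s) r 𝓣.h 𝓑.χ * 𝓣.h ^ (r + 1) := by
  have h1 := (sin_pi_div_pos (r := r)).ne'
  have h3 : 𝓣.μ ≠ 0 := by linarith [𝓣.one_le_μ]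
  rw [H, Hconst_eq 𝓑 hs.ne', Dconst, Gconst_eq, gap]
  generalize Real.sin (Real.pi / (2 * r + 2)) = q at h1 ⊢
  field_simp
  ring

open Filter Topology in
/-- The scalar conditions of `spectralRadius_bounds` hold strictly in the limit, where the shift
is `χ` and the error constant is `G`, and therefore for all large `n`. In the limit they read
`ε + ε x < (ε - ε x) exp ((M - a) d)` with `x = a d / 2 ≤ 3 h / 4`, where `(M - a) d ≥ 2 x (1 + h ^ 2)`. -/
lemma exists_scalar_cond {s M : ℝ} {r : ℕ} (hr : 2 ≤ r) (hs : 0 < s) (hs' : s ≤ 3 / 2)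
    (hχ : 1 ≤ 𝓑.χ) (hh : 𝓣.h ≤ 1 / 5) (hM : 2 * s / 𝓑.χ * (2 + 𝓣.h ^ 2) ≤ M) :
    ∃ n₀, ∀ n, n₀ ≤ n → 2 * s / 𝓑.shift n < M ∧
      errConst (2 * s) r 𝓣.h (𝓑.shift n) * 𝓣.h ^ (r + 1) ≤ 𝓣.H s r * 𝓣.h ^ r ∧
      𝓣.H s r * 𝓣.h ^ r + errConst (2 * s) r 𝓣.h (𝓑.shift n) * 𝓣.h ^ (r + 1) ≤
        (𝓣.H s r * 𝓣.h ^ r - errConst (2 * s) r 𝓣.h (𝓑.shift n) * 𝓣.h ^ (r + 1)) *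
          Real.exp ((M - 2 * s / 𝓑.shift n) * 𝓣.gap r) := by
  have hh0 := 𝓣.h_pos
  have hgap := 𝓣.gap_pos r
  have hgap' := 𝓣.gap_le_half_h hr
  have hχ0 : 0 < 𝓑.χ := by linarith
  have hid := 𝓣.H_pow_mul_gap hs (r := r) hχ0
  have hεnn : 0 ≤ 𝓣.H s r * 𝓣.h ^ r := by
    have := 𝓣.H_nonneg hs.le (by omega : 1 ≤ r)
    positivity
  have hgpos : 0 < errConst (2 * s) r 𝓣.h 𝓑.χ * 𝓣.h ^ (r + 1) := by
    have hc := cos_pos_aux (by omega : 1 ≤ r)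
    unfold errConst
    have : 0 < ∏ j ∈ Finset.range (r + 1), (2 * s + (j : ℝ)) :=
      Finset.prod_pos fun j _ => by positivity
    positivity
  have ha : 0 < 2 * s / 𝓑.χ := by positivity
  have ha3 : 2 * s / 𝓑.χ ≤ 3 := by
    rw [div_le_iff₀ hχ0]; linarith
  set ε := 𝓣.H s r * 𝓣.h ^ r with hε
  set a := 2 * s / 𝓑.χ with ha_def
  set x := a * 𝓣.gap r / 2 with hx
  have hx0 : 0 < x := by positivity
  have hxh : x ≤ 3 / 4 * 𝓣.h := by
    have : a * 𝓣.gap r ≤ 3 * (𝓣.h / 2) := by gcongr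
    rw [hx]; linarith
  have hε0 : 0 < ε := by
    rcases hεnn.lt_or_eq with h | h
    · exact h
    · rw [← h, zero_mul] at hid; linarith
  have hy : 2 * x * (1 + 16 / 9 * x ^ 2) ≤ (M - a) * 𝓣.gap r := by
    have h1 : x ^ 2 ≤ (3 / 4 * 𝓣.h) ^ 2 := by gcongr
    have h2 : 1 + 16 / 9 * x ^ 2 ≤ 1 + 𝓣.h ^ 2 := by linarith
    calc 2 * x * (1 + 16 / 9 * x ^ 2) ≤ 2 * x * (1 + 𝓣.h ^ 2) := by gcongr
      _ = a * (1 + 𝓣.h ^ 2) * 𝓣.gap r := by rw [hx]; ring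
      _ ≤ _ := by gcongr; linarith
  have hkey := one_add_lt_one_sub_mul_exp hx0 (by linarith) hy
  have hce := continuousAt_errConst (2 * s) r 𝓣.h hχ0.ne'
  have c1 : ContinuousAt (fun χ' : ℝ => M - 2 * s / χ') 𝓑.χ := by
    have := hχ0.ne'
    fun_prop (disch := assumption)
  have c2 : ContinuousAt (fun χ' : ℝ => ε - errConst (2 * s) r 𝓣.h χ' * 𝓣.h ^ (r + 1)) 𝓑.χ :=
    continuousAt_const.sub (hce.mul continuousAt_const)
  have c3 : ContinuousAt (fun χ' : ℝ => (ε - errConst (2 * s) r 𝓣.h χ' * 𝓣.h ^ (r + 1)) *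
      Real.exp ((M - 2 * s / χ') * 𝓣.gap r) -
      (ε + errConst (2 * s) r 𝓣.h χ' * 𝓣.h ^ (r + 1))) 𝓑.χ :=
    (c2.mul (c1.mul continuousAt_const).rexp).sub
      (continuousAt_const.add (hce.mul continuousAt_const))
  have p1 : 0 < M - 2 * s / 𝓑.χ := by
    have : 0 < a * (1 + 𝓣.h ^ 2) := by positivity
    change 0 < M - a
    linarith
  have p2 : 0 < ε - errConst (2 * s) r 𝓣.h 𝓑.χ * 𝓣.h ^ (r + 1) := by
    rw [← hid]
    have := mul_lt_mul_of_pos_left (show x < 1 by linarith) hε0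
    linarith
  have p3 : 0 < (ε - errConst (2 * s) r 𝓣.h 𝓑.χ * 𝓣.h ^ (r + 1)) *
      Real.exp ((M - 2 * s / 𝓑.χ) * 𝓣.gap r) -
      (ε + errConst (2 * s) r 𝓣.h 𝓑.χ * 𝓣.h ^ (r + 1)) := by
    rw [← hid]
    have := mul_lt_mul_of_pos_left hkey hε0
    change 0 < (ε - ε * x) * Real.exp ((M - a) * 𝓣.gap r) - (ε + ε * x)
    linarith
  have hev := ((c1.eventually_const_lt p1).and
    ((c2.eventually_const_lt p2).and (c3.eventually_const_lt p3)))
  obtain ⟨n₀, hn₀⟩ := eventually_atTop.1 (𝓑.tendsto_shift.eventually hev)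
  refine ⟨n₀, fun n hn => ?_⟩
  obtain ⟨e1, e2, e3⟩ := hn₀ n hn
  exact ⟨sub_pos.1 e1, (sub_pos.1 e2).le, (sub_pos.1 e3).le⟩

theorem spectralRadius_bounds_of_pos {s κ₂ M M₀ u : ℝ} {r : ℕ} (hr : 2 ≤ r) (hν : 1 ≤ ν)
    (hs : 0 < s) (hs' : s ≤ 3 / 2) (hχ : 1 ≤ 𝓑.χ) (hκ : kappa₁ 𝓑 r ν < κ₂) (hκ₂ : κ₂ < 1)
    (hM₀ : ∀ ω : 𝓑.Word ν, ∀ x ∈ 𝓑.S, ∀ y ∈ 𝓑.S,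
      gWord ω x ≤ gWord ω y * Real.exp (M₀ * |x - y|))
    (hM : M = Mconst 𝓑 s r ν κ₂) (hu : u = M * eta r * 𝓣.h)
    (hψ : psi r * u * Real.exp u < 1)
    (hinv : kappa₁ 𝓑 r ν * Real.exp u / (1 - psi r * u * Real.exp u) < κ₂ - s * M₀ / M)
    (hH : 2 + 𝓣.H s r * 𝓣.h ^ r * (1 + 𝓣.h ^ (2 * r + 2)) + 𝓣.h ^ 2 ≤
      2 / (κ₂ - kappa₁ 𝓑 r ν)) (hh : 𝓣.h ≤ 1 / 5) :
    matrixSpectralRadius (𝓣.L s r) ≤ (1 + 𝓣.H s r * 𝓣.h ^ r) * lam 𝓑 s ^ ν ∧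
      (𝓣.H s r * 𝓣.h ^ r < 1 → lam 𝓑 s ^ ν ≤
        (1 - 𝓣.H s r * 𝓣.h ^ r)⁻¹ * matrixSpectralRadius (𝓣.L s r)) := by
  have hr1 : 1 ≤ r := by omega
  have hh0 := 𝓣.h_pos
  have hH0 := 𝓣.H_nonneg hs.le hr1
  have hχ0 : 0 < 𝓑.χ := by linarith
  have hκd : 0 < κ₂ - kappa₁ 𝓑 r ν := by linarith
  have hends := 𝓑.ends_bounds (ν - 1)
  have hden : 0 < 𝓑.aInf + (𝓑.ends (ν - 1)).1 + 𝓑.γ := by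
    linarith [𝓑.aInf_pos, 𝓑.one_le_γ]
  have hdenχ : 𝓑.aInf + (𝓑.ends (ν - 1)).1 + 𝓑.γ ≤ 𝓑.χ := by
    unfold Digits.χ; linarith
  have hMge : 2 * s / 𝓑.χ * (2 + 𝓣.h ^ 2) ≤ M := by
    have h1 : 2 + 𝓣.h ^ 2 ≤ 2 / (κ₂ - kappa₁ 𝓑 r ν) := by
      have : 0 ≤ 𝓣.H s r * 𝓣.h ^ r * (1 + 𝓣.h ^ (2 * r + 2)) := by positivity
      linarith
    calc 2 * s / 𝓑.χ * (2 + 𝓣.h ^ 2) ≤ 2 * s / 𝓑.χ * (2 / (κ₂ - kappa₁ 𝓑 r ν)) := by gcongr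
      _ = 4 * s / 𝓑.χ * (1 / (κ₂ - kappa₁ 𝓑 r ν)) := by ring
      _ ≤ 4 * s / (𝓑.aInf + (𝓑.ends (ν - 1)).1 + 𝓑.γ) * (1 / (κ₂ - kappa₁ 𝓑 r ν)) := by gcongr
      _ = M := by rw [hM, Mconst]
  have hM0 : 0 < M := lt_of_lt_of_le (by positivity) hMge
  obtain ⟨n₀, hn₀⟩ := 𝓣.exists_scalar_cond hr hs hs' hχ hh hMge
  refine spectralRadius_bounds hr1 hν hs.le (by positivity) (fun F hF => ?_) hn₀
  refine cone_mono ?_ (𝓣.discreteOp_mem_cone hr hν hs.le hM₀ hM0.le hu hψ hF)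
  have h1 := mul_le_mul_of_nonneg_right hinv.le hM0.le
  rw [sub_mul, div_mul_cancel₀ _ hM0.ne'] at h1
  have h2 := mul_le_mul_of_nonneg_right hκ₂.le hM0.le
  linarith

open Filter Topology in
/-- For `s = 0` interpolation is exact on the constant functions `L_0 ^ n 1`, and the two spectral radii
agree. -/
theorem spectralRadius_bounds_zero {r : ℕ} (hr : 2 ≤ r) (hν : 1 ≤ ν) (hκ : kappa₁ 𝓑 r ν < 1)
    {M₀ : ℝ} (hM₀ : ∀ ω : 𝓑.Word ν, ∀ x ∈ 𝓑.S, ∀ y ∈ 𝓑.S,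
      gWord ω x ≤ gWord ω y * Real.exp (M₀ * |x - y|)) :
    matrixSpectralRadius (𝓣.L 0 r) = lam 𝓑 0 ^ ν := by
  have hr1 : 1 ≤ r := by omega
  -- the cone of parameter `0` has no interior; a small positive parameter serves instead
  obtain ⟨M, hM0, hψ, hinv⟩ : ∃ M : ℝ, 0 < M ∧
      psi r * (M * eta r * 𝓣.h) * Real.exp (M * eta r * 𝓣.h) < 1 ∧
      kappa₁ 𝓑 r ν * Real.exp (M * eta r * 𝓣.h) /
        (1 - psi r * (M * eta r * 𝓣.h) * Real.exp (M * eta r * 𝓣.h)) < 1 := by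
    have c1 : ContinuousAt (fun M : ℝ =>
        psi r * (M * eta r * 𝓣.h) * Real.exp (M * eta r * 𝓣.h)) 0 := by fun_prop
    have c2 : ContinuousAt (fun M : ℝ => kappa₁ 𝓑 r ν * Real.exp (M * eta r * 𝓣.h) /
        (1 - psi r * (M * eta r * 𝓣.h) * Real.exp (M * eta r * 𝓣.h))) 0 := by
      have : (1 - psi r * (0 * eta r * 𝓣.h) * Real.exp (0 * eta r * 𝓣.h)) ≠ 0 := by simp
      fun_prop (disch := assumption)
    have e1 := c1.eventually_lt_const (u := 1) (by simp)
    have e2 := c2.eventually_lt_const (u := 1) (by simpa using hκ)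
    have h3 : ∀ᶠ M : ℝ in 𝓝[>] 0, 0 < M := self_mem_nhdsWithin
    obtain ⟨M, hM, h1, h2⟩ := (h3.and ((e1.and e2).filter_mono nhdsWithin_le_nhds)).exists
    exact ⟨M, hM, h1, h2⟩
  have h := spectralRadius_bounds (𝓣 := 𝓣) (s := 0) (M := M) (ε := 0) (r := r) (n₀ := 0) hr1 hν
    le_rfl le_rfl (fun F hF => by
      refine cone_mono ?_ (𝓣.discreteOp_mem_cone hr hν le_rfl hM₀ hM0.le rfl hψ hF)
      have := mul_le_mul_of_nonneg_right hinv.le hM0.le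
      linarith) fun n _ => ⟨by simpa using hM0, by simp [errConst_zero],
        by simp [errConst_zero]⟩
  refine le_antisymm (by simpa using h.1) (by simpa using h.2 one_pos)

lemma exists_thetaWord_mem_cell {r : ℕ} (hr : 1 ≤ r) (ω : 𝓑.Word ν) (ξ : 𝓣.T r) :
    ∃ p, thetaWord ω ξ ∈ 𝓣.cell p := by
  obtain ⟨i, hi⟩ := 𝓣.mapsTo ω
  obtain ⟨j, hj⟩ := 𝓣.exists_cell (hi (𝓣.T_mem_S hr ξ))
  exact ⟨_, hj⟩

lemma abs_L_apply_le {s : ℝ} (hs : 0 ≤ s) {r : ℕ} (hr : 2 ≤ r) (ξ η : 𝓣.T r) :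
    |𝓣.L s r ξ η| ≤ Fintype.card (𝓑.Word ν) * psi r := by
  have hr1 : 1 ≤ r := by omega
  have hξ0 := (𝓑.S_subset (𝓣.T_mem_S hr1 ξ)).1
  rw [L, LinearMap.toMatrix'_apply]
  refine (Finset.abs_sum_le_sum_abs _ _).trans
    ((Finset.sum_le_card_nsmul _ _ (psi r) fun ω _ => ?_).trans_eq (by simp))
  have h1 : gWord ω ξ ^ s ≤ 1 := Real.rpow_le_one (gWord_nonneg _ _) (gWord_le_one ω hξ0) hs
  obtain ⟨p, hp⟩ := 𝓣.exists_thetaWord_mem_cell hr1 ω ξ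
  obtain ⟨y, hy, e⟩ := 𝓣.exists_ref hp
  rw [𝓣.interp_eq hr1 _ p hp, e, localInterp_eq_refInterp, abs_mul,
    abs_of_nonneg (Real.rpow_nonneg (gWord_nonneg _ _) _)]
  have h2 := 𝓣.abs_refInterp_sub_le hr (Pi.single η 1) p (m := 0) (K := 1)
    (fun k => by rw [sub_zero, Pi.single_apply]; split_ifs <;> simp) hy
  rw [sub_zero, mul_one] at h2
  exact (mul_le_mul h1 h2 (abs_nonneg _) zero_le_one).trans_eq (one_mul _)

end Mesh

lemma Hconst_le {𝓑 : Digits} {s : ℝ} (hs : 0 ≤ s) {r : ℕ} (hr : 1 ≤ r) (hχ : 0 < 𝓑.χ)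
    {h μ μ₀ : ℝ} (hh : h ≤ 1) (hμ₀ : 0 ≤ μ₀) (hμ : μ ≤ μ₀) :
    Hconst 𝓑 s r h μ ≤ Hconst 𝓑 s r 1 μ₀ := by
  have h1 := sin_pi_div_pos (r := r)
  have h2 := cos_pos_aux hr
  unfold Hconst
  gcongr

/-- The entries of the two rescaled matrices differ by `O(h ^ r)`: the entries of `𝐋` are bounded by the
number of words times `ψ(r)`, and `H` stays bounded while `μ` and `h` do. -/
theorem entries_diff_le {𝓑 : Digits} {s : ℝ} (hs : 0 ≤ s) {r ν : ℕ} (hr : 2 ≤ r)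
    (hχ : 0 < 𝓑.χ) (μ₀ : ℝ) :
    ∃ C : ℝ, ∃ h₀ : ℝ, 0 < h₀ ∧ ∀ 𝓣 : Mesh 𝓑 ν, 𝓣.μ ≤ μ₀ → 𝓣.h ≤ h₀ → ∀ ξ η : 𝓣.T r,
      |((1 - 𝓣.H s r * 𝓣.h ^ r)⁻¹ • 𝓣.L s r) ξ η -
        ((1 + 𝓣.H s r * 𝓣.h ^ r)⁻¹ • 𝓣.L s r) ξ η| ≤ C * 𝓣.h ^ r := by
  have hr1 : 1 ≤ r := by omega
  set H₀ := Hconst 𝓑 s r 1 (max μ₀ 0) with hH₀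
  have hH₀0 : 0 ≤ H₀ := by
    have h1 := sin_pi_div_pos (r := r)
    have h2 := cos_pos_aux hr1
    have h3 : 0 ≤ max μ₀ 0 := le_max_right _ _
    rw [hH₀, Hconst]
    positivity
  refine ⟨4 * H₀ * (Fintype.card (𝓑.Word ν) * psi r), 1 / (2 * (H₀ + 1)), by positivity,
    fun 𝓣 hμ hh ξ η => ?_⟩
  have hh0 := 𝓣.h_pos
  have hh1 : 𝓣.h ≤ 1 := by
    refine hh.trans ?_
    rw [div_le_one (by positivity)]
    linarith
  have hHle : 𝓣.H s r ≤ H₀ := Hconst_le hs hr1 hχ hh1 (le_max_right _ _) (hμ.trans (le_max_left _ _))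
  have hHnn := 𝓣.H_nonneg hs hr1
  have hpow : 𝓣.h ^ r ≤ 𝓣.h := pow_le_of_le_one hh0.le hh1 (by omega)
  set ε := 𝓣.H s r * 𝓣.h ^ r with hε
  have hε0 : 0 ≤ ε := by positivity
  have hεle : ε ≤ H₀ * 𝓣.h ^ r := by rw [hε]; gcongr
  have hε2 : ε ≤ 1 / 2 := by
    calc ε ≤ H₀ * 𝓣.h := hεle.trans (by gcongr)
      _ ≤ (H₀ + 1) * (1 / (2 * (H₀ + 1))) := by gcongr; linarith
      _ = 1 / 2 := by field_simp
  have e : ((1 - ε)⁻¹ • 𝓣.L s r) ξ η - ((1 + ε)⁻¹ • 𝓣.L s r) ξ η =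
      2 * ε / ((1 - ε) * (1 + ε)) * 𝓣.L s r ξ η := by
    have h1 : 1 - ε ≠ 0 := by linarith
    have h2 : 1 + ε ≠ 0 := by linarith
    simp only [Matrix.smul_apply, smul_eq_mul]
    field_simp
    ring
  have hfac : 2 * ε / ((1 - ε) * (1 + ε)) ≤ 4 * ε := by
    rw [div_le_iff₀ (mul_pos (by linarith) (by linarith))]
    have : 0 ≤ ε * (1 / 2 - ε ^ 2) := mul_nonneg hε0 (by nlinarith)
    linarith
  have hfac0 : 0 ≤ 2 * ε / ((1 - ε) * (1 + ε)) :=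
    div_nonneg (by linarith) (mul_nonneg (by linarith) (by linarith))
  rw [e, abs_mul, abs_of_nonneg hfac0]
  have hψ := psi_pos r
  calc 2 * ε / ((1 - ε) * (1 + ε)) * |𝓣.L s r ξ η|
      ≤ 4 * (H₀ * 𝓣.h ^ r) * (Fintype.card (𝓑.Word ν) * psi r) :=
        mul_le_mul (hfac.trans (by linarith)) (𝓣.abs_L_apply_le hs hr ξ η) (abs_nonneg _)
          (by positivity)
    _ = _ := by ring

lemma rpow_one_div_le_of_le_mul_pow {R lam q : ℝ} {ν : ℕ} (hν : 1 ≤ ν) (hR : 0 ≤ R)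
    (hlam : 0 ≤ lam) (hq : 0 < q) (h : R ≤ q * lam ^ ν) :
    (q⁻¹ * R) ^ (1 / (ν : ℝ)) ≤ lam := by
  have h1 : q⁻¹ * R ≤ lam ^ ν := by rwa [inv_mul_le_iff₀ hq]
  refine (Real.rpow_le_rpow (by positivity) h1 (by positivity)).trans_eq ?_
  rw [one_div, Real.pow_rpow_inv_natCast hlam (by omega)]

lemma le_rpow_one_div_of_pow_le {x lam : ℝ} {ν : ℕ} (hν : 1 ≤ ν) (hlam : 0 ≤ lam)
    (h : lam ^ ν ≤ x) : lam ≤ x ^ (1 / (ν : ℝ)) := by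
  have := Real.rpow_le_rpow (by positivity) h (by positivity : 0 ≤ 1 / (ν : ℝ))
  rwa [one_div, Real.pow_rpow_inv_natCast hlam (by omega), ← one_div] at this

end CFTransfer

end

open CFTransfer
theorem theorem8p2 (𝓑 : Digits) (r ν : ℕ) (s : ℝ) (hr : 2 ≤ r) (hν : 1 ≤ ν)
    (hs : 0 ≤ s) (hs' : s ≤ 3 / 2) (hχ : 1 ≤ 𝓑.χ) (hκ₁ : kappa₁ 𝓑 r ν < 1) :
    -- the two-sided bound
    (∀ (𝓣 : Mesh 𝓑 ν) (κ₂ M M₀ u : ℝ),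
      kappa₁ 𝓑 r ν < κ₂ → κ₂ < 1 →
      -- `M₀` is an admissible constant `M₀(ν)`
      (∀ ω : 𝓑.Word ν, ∀ x ∈ 𝓑.S, ∀ y ∈ 𝓑.S,
        gWord ω x ≤ gWord ω y * Real.exp (M₀ * |x - y|)) →
      M = Mconst 𝓑 s r ν κ₂ → 2 * s * M₀ / (κ₂ - kappa₁ 𝓑 r ν) ≤ M →
      -- the mesh size is small enough
      u = M * eta r * 𝓣.h →
      psi r * u * Real.exp u < 1 →
      kappa₁ 𝓑 r ν * Real.exp u / (1 - psi r * u * Real.exp u) < κ₂ - s * M₀ / M →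
      2 + 𝓣.H s r * 𝓣.h ^ r * (1 + 𝓣.h ^ (2 * r + 2)) + 𝓣.h ^ 2 ≤ 2 / (κ₂ - kappa₁ 𝓑 r ν) →
      𝓣.h ≤ 1 / 5 →
      ((1 + 𝓣.H s r * 𝓣.h ^ r)⁻¹ * matrixSpectralRadius (𝓣.L s r)) ^ (1 / (ν : ℝ)) ≤ lam 𝓑 s ∧
      (𝓣.H s r * 𝓣.h ^ r < 1 →
        lam 𝓑 s ≤
          ((1 - 𝓣.H s r * 𝓣.h ^ r)⁻¹ * matrixSpectralRadius (𝓣.L s r)) ^ (1 / (ν : ℝ)))) ∧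
    -- the entries of the two scaled matrices differ by `O(h ^ r)`, with a uniform constant
    (∀ μ₀ : ℝ, ∃ C : ℝ, ∃ h₀ : ℝ, 0 < h₀ ∧
      ∀ 𝓣 : Mesh 𝓑 ν, 𝓣.μ ≤ μ₀ → 𝓣.h ≤ h₀ → ∀ ξ η : 𝓣.T r,
        |((1 - 𝓣.H s r * 𝓣.h ^ r)⁻¹ • 𝓣.L s r) ξ η -
          ((1 + 𝓣.H s r * 𝓣.h ^ r)⁻¹ • 𝓣.L s r) ξ η| ≤ C * 𝓣.h ^ r) := by

  refine ⟨fun 𝓣 κ₂ M M₀ u hκ hκ₂ hM₀ hM _ hu hψ hinv hH hh => ?_,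
    entries_diff_le hs hr (by linarith)⟩
  have hε : 0 ≤ 𝓣.H s r * 𝓣.h ^ r :=
    mul_nonneg (𝓣.H_nonneg hs (by omega)) (pow_nonneg 𝓣.h_pos.le r)
  have hR : 0 ≤ matrixSpectralRadius (𝓣.L s r) := ENNReal.toReal_nonneg
  have hlam : 0 ≤ lam 𝓑 s := ENNReal.toReal_nonneg
  suffices h : matrixSpectralRadius (𝓣.L s r) ≤ (1 + 𝓣.H s r * 𝓣.h ^ r) * lam 𝓑 s ^ ν ∧
      (𝓣.H s r * 𝓣.h ^ r < 1 → lam 𝓑 s ^ ν ≤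
        (1 - 𝓣.H s r * 𝓣.h ^ r)⁻¹ * matrixSpectralRadius (𝓣.L s r)) from
    ⟨rpow_one_div_le_of_le_mul_pow hν hR hlam (by linarith) h.1,
      fun h1 => le_rpow_one_div_of_pow_le hν hlam (h.2 h1)⟩
  rcases hs.lt_or_eq with hs0 | rfl
  · exact 𝓣.spectralRadius_bounds_of_pos hr hν hs0 hs' hχ hκ hκ₂ hM₀ hM hu hψ hinv hH hh
  · have h0 := 𝓣.spectralRadius_bounds_zero hr hν hκ₁ hM₀
    rw [← h0]
    exact ⟨le_mul_of_one_le_left hR (by linarith),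
      fun h1 => le_mul_of_one_le_left hR (one_le_inv_iff₀.2 ⟨by linarith, by linarith⟩)⟩
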